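/- Let $p\ge 1$. There is an integer $k=k(p)$ such that the following holds. Let $f:\mathbb R\times\mathbb R\to\mathbb R$, $(x,\alpha)\mapsto f(x,\alpha)$, be of class $C^{p+6}$ with $$f(0,\alpha)=0\ \text{ for all small } |\alpha|,\qquad f_x(0,0)=0,\quad f_{xx}(0,0)\neq0,\quad f_{x\alpha}(0,0)\ne 0 ,$$ and let $\Phi(h,\cdot,\alpha)$ be the time-$h$ map of $\dot x=f(x,\alpha)$. Let $\varphi(h,x,\alpha)$, $h\ge0$, be a one-step method that is of class $C^k$ near the origin (up to $h=0$), and suppose that, for all small $h\ge 0$, $|x|$ and $|\alpha|$, $\varphi(h,0,\alpha)=0$ and $|\Phi(h,x,\alpha)-\varphi(h,x,\alpha)|\le const\cdot h^{p+1}$. Then there are positive numbers $h_0,\varepsilon_0,\alpha_0$, $r'\le r$, $\rho'\le\rho$ and $C$ (depending on $f$ and $\varphi$ only) with the following properties. 1. (Normal forms.) There are $C^{p+3}$ invertible coordinate and parameter changes $\eta=\chi_\Phi(h,x,\alpha)$, $\beta=b_\Phi(h,\alpha)$ and $\eta=\chi_\varphi(h,x,\alpha)$, $\beta=b_\varphi(h,\alpha)$,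 defined for $0\le h\le h_0$, $|x|\le r$, $|\alpha|\le\rho$, with values in $|\eta|\le\varepsilon_0$, $|\beta|\le\alpha_0$, with $\chi_\Phi(h,0,\alpha)=\chi_\varphi(h,0,\alpha)=0$ and with non-vanishing $x$- resp. $\alpha$-derivatives, which transform $\Phi$ and $\varphi$ into $$\mathcal N_\Phi(h,\eta,\beta)=(1+h\beta)\eta+h\eta^2+h\eta^3 e_\Phi(h,\eta,\beta),\qquad \mathcal N_\varphi(h,\eta,\beta)=(1+h\beta)\eta+h\eta^2+h\eta^3 e_\varphi(h,\eta,\beta),$$ where $e_\Phi,e_\varphi$ are $C^{p+3}$ on $[0,h_0]\times[-\varepsilon_0,\varepsilon_0]\times[-\alpha_0,\alpha_0]$. Moreover $|\chi_\Phi-\chi_\varphi|$, $|b_\Phi-b_\varphi|$ and $|e_\Phi-e_\varphi|$ are at most $C h^p$. 2. (Conjugacy of the normal forms.) For all $0<h\le h_0$, $|\alpha|\le\alpha_0$ there is an increasing homeomorphism $J=J(h,\cdot,\alpha)$ of $[-\varepsilon_0,\varepsilon_0]$ with $J(g(x))=G(J(x))$ whenever $x,g(x)\in[-\varepsilon_0,\varepsilon_0]$,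 where $g=\mathcal N_\varphi(h,\cdot,\alpha)$ and $G=\mathcal N_\Phi(h,\cdot,\alpha)$. It is built from fundamental domains, as follows (inverses are taken on $[-\varepsilon_0,\varepsilon_0]$). - If $\alpha\ne0$, let $x_n=g^{[n]}(-\alpha/3)$ and $y_n=g^{[-n]}(-\alpha/3)$. Then $J$ is affine on $[x_1,x_0]$ with $J(x_0)=x_0$ and $J(x_1)=G(x_0)$, $J=G\circ J\circ g^{-1}$ on $[x_{n+1},x_n]$ for $n\ge1$, and $J=G^{-1}\circ J\circ g$ on $[y_n,y_{n+1}]$ for $n\ge0$. - With $z_n=g^{[n]}(-\varepsilon_0)$, $J$ is affine on $[z_0,z_1]$ with $J(z_0)=z_0$ and $J(z_1)=G(z_0)$, and $J=G\circ J\circ g^{-1}$ on $[z_n,z_{n+1}]$ for $n\ge1$. - With $w_n=g^{[-n]}(\varepsilon_0)$, $J$ is affine on $[w_1,w_0]$ with $J(w_0)=w_0$ and $J(w_1)=G^{-1}(w_0)$, and $J=G^{-1}\circ J\circ g$ on $[w_{n+1},w_n]$ for $n\ge1$. - $J(0)=0$, and $J$ maps a nonzero fixed point of $g$ in $[-\varepsilon_0,\varepsilon_0]$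 to a nonzero fixed point of $G$. 3. (Closeness.) $|x-J(h,x,\alpha)|\le C h^p$ for all $0<h\le h_0$, $|x|\le\varepsilon_0$, $|\alpha|\le\alpha_0$. 4. (Original coordinates.) For $0<h\le h_0$ there is a parameter shift $\alpha\mapsto\tilde\alpha=\tilde\alpha(h,\alpha)$, an increasing homeomorphism of $[-\rho',\rho']$ onto its image in $[-\rho,\rho]$, with $b_\varphi(h,\tilde\alpha)=b_\Phi(h,\alpha)$ and $|\alpha-\tilde\alpha|\le Ch^p$; and for $|\alpha|\le\rho'$ there is an increasing homeomorphism $\mathcal J(h,\cdot,\alpha)$ of $[-r',r']$ onto its image in $[-r,r]$ such that, for $|x|\le r'$, $J\big(h,\chi_\varphi(h,\mathcal J(h,x,\alpha),\tilde\alpha),b_\Phi(h,\alpha)\big)=\chi_\Phi(h,x,\alpha)$, and $$\mathcal J(h,\Phi(h,x,\alpha),\alpha)=\varphi(h,\mathcal J(h,x,\alpha),\tilde\alpha)\quad\text{if } |\Phi(h,x,\alpha)|\le r',\qquad |x-\mathcal J(h,x,\alpha)|\le C h^p .$$ Furthermore, the order $h^p$ is optimal: for every $p\ge1$ there are $f$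 and $\varphi$ satisfying the hypotheses above for every $k$, for which 1.--4. hold with some choice of the objects above and for which, with some constant $c>0$ and for all $0<h\le h_0$: for $|\beta|\le\alpha_0$, every continuous injective $K:[-\varepsilon_0,\varepsilon_0]\to[-\varepsilon_0,\varepsilon_0]$ with $K\circ \mathcal N_\varphi(h,\cdot,\beta)=\mathcal N_\Phi(h,\cdot,\beta)\circ K$ (wherever the argument and its image under $\mathcal N_\varphi(h,\cdot,\beta)$ lie in $[-\varepsilon_0,\varepsilon_0]$), in particular $K=J(h,\cdot,\beta)$, satisfies $|x-K(x)|\ge c\,\beta^2h^p$ for some $|x|\le\varepsilon_0$; and for $|\alpha|\le\rho'$, every continuous injective $K:[-r',r']\to[-r,r]$ with $K(\Phi(h,x,\alpha))=\varphi(h,K(x),\tilde\alpha)$ (wherever $|x|,|\Phi(h,x,\alpha)|\le r'$) satisfies $|x-K(x)|\ge c\,\alpha^2h^p$ for some $|x|\le r'$. -/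

import Mathlib

open Set Filter Topology

noncomputable section

/-- `u` solves `u' = f (u, α)` on the time interval `[0, h]` with `u 0 = x`. -/
def IsSolutionOn (f : ℝ → ℝ → ℝ) (α x h : ℝ) (u : ℝ → ℝ) : Prop :=
  u 0 = x ∧ ∀ t ∈ Icc (0 : ℝ) h, HasDerivWithinAt u (f (u t) α) (Icc 0 h) t

open Classical in
/-- The time-`h` map `Φ(h, x, α)` of the flow of `x' = f (x, α)`, `h ≥ 0`: the value at time `h`
of the solution starting at `x` (and `0` if no solution exists up to time `h`, which does not
happen near the equilibrium at the origin when `f` is continuously differentiable). -/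
def timeMap (f : ℝ → ℝ → ℝ) (h x α : ℝ) : ℝ :=
  if H : ∃ u : ℝ → ℝ, IsSolutionOn f α x h u then H.choose h else 0

/-- The transcritical conditions: `f(0, α) = 0` for all small `|α|`, and at the origin
`f_x = 0`, `f_xx ≠ 0`, `f_xα ≠ 0`. -/
structure TranscriticalConditions (f : ℝ → ℝ → ℝ) : Prop where
  equilibrium : ∃ α₁ > 0, ∀ α ∈ Icc (-α₁) α₁, f 0 α = 0
  deriv_x : deriv (fun x => f x 0) 0 = 0
  deriv_xx : deriv (deriv (fun x => f x 0)) 0 ≠ 0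
  deriv_xα : deriv (fun α => deriv (fun x => f x α) 0) 0 ≠ 0

/-- The one-step method `φ(h, x, α)` has order `p` for `x' = f (x, α)` near the origin:
`|Φ(h, x, α) - φ(h, x, α)| ≤ C h ^ (p + 1)` for small `h ≥ 0`, `|x|`, `|α|`. -/
def HasOrderNearOrigin (f : ℝ → ℝ → ℝ) (φ : ℝ → ℝ → ℝ → ℝ) (p : ℕ) : Prop :=
  ∃ h₁ > 0, ∃ ε₁ > 0, ∃ α₁ > 0, ∃ C > 0,
    ∀ h ∈ Icc (0 : ℝ) h₁, ∀ x ∈ Icc (-ε₁) ε₁, ∀ α ∈ Icc (-α₁) α₁,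
      |timeMap f h x α - φ h x α| ≤ C * h ^ (p + 1)

/-- `φ(h, 0, α) = 0` for all small `h ≥ 0` and `|α|`. -/
def PreservesEquilibrium (φ : ℝ → ℝ → ℝ → ℝ) : Prop :=
  ∃ h₁ > 0, ∃ α₁ > 0, ∀ h ∈ Icc (0 : ℝ) h₁, ∀ α ∈ Icc (-α₁) α₁, φ h 0 α = 0

/-- The method `φ(h, x, α)`, `h ≥ 0`, is of class `C^k` in all variables near the origin, up to
step-size `h = 0`: for small `h ≥ 0`, `|x|`, `|α|` it is the restriction of a function that is
`C^k` in a full neighbourhood of the origin. (The values of `φ` itself at `h < 0` are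
irrelevant.) -/
def SmoothNearOrigin (k : ℕ) (φ : ℝ → ℝ → ℝ → ℝ) : Prop :=
  ∃ ψ : ℝ × ℝ × ℝ → ℝ, ContDiffAt ℝ (k : WithTop ℕ∞) ψ (0, 0, 0) ∧
    ∃ h₁ > 0, ∃ ε₁ > 0, ∃ α₁ > 0,
      ∀ h ∈ Icc (0 : ℝ) h₁, ∀ x ∈ Icc (-ε₁) ε₁, ∀ α ∈ Icc (-α₁) α₁, φ h x α = ψ (h, x, α)

/-- The closed box `[0, h₀] × [-r, r] × [-ρ, ρ]` in `(h, x, α)`-space. -/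
def box (h₀ r ρ : ℝ) : Set (ℝ × ℝ × ℝ) := Icc 0 h₀ ×ˢ Icc (-r) r ×ˢ Icc (-ρ) ρ

/-- The transcritical normal form map `η ↦ (1 + h β) η + h η² + h η³ e(h, η, β)` with tail `e`. -/
def normalForm (e : ℝ → ℝ → ℝ → ℝ) (h η β : ℝ) : ℝ :=
  (1 + h * β) * η + h * η ^ 2 + h * η ^ 3 * e h η β

/-- The `C^m` invertible coordinate change `η = χ(h, x, α)` and parameter change `β = b(h, α)`,
defined for `h ∈ [0, h₀]`, `|x| ≤ r`, `|α| ≤ ρ` and with values in `|η| ≤ ε₀`, `|β| ≤ α₀`, transform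
the map `x ↦ g(h, x, α)` into the transcritical normal form with the `C^m` tail `e`. -/
structure NormalFormReduction (m : ℕ) (g : ℝ → ℝ → ℝ → ℝ) (h₀ r ρ ε₀ α₀ : ℝ)
    (χ : ℝ → ℝ → ℝ → ℝ) (b : ℝ → ℝ → ℝ) (e : ℝ → ℝ → ℝ → ℝ) : Prop where
  coord_smooth : ContDiffOn ℝ (m : WithTop ℕ∞)
    (fun q : ℝ × ℝ × ℝ => χ q.1 q.2.1 q.2.2) (box h₀ r ρ)
  coord_zero : ∀ h ∈ Icc 0 h₀, ∀ α ∈ Icc (-ρ) ρ, χ h 0 α = 0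
  coord_deriv : ∀ h ∈ Icc 0 h₀, ∀ x ∈ Icc (-r) r, ∀ α ∈ Icc (-ρ) ρ,
    derivWithin (fun y => χ h y α) (Icc (-r) r) x ≠ 0
  coord_maps : ∀ h ∈ Icc 0 h₀, ∀ x ∈ Icc (-r) r, ∀ α ∈ Icc (-ρ) ρ, χ h x α ∈ Icc (-ε₀) ε₀
  param_smooth : ContDiffOn ℝ (m : WithTop ℕ∞)
    (fun q : ℝ × ℝ => b q.1 q.2) (Icc 0 h₀ ×ˢ Icc (-ρ) ρ)
  param_deriv : ∀ h ∈ Icc 0 h₀, ∀ α ∈ Icc (-ρ) ρ, derivWithin (b h) (Icc (-ρ) ρ) α ≠ 0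
  param_maps : ∀ h ∈ Icc 0 h₀, ∀ α ∈ Icc (-ρ) ρ, b h α ∈ Icc (-α₀) α₀
  tail_smooth : ContDiffOn ℝ (m : WithTop ℕ∞)
    (fun q : ℝ × ℝ × ℝ => e q.1 q.2.1 q.2.2) (box h₀ ε₀ α₀)
  transforms : ∀ h ∈ Icc 0 h₀, ∀ x ∈ Icc (-r) r, ∀ α ∈ Icc (-ρ) ρ, g h x α ∈ Icc (-r) r →
    χ h (g h x α) α = normalForm e h (χ h x α) (b h α)

/-- `K` is a topological conjugacy from the map `g` on `s` to the map `G`, with values in `t`. -/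
structure IsConjugacyOn (g G : ℝ → ℝ) (s t : Set ℝ) (K : ℝ → ℝ) : Prop where
  continuousOn : ContinuousOn K s
  injOn : InjOn K s
  mapsTo : MapsTo K s t
  conj : ∀ x ∈ s, g x ∈ s → K (g x) = G (K x)

/-- The inverse of `g` on `[-ε, ε]`. -/
def localInv (g : ℝ → ℝ) (ε : ℝ) : ℝ → ℝ := Function.invFunOn g (Icc (-ε) ε)

/-- The affine function with value `A` at `a` and value `B` at `b`. -/
def affineInterp (a A b B x : ℝ) : ℝ := A + (x - a) / (b - a) * (B - A)

/-- `J` is obtained on `[-ε, ε]` from the normal forms `g` (of the method) and `G` (of the exact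
flow), at a fixed step-size and the parameter value `β`, by the method of fundamental domains.

Inner region (between the two fixed points, `β ≠ 0`): `x_n = g^[n] (-β/3)`,
`y_n = g^[-n] (-β/3)`; `J` is affine on `[x_1, x_0]` with `J x_0 = x_0`, `J x_1 = G x_0`, and is
extended by `J = G ∘ J ∘ g⁻¹` to `[x_{n+1}, x_n]`, `n ≥ 1`, and by `J = G⁻¹ ∘ J ∘ g` to
`[y_n, y_{n+1}]`, `n ≥ 0`.

Outer region below the fixed points: the same with `z_n = g^[n] (-ε)` in place of `x_n`.

Outer region above the fixed points: the mirror image, with `w_n = g^[-n] ε` and with `g⁻¹`, `G⁻¹`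
in place of `g`, `G`.

Fixed points of `g` are sent to the corresponding fixed points of `G`. -/
structure BuiltFromFundamentalDomains (g G : ℝ → ℝ) (ε β : ℝ) (J : ℝ → ℝ) : Prop where
  inner_start : β ≠ 0 → ∀ x ∈ Icc (g (-β / 3)) (-β / 3),
    J x = affineInterp (g (-β / 3)) (G (-β / 3)) (-β / 3) (-β / 3) x
  inner_forward : β ≠ 0 → ∀ n : ℕ, 1 ≤ n → ∀ x ∈ Icc (g^[n + 1] (-β / 3)) (g^[n] (-β / 3)),
    J x = G (J (localInv g ε x))
  inner_backward : β ≠ 0 → ∀ n : ℕ,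
    ∀ x ∈ Icc ((localInv g ε)^[n] (-β / 3)) ((localInv g ε)^[n + 1] (-β / 3)),
      J x = localInv G ε (J (g x))
  lower_start : ∀ x ∈ Icc (-ε) (g (-ε)), J x = affineInterp (-ε) (-ε) (g (-ε)) (G (-ε)) x
  lower_forward : ∀ n : ℕ, 1 ≤ n → ∀ x ∈ Icc (g^[n] (-ε)) (g^[n + 1] (-ε)),
    J x = G (J (localInv g ε x))
  upper_start : ∀ x ∈ Icc (localInv g ε ε) ε,
    J x = affineInterp (localInv g ε ε) (localInv G ε ε) ε ε x
  upper_backward : ∀ n : ℕ, 1 ≤ n →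
    ∀ x ∈ Icc ((localInv g ε)^[n + 1] ε) ((localInv g ε)^[n] ε), J x = localInv G ε (J (g x))
  fixed_zero : J 0 = 0
  fixed_other : ∀ ω ∈ Icc (-ε) ε, g ω = ω → ω ≠ 0 → G (J ω) = J ω ∧ J ω ≠ 0

/-- All objects of the transcritical conjugacy for the exact time-`h` map `Φ` and the method `φ`. -/
structure TCData where
  /-- bounds for `h` -/
  h₀ : ℝ
  /-- bound for the space variable in normal form coordinates -/
  ε₀ : ℝ
  /-- bound for the parameter in normal form coordinates -/
  α₀ : ℝ
  /-- bound for the space variable in the domain of the coordinate changes -/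
  r : ℝ
  /-- bound for the parameter in the domain of the parameter changes -/
  ρ : ℝ
  /-- bound for the space variable in the domain of the conjugacy in original coordinates -/
  r' : ℝ
  /-- bound for the parameter in the domain of the conjugacy in original coordinates -/
  ρ' : ℝ
  /-- coordinate changes for `Φ` and `φ` -/
  χΦ : ℝ → ℝ → ℝ → ℝ
  χφ : ℝ → ℝ → ℝ → ℝ
  /-- parameter changes for `Φ` and `φ` -/
  bΦ : ℝ → ℝ → ℝ
  bφ : ℝ → ℝ → ℝ
  /-- tails of the normal forms of `Φ` and `φ` -/
  eΦ : ℝ → ℝ → ℝ → ℝ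
  eφ : ℝ → ℝ → ℝ → ℝ
  /-- the conjugacy between the normal forms -/
  J : ℝ → ℝ → ℝ → ℝ
  /-- the parameter shift `α ↦ α̃` in the original parameter -/
  shift : ℝ → ℝ → ℝ
  /-- the conjugacy in the original coordinates -/
  Jo : ℝ → ℝ → ℝ → ℝ

/-- The constructed conjugacy with its `O(h^p)` closeness estimates, uniform constant `C`. -/
structure TCData.IsCloseConjugacy (D : TCData) (p : ℕ) (Φ φ : ℝ → ℝ → ℝ → ℝ) (C : ℝ) :
    Prop where
  h₀_pos : 0 < D.h₀
  ε₀_pos : 0 < D.ε₀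
  α₀_pos : 0 < D.α₀
  r'_pos : 0 < D.r'
  r'_le : D.r' ≤ D.r
  ρ'_pos : 0 < D.ρ'
  ρ'_le : D.ρ' ≤ D.ρ
  /-- normal forms of both maps, with `O(h^p)`-close transformations and tails -/
  reductionΦ : NormalFormReduction (p + 3) Φ D.h₀ D.r D.ρ D.ε₀ D.α₀ D.χΦ D.bΦ D.eΦ
  reductionφ : NormalFormReduction (p + 3) φ D.h₀ D.r D.ρ D.ε₀ D.α₀ D.χφ D.bφ D.eφ
  coord_close : ∀ h ∈ Icc 0 D.h₀, ∀ x ∈ Icc (-D.r) D.r, ∀ α ∈ Icc (-D.ρ) D.ρ,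
    |D.χΦ h x α - D.χφ h x α| ≤ C * h ^ p
  param_close : ∀ h ∈ Icc 0 D.h₀, ∀ α ∈ Icc (-D.ρ) D.ρ, |D.bΦ h α - D.bφ h α| ≤ C * h ^ p
  tail_close : ∀ h ∈ Icc 0 D.h₀, ∀ η ∈ Icc (-D.ε₀) D.ε₀, ∀ β ∈ Icc (-D.α₀) D.α₀,
    |D.eΦ h η β - D.eφ h η β| ≤ C * h ^ p
  /-- `J(h, ·, β)` is an increasing homeomorphism of `[-ε₀, ε₀]` that conjugates the normal forms
  and is built from fundamental domains -/
  built : ∀ h ∈ Ioc 0 D.h₀, ∀ β ∈ Icc (-D.α₀) D.α₀,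
    BuiltFromFundamentalDomains (fun η => normalForm D.eφ h η β)
      (fun η => normalForm D.eΦ h η β) D.ε₀ β (fun η => D.J h η β)
  conj : ∀ h ∈ Ioc 0 D.h₀, ∀ β ∈ Icc (-D.α₀) D.α₀,
    IsConjugacyOn (fun η => normalForm D.eφ h η β) (fun η => normalForm D.eΦ h η β)
      (Icc (-D.ε₀) D.ε₀) (Icc (-D.ε₀) D.ε₀) (fun η => D.J h η β)
  mono : ∀ h ∈ Ioc 0 D.h₀, ∀ β ∈ Icc (-D.α₀) D.α₀,
    StrictMonoOn (fun η => D.J h η β) (Icc (-D.ε₀) D.ε₀)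
  surj : ∀ h ∈ Ioc 0 D.h₀, ∀ β ∈ Icc (-D.α₀) D.α₀,
    SurjOn (fun η => D.J h η β) (Icc (-D.ε₀) D.ε₀) (Icc (-D.ε₀) D.ε₀)
  /-- the closeness estimate -/
  close : ∀ h ∈ Ioc 0 D.h₀, ∀ x ∈ Icc (-D.ε₀) D.ε₀, ∀ α ∈ Icc (-D.α₀) D.α₀,
    |x - D.J h x α| ≤ C * h ^ p
  /-- the parameter shift is a homeomorphism onto its image, aligns the normal form parameters and
  is `O(h^p)`-close to the identity -/
  shift_maps : ∀ h ∈ Ioc 0 D.h₀, MapsTo (D.shift h) (Icc (-D.ρ') D.ρ') (Icc (-D.ρ) D.ρ)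
  shift_continuousOn : ∀ h ∈ Ioc 0 D.h₀, ContinuousOn (D.shift h) (Icc (-D.ρ') D.ρ')
  shift_mono : ∀ h ∈ Ioc 0 D.h₀, StrictMonoOn (D.shift h) (Icc (-D.ρ') D.ρ')
  shift_aligns : ∀ h ∈ Ioc 0 D.h₀, ∀ α ∈ Icc (-D.ρ') D.ρ', D.bφ h (D.shift h α) = D.bΦ h α
  shift_close : ∀ h ∈ Ioc 0 D.h₀, ∀ α ∈ Icc (-D.ρ') D.ρ', |α - D.shift h α| ≤ C * h ^ p
  /-- the conjugacy `Jo = χφ⁻¹ ∘ J⁻¹ ∘ χΦ` between `Φ` and `φ` in the original coordinates -/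
  orig_eq : ∀ h ∈ Ioc 0 D.h₀, ∀ x ∈ Icc (-D.r') D.r', ∀ α ∈ Icc (-D.ρ') D.ρ',
    D.J h (D.χφ h (D.Jo h x α) (D.shift h α)) (D.bΦ h α) = D.χΦ h x α
  orig_conj : ∀ h ∈ Ioc 0 D.h₀, ∀ α ∈ Icc (-D.ρ') D.ρ',
    IsConjugacyOn (fun x => Φ h x α) (fun x => φ h x (D.shift h α))
      (Icc (-D.r') D.r') (Icc (-D.r) D.r) (fun x => D.Jo h x α)
  orig_mono : ∀ h ∈ Ioc 0 D.h₀, ∀ α ∈ Icc (-D.ρ') D.ρ',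
    StrictMonoOn (fun x => D.Jo h x α) (Icc (-D.r') D.r')
  orig_close : ∀ h ∈ Ioc 0 D.h₀, ∀ x ∈ Icc (-D.r') D.r', ∀ α ∈ Icc (-D.ρ') D.ρ',
    |x - D.Jo h x α| ≤ C * h ^ p

/-- No conjugacy, neither between the two normal forms nor between the original maps with aligned
parameters, is closer to the identity than `c α² h^p`. -/
structure TCData.IsOptimal (D : TCData) (p : ℕ) (Φ φ : ℝ → ℝ → ℝ → ℝ) (c : ℝ) : Prop where
  normal : ∀ h ∈ Ioc 0 D.h₀, ∀ β ∈ Icc (-D.α₀) D.α₀, ∀ K : ℝ → ℝ,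
    IsConjugacyOn (fun η => normalForm D.eφ h η β) (fun η => normalForm D.eΦ h η β)
      (Icc (-D.ε₀) D.ε₀) (Icc (-D.ε₀) D.ε₀) K →
    ∃ x ∈ Icc (-D.ε₀) D.ε₀, c * β ^ 2 * h ^ p ≤ |x - K x|
  orig : ∀ h ∈ Ioc 0 D.h₀, ∀ α ∈ Icc (-D.ρ') D.ρ', ∀ K : ℝ → ℝ,
    IsConjugacyOn (fun x => Φ h x α) (fun x => φ h x (D.shift h α))
      (Icc (-D.r') D.r') (Icc (-D.r) D.r) K →
    ∃ x ∈ Icc (-D.r') D.r', c * α ^ 2 * h ^ p ≤ |x - K x|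

/-- The hypotheses on `f` and on the method `φ`, of smoothness `k`. -/
structure TCHypotheses (p k : ℕ) (f : ℝ → ℝ → ℝ) (φ : ℝ → ℝ → ℝ → ℝ) : Prop where
  smooth_f : ContDiff ℝ ((p + 6 : ℕ) : WithTop ℕ∞) (fun q : ℝ × ℝ => f q.1 q.2)
  smooth_φ : SmoothNearOrigin k φ
  transcritical : TranscriticalConditions f
  order : HasOrderNearOrigin f φ p
  equilibrium : PreservesEquilibrium φ

end

/-!
The time-`h` map and the method both fix the equilibrium and are `x + O(h)`, so near the origin they
have expansions `x + h x (A₀(h, α) + A₁(h, α) x + A₂(h, x, α) x²)`: three Hadamard quotients of the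
increment (`TCHypotheses.exists_expansions`). The increment of the exact flow is as smooth as `f`,
since the solution, rescaled to the time interval `[0, 1]`, is given by the implicit function theorem
in the space of continuous functions (`exists_timeMap_increment`). The order condition gives
`O(h^p)` for the difference of the increments; Hadamard quotients in `h` turn the difference into
`h^p` times a smooth function, so that this closeness passes to `A₀`, `A₁`, `A₂`. The
transcritical conditions say that `A₀(0, 0) = 0` and that `A₁` and `∂A₀/∂α` do not vanish at the
origin. Hence `η = A₁(h, α) x`, `β = A₀(h, α)` are admissible changes and produce the normal form,
with tail `A₂ / A₁²` (`HasExpansion.eventually_transforms`, `AreClose.isBigO_nfTail`).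

At a fixed step-size and parameter, two normal forms with tails that differ by at most `δ` are
conjugate by a homeomorphism within `2100 δ` of the identity (`exists_nf_conjugacy`). The conjugacy
carries orbits to orbits: each of the three regions cut out by the fixed points is parametrized by
`ℝ` through a fundamental domain, the map acting as a unit translation (`orbitParam`), and the
conjugacy matches the parametrizations. Corresponding orbits remain close for all times because the
local error of one step, `h δ` times the cube of the distance to `0`, is absorbed by contraction: the
maps contract below the fixed points, the inverses contract above them, and between them one of the
two contracts near `0`. On the remaining part of the inner region the bound comes from a weighted
distance, with weight `1 + 5 (a + b)` in units of `-β`, which is not increased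
(`weight_supersolution`). All constants are uniform in `h` and `β`, so `δ = O(h^p)` gives the
closeness estimate.

In the original coordinates the parameter shift is `B₀⁻¹ ∘ A₀`, where `B₀`, `B₁` are the coefficients
of the method, and the conjugacy is `χφ⁻¹ ∘ J⁻¹ ∘ χΦ` (`isCloseConjugacy_conjData`).

For optimality, `h^(p+1) x³` is added to the time-`h` map of `x' = α x + x²`. This changes the tail by
a multiple of `h^p` and nothing else, so the nonzero fixed points are apart by at least a multiple of
`β² h^p` (`TailBound.fixed_gap`), and a conjugacy must carry fixed points to fixed points.
-/

noncomputable section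

/-! ### Superposition operators and Hadamard quotients -/

/-- Pointwise application of operator-valued functions, as a continuous bilinear map. -/
def applyCLM (X V W : Type) [TopologicalSpace X] [CompactSpace X]
    [NormedAddCommGroup V] [NormedSpace ℝ V] [NormedAddCommGroup W] [NormedSpace ℝ W] :
    C(X, V →L[ℝ] W) →L[ℝ] C(X, V) →L[ℝ] C(X, W) :=
  LinearMap.mkContinuous₂
    (LinearMap.mk₂ ℝ (fun (A : C(X, V →L[ℝ] W)) (v : C(X, V)) =>
        (⟨fun x => A x (v x), by fun_prop⟩ : C(X, W)))
      (fun _ _ _ => by ext; simp) (fun _ _ _ => by ext; simp)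
      (fun _ _ _ => by ext; simp) (fun _ _ _ => by ext; simp)) 1
    (fun A v => by
      rw [one_mul]
      refine (ContinuousMap.norm_le _ (by positivity)).2 fun x => ?_
      exact ((A x).le_opNorm _).trans (mul_le_mul (A.norm_coe_le_norm x) (v.norm_coe_le_norm x)
        (norm_nonneg _) (by positivity)))

/-- A `C¹` function with derivative `f'` has a differentiable superposition operator `u ↦ f ∘ u`
on continuous functions over a compact space. -/
theorem hasFDerivAt_postcomp {X V W : Type} [TopologicalSpace X] [CompactSpace X]
    [NormedAddCommGroup V] [NormedSpace ℝ V] [ProperSpace V]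
    [NormedAddCommGroup W] [NormedSpace ℝ W] (f : C(V, W)) (f' : C(V, V →L[ℝ] W))
    (hf : ∀ v, HasFDerivAt f (f' v) v) (u : C(X, V)) :
    HasFDerivAt (fun u : C(X, V) => f.comp u) (applyCLM X V W (f'.comp u)) u := by
  rw [hasFDerivAt_iff_isLittleO_nhds_zero, Asymptotics.isLittleO_iff]
  intro c hc
  have huc : UniformContinuousOn f' (Metric.closedBall 0 (‖u‖ + 1)) :=
    (isCompact_closedBall _ _).uniformContinuousOn_of_continuous f'.continuous.continuousOn
  rw [Metric.uniformContinuousOn_iff] at huc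
  obtain ⟨δ, hδ, H⟩ := huc c hc
  filter_upwards [Metric.ball_mem_nhds (0 : C(X, V)) (lt_min hδ one_pos)] with v hv
  rw [mem_ball_zero_iff, lt_min_iff] at hv
  refine (ContinuousMap.norm_le _ (by positivity)).2 fun x => ?_
  have hvx : ‖v x‖ ≤ ‖v‖ := v.norm_coe_le_norm x
  have hux : ‖u x‖ ≤ ‖u‖ := u.norm_coe_le_norm x
  have key := Convex.norm_image_sub_le_of_norm_hasFDerivWithin_le' (𝕜 := ℝ) (f := f) (f' := f')
    (φ := f' (u x)) (C := c) (s := Metric.closedBall (u x) ‖v x‖) (x := u x) (y := u x + v x)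
    (fun y _ => (hf y).hasFDerivWithinAt) (fun y hy => ?_) (convex_closedBall _ _)
    (Metric.mem_closedBall_self (norm_nonneg _)) (by simp)
  · refine (le_of_eq ?_).trans (key.trans ?_)
    · simp [applyCLM]
    · simpa using mul_le_mul_of_nonneg_left hvx hc.le
  · rw [mem_closedBall_iff_norm] at hy
    rw [← dist_eq_norm]
    refine (H y ?_ (u x) ?_ ?_).le
    · rw [mem_closedBall_zero_iff]
      calc ‖y‖ = ‖(y - u x) + u x‖ := by simp
        _ ≤ ‖y - u x‖ + ‖u x‖ := norm_add_le _ _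
        _ ≤ ‖u‖ + 1 := by linarith
    · rw [mem_closedBall_zero_iff]; linarith
    · rw [dist_eq_norm]; linarith

/-- The superposition operator of a `C^n` function is `C^n`. -/
theorem contDiff_postcomp {X V : Type} [TopologicalSpace X] [CompactSpace X]
    [NormedAddCommGroup V] [NormedSpace ℝ V] [ProperSpace V] (n : ℕ) :
    ∀ {W : Type} [NormedAddCommGroup W] [NormedSpace ℝ W] (f : C(V, W)), ContDiff ℝ n f →
      ContDiff ℝ n (fun u : C(X, V) => f.comp u) := by
  induction n with
  | zero =>
    intro W _ _ f _
    rw [Nat.cast_zero, contDiff_zero]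
    exact ContinuousMap.continuous_postcomp f
  | succ n ih =>
    intro W _ _ f hf
    push_cast at hf ⊢
    obtain ⟨f', hf', hd⟩ := contDiff_succ_iff_hasFDerivAt.1 hf
    refine contDiff_succ_iff_hasFDerivAt.2 ⟨_, ?_, fun u =>
      hasFDerivAt_postcomp f ⟨f', hf'.continuous⟩ hd u⟩
    exact (applyCLM X V W).contDiff.comp (ih ⟨f', hf'.continuous⟩ hf')

/-- A germ of a `C^n` function extends to a global `C^n` function. -/
theorem ContDiffAt.exists_global {V W : Type} [NormedAddCommGroup V] [NormedSpace ℝ V]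
    [FiniteDimensional ℝ V] [NormedAddCommGroup W] [NormedSpace ℝ W] {n : ℕ} {f : V → W} {a : V}
    (hf : ContDiffAt ℝ n f a) : ∃ g : V → W, ContDiff ℝ n g ∧ g =ᶠ[𝓝 a] f := by
  have hev := hf.eventually (by simp)
  obtain ⟨r, hr, hball⟩ := Metric.eventually_nhds_iff_ball.1 hev
  let χ : ContDiffBump a := ⟨r / 4, r / 2, by positivity, by linarith⟩
  refine ⟨fun v => χ v • f v, ?_, ?_⟩
  · rw [contDiff_iff_contDiffAt]
    intro v
    by_cases hv : v ∈ Metric.ball a r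
    · exact (χ.contDiff.contDiffAt).smul (hball v hv)
    · have : (fun v => χ v • f v) =ᶠ[𝓝 v] fun _ => 0 := by
        have : v ∉ tsupport χ := by
          rw [χ.tsupport_eq]
          intro h
          exact hv (Metric.closedBall_subset_ball (by simp [χ]; linarith) h)
        filter_upwards [notMem_tsupport_iff_eventuallyEq.1 this] with w hw
        simp [hw]
      exact contDiffAt_const.congr_of_eventuallyEq this
  · filter_upwards [χ.eventuallyEq_one] with v hv
    simp [hv]

/-- The straight path from `v - ℓ v • e` to `v`, depending linearly on `v`. -/
def segmentPath {V : Type} [NormedAddCommGroup V] [NormedSpace ℝ V] (ℓ : V →L[ℝ] ℝ) (e : V) :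
    V →L[ℝ] C(Icc (0 : ℝ) 1, V) :=
  LinearMap.mkContinuous
    { toFun := fun v => ⟨fun s => v - ((1 - (s : ℝ)) * ℓ v) • e, by fun_prop⟩
      map_add' := fun v w => by ext s; simp [mul_add, add_smul]; abel
      map_smul' := fun c v => by
        ext s
        simp only [map_smul, smul_eq_mul, ContinuousMap.coe_mk, RingHom.id_apply,
          ContinuousMap.coe_smul, Pi.smul_apply, smul_sub, smul_smul]
        ring_nf }
    (1 + ‖ℓ‖ * ‖e‖) (fun v => by
      refine (ContinuousMap.norm_le _ (by positivity)).2 fun s => ?_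
      have h1 : |1 - (s : ℝ)| ≤ 1 := abs_le.2 ⟨by linarith [s.2.2], by linarith [s.2.1]⟩
      have h2 : ‖ℓ v‖ ≤ ‖ℓ‖ * ‖v‖ := ℓ.le_opNorm v
      calc ‖v - ((1 - (s : ℝ)) * ℓ v) • e‖ ≤ ‖v‖ + ‖((1 - (s : ℝ)) * ℓ v) • e‖ := norm_sub_le _ _
        _ ≤ ‖v‖ + (1 * (‖ℓ‖ * ‖v‖)) * ‖e‖ := by
          rw [norm_smul, norm_mul, Real.norm_eq_abs (1 - (s : ℝ))]
          gcongr
        _ = (1 + ‖ℓ‖ * ‖e‖) * ‖v‖ := by ring)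

/-- The integral over `[0, 1]` on continuous functions. -/
def integralCLM : C(Icc (0 : ℝ) 1, ℝ) →L[ℝ] ℝ :=
  LinearMap.mkContinuous
    { toFun := fun v => ∫ s in (0 : ℝ)..1, v (projIcc 0 1 zero_le_one s)
      map_add' := fun v w => by
        simp only [ContinuousMap.add_apply]
        exact intervalIntegral.integral_add
          (Continuous.intervalIntegrable (by fun_prop) _ _)
          (Continuous.intervalIntegrable (by fun_prop) _ _)
      map_smul' := fun c v => by simp }
    1 (fun v => by
      have := intervalIntegral.norm_integral_le_of_norm_le_const (a := (0 : ℝ)) (b := 1)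
        (f := fun s => v (projIcc 0 1 zero_le_one s)) (C := ‖v‖)
        (fun s _ => v.norm_coe_le_norm _)
      simpa using this)

/-- **Hadamard's lemma**: the increment of a `C^(n+1)` germ along a fixed direction `e` is divisible,
with a `C^n` quotient, by the linear functional which measures the displacement. The quotient is the
integral of the derivative over the segment, a superposition operator followed by a linear map. -/
theorem exists_hadamard_quotient {V : Type} [NormedAddCommGroup V] [NormedSpace ℝ V]
    [FiniteDimensional ℝ V] (ℓ : V →L[ℝ] ℝ) (e : V) {n : ℕ} {F : V → ℝ}
    (hF : ContDiffAt ℝ ((n + 1 : ℕ) : WithTop ℕ∞) F 0) :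
    ∃ Q : V → ℝ, ContDiffAt ℝ n Q 0 ∧ ∀ᶠ v in 𝓝 (0 : V), F v = F (v - ℓ v • e) + ℓ v * Q v := by
  obtain ⟨G, hG, hGF⟩ := hF.exists_global
  push_cast at hG
  obtain ⟨G', hG', hd⟩ := contDiff_succ_iff_hasFDerivAt.1 hG
  have : ProperSpace V := FiniteDimensional.proper ℝ V
  let D : C(V, ℝ) := ⟨fun v => G' v e, hG'.continuous.clm_apply continuous_const⟩
  have hD : ContDiff ℝ n D := hG'.clm_apply contDiff_const
  refine ⟨fun v => integralCLM (D.comp (segmentPath ℓ e v)), ?_, ?_⟩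
  · exact (integralCLM.contDiff.comp ((contDiff_postcomp n D hD).comp
      (segmentPath ℓ e).contDiff)).contDiffAt
  · have hlim : Tendsto (fun v : V => v - ℓ v • e) (𝓝 0) (𝓝 0) := by
      have : Continuous fun v : V => v - ℓ v • e := by fun_prop
      simpa using this.tendsto 0
    filter_upwards [hGF, hlim.eventually hGF] with v h1 h2
    have hderiv : ∀ s ∈ uIcc (0 : ℝ) 1,
        HasDerivAt (fun s : ℝ => G (v - ((1 - s) * ℓ v) • e))
          (ℓ v * D (v - ((1 - s) * ℓ v) • e)) s := by
      intro s _
      have hp : HasDerivAt (fun s : ℝ => v - ((1 - s) * ℓ v) • e) (ℓ v • e) s := by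
        have h0 : HasDerivAt (fun s : ℝ => (1 - s) * ℓ v) (-1 * ℓ v) s :=
          ((hasDerivAt_id s).const_sub 1).mul_const _
        simpa using (h0.smul_const e).const_sub v
      have := (hd (v - ((1 - s) * ℓ v) • e)).comp_hasDerivAt s hp
      rw [show ℓ v * D (v - ((1 - s) * ℓ v) • e) = G' (v - ((1 - s) * ℓ v) • e) (ℓ v • e) by
        simp [D]]
      exact this
    have hint := intervalIntegral.integral_eq_sub_of_hasDerivAt hderiv
      (Continuous.intervalIntegrable (by fun_prop) _ _)
    simp only [sub_self, zero_mul, zero_smul, sub_zero, one_mul] at hint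
    have heq : integralCLM (D.comp (segmentPath ℓ e v))
        = ∫ s in (0 : ℝ)..1, D (v - ((1 - s) * ℓ v) • e) := by
      change ∫ s in (0 : ℝ)..1, _ = _
      refine intervalIntegral.integral_congr fun s hs => ?_
      rw [uIcc_of_le zero_le_one] at hs
      simp [segmentPath, projIcc_of_mem _ hs]
    rw [heq, ← h1, ← h2, ← intervalIntegral.integral_const_mul, hint]
    ring

/-! ### Smoothness of the time-`h` map -/

/-- The primitive vanishing at `0`, on continuous functions on `[0, 1]`. -/
def primitiveCLM : C(Icc (0 : ℝ) 1, ℝ) →L[ℝ] C(Icc (0 : ℝ) 1, ℝ) :=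
  LinearMap.mkContinuous
    { toFun := fun v => ⟨fun t => ∫ s in (0 : ℝ)..t, v (projIcc 0 1 zero_le_one s),
        (intervalIntegral.continuous_primitive
          (fun _ _ => Continuous.intervalIntegrable (by fun_prop) _ _) 0).comp
          continuous_subtype_val⟩
      map_add' := fun v w => by
        ext t
        simp only [ContinuousMap.add_apply, ContinuousMap.coe_mk]
        exact intervalIntegral.integral_add
          (Continuous.intervalIntegrable (by fun_prop) _ _)
          (Continuous.intervalIntegrable (by fun_prop) _ _)
      map_smul' := fun c v => by ext t; simp }
    1 (fun v => by
      refine (ContinuousMap.norm_le _ (by positivity)).2 fun t => ?_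
      have := intervalIntegral.norm_integral_le_of_norm_le_const (a := (0 : ℝ)) (b := t)
        (f := fun s => v (projIcc 0 1 zero_le_one s)) (C := ‖v‖)
        (fun s _ => v.norm_coe_le_norm _)
      refine this.trans ?_
      rw [sub_zero, abs_of_nonneg t.2.1, mul_comm]
      exact mul_le_mul_of_nonneg_right t.2.2 (norm_nonneg _))

/-- A continuous function on `[0, 1]` paired with a constant. -/
def pairConstCLM : (C(Icc (0 : ℝ) 1, ℝ) × ℝ) →L[ℝ] C(Icc (0 : ℝ) 1, ℝ × ℝ) :=
  LinearMap.mkContinuous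
    { toFun := fun w => w.1.prodMk (ContinuousMap.const _ w.2)
      map_add' := fun _ _ => by ext <;> simp
      map_smul' := fun _ _ => by ext <;> simp }
    1 (fun w => by
      refine (ContinuousMap.norm_le _ (by positivity)).2 fun t => ?_
      rw [one_mul]
      exact max_le ((w.1.norm_coe_le_norm t).trans (le_max_left _ _)) (le_max_right _ _))

/-- The constant functions on `[0, 1]`. -/
def constCLM : ℝ →L[ℝ] C(Icc (0 : ℝ) 1, ℝ) :=
  LinearMap.mkContinuous
    { toFun := fun x => ContinuousMap.const _ x
      map_add' := fun _ _ => by ext; simp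
      map_smul' := fun _ _ => by ext; simp }
    1 (fun x => by
      refine (ContinuousMap.norm_le _ (by positivity)).2 fun t => ?_
      simp)

/-- Solutions of the initial value problem for a `C¹` vector field are unique. -/
theorem IsSolutionOn.eqOn {f : ℝ → ℝ → ℝ} {α x h : ℝ} {u w : ℝ → ℝ}
    (hf : ContDiff ℝ 1 (fun q : ℝ × ℝ => f q.1 q.2)) (hu : IsSolutionOn f α x h u)
    (hw : IsSolutionOn f α x h w) : EqOn u w (Icc 0 h) := by
  have hcu : ContinuousOn u (Icc 0 h) := fun t ht => (hu.2 t ht).continuousWithinAt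
  have hcw : ContinuousOn w (Icc 0 h) := fun t ht => (hw.2 t ht).continuousWithinAt
  obtain ⟨R₁, hR₁⟩ := isCompact_Icc.exists_bound_of_continuousOn hcu
  obtain ⟨R₂, hR₂⟩ := isCompact_Icc.exists_bound_of_continuousOn hcw
  have hfα : ContDiff ℝ 1 (fun y => f y α) := hf.comp (contDiff_id.prodMk contDiff_const)
  obtain ⟨K, hK⟩ := hfα.contDiffOn.exists_lipschitzOnWith (s := Metric.closedBall 0 (max R₁ R₂))
    one_ne_zero (convex_closedBall _ _) (isCompact_closedBall _ _)
  have key : ∀ {y : ℝ → ℝ}, IsSolutionOn f α x h y → ∀ t ∈ Ico 0 h,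
      HasDerivWithinAt y (f (y t) α) (Ici t) t := fun hy t ht =>
    (hy.2 t (Ico_subset_Icc_self ht)).mono_of_mem_nhdsWithin (Icc_mem_nhdsGE_of_mem ht)
  exact ODE_solution_unique_of_mem_Icc_right (v := fun _ y => f y α) (K := K)
    (s := fun _ => Metric.closedBall 0 (max R₁ R₂)) (fun _ _ => hK) hcu (key hu)
    (fun t ht => mem_closedBall_zero_iff.2 ((hR₁ t (Ico_subset_Icc_self ht)).trans
      (le_max_left _ _))) hcw (key hw)
    (fun t ht => mem_closedBall_zero_iff.2 ((hR₂ t (Ico_subset_Icc_self ht)).trans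
      (le_max_right _ _))) (hu.1.trans hw.1.symm)

theorem timeMap_eq_of_isSolutionOn {f : ℝ → ℝ → ℝ} {α x h : ℝ} {u : ℝ → ℝ} (hh : 0 ≤ h)
    (hf : ContDiff ℝ 1 (fun q : ℝ × ℝ => f q.1 q.2)) (hu : IsSolutionOn f α x h u) :
    timeMap f h x α = u h := by
  have H : ∃ u : ℝ → ℝ, IsSolutionOn f α x h u := ⟨u, hu⟩
  rw [timeMap, dif_pos H]
  exact H.choose_spec.eqOn hf hu (right_mem_Icc.2 hh)

theorem timeMap_zero {f : ℝ → ℝ → ℝ} {α x : ℝ}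
    (hf : ContDiff ℝ 1 (fun q : ℝ × ℝ => f q.1 q.2)) : timeMap f 0 x α = x := by
  refine timeMap_eq_of_isSolutionOn (u := fun t => x + t * f x α) le_rfl hf ⟨by simp, ?_⟩ |>.trans
    (by simp)
  intro t ht
  rw [Icc_self, mem_singleton_iff] at ht
  subst ht
  have : HasDerivAt (fun t => x + t * f x α) (1 * f x α) 0 :=
    ((hasDerivAt_id (0 : ℝ)).mul_const _).const_add x
  simpa using this.hasDerivWithinAt

/-- A fixed point of the rescaled integral equation is a solution of the differential equation,
traversed in unit time. -/
theorem timeMap_eq_of_integral_eq {f : ℝ → ℝ → ℝ} {α x h : ℝ} (hh : 0 ≤ h)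
    (hf : ContDiff ℝ 1 (fun q : ℝ × ℝ => f q.1 q.2)) (u : C(Icc (0 : ℝ) 1, ℝ))
    (hu : ∀ t : Icc (0 : ℝ) 1,
      u t = x + h * ∫ s in (0 : ℝ)..t, f (u (projIcc 0 1 zero_le_one s)) α) :
    timeMap f h x α = x + h * ∫ s in (0 : ℝ)..1, f (u (projIcc 0 1 zero_le_one s)) α := by
  rcases hh.eq_or_lt with rfl | hpos
  · simp [timeMap_zero hf]
  set y : ℝ → ℝ := fun t => x + h * ∫ s in (0 : ℝ)..t / h, f (u (projIcc 0 1 zero_le_one s)) α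
    with hy
  have hcont : Continuous fun s : ℝ => f (u (projIcc 0 1 zero_le_one s)) α :=
    hf.continuous.comp (by fun_prop : Continuous fun s : ℝ => (u (projIcc 0 1 zero_le_one s), α))
  have hsol : IsSolutionOn f α x h y := by
    refine ⟨by simp [hy], fun t ht => ?_⟩
    have hmem : t / h ∈ Icc (0 : ℝ) 1 :=
      ⟨div_nonneg ht.1 hh, (div_le_one hpos).2 ht.2⟩
    have hval : y t = u (projIcc 0 1 zero_le_one (t / h)) := by
      rw [hu, projIcc_of_mem _ hmem]
    have h1 : HasDerivAt (fun r : ℝ => ∫ s in (0 : ℝ)..r, f (u (projIcc 0 1 zero_le_one s)) α)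
        (f (u (projIcc 0 1 zero_le_one (t / h))) α) (t / h) :=
      intervalIntegral.integral_hasDerivAt_right (hcont.intervalIntegrable _ _)
        (hcont.stronglyMeasurableAtFilter _ _) hcont.continuousAt
    have h2 : HasDerivAt (fun t : ℝ => t / h) (1 / h) t := (hasDerivAt_id t).div_const h
    have h3 := ((h1.comp t h2).const_mul h).const_add x
    rw [hval]
    refine (h3.congr_deriv ?_).hasDerivWithinAt
    field_simp
  rw [timeMap_eq_of_isSolutionOn hh hf hsol]
  simp [hy, div_self hpos.ne']

/-- Smooth dependence of the flow on time, initial value and parameter, in the form needed here: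
the increment of the time-`h` map is `h` times a function of the same class as the vector field. The
trajectory is the implicit function of a smooth equation in the Banach space `C([0, 1])`. -/
theorem exists_timeMap_increment {f : ℝ → ℝ → ℝ} {n : ℕ} (hn : n ≠ 0)
    (hf : ContDiff ℝ n (fun q : ℝ × ℝ => f q.1 q.2)) :
    ∃ g : ℝ × ℝ × ℝ → ℝ, ContDiffAt ℝ n g 0 ∧
      (∀ᶠ q in 𝓝 (0 : ℝ × ℝ × ℝ), 0 ≤ q.1 → timeMap f q.1 q.2.1 q.2.2 = q.2.1 + q.1 * g q) ∧
      (∀ᶠ q in 𝓝 (0 : ℝ × ℝ × ℝ), q.1 = 0 → g q = f q.2.1 q.2.2) := by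
  have hn1 : (1 : WithTop ℕ∞) ≤ n := by exact_mod_cast Nat.one_le_iff_ne_zero.2 hn
  have hn0 : (n : WithTop ℕ∞) ≠ 0 := by exact_mod_cast hn
  let F : C(ℝ × ℝ, ℝ) := ⟨fun q => f q.1 q.2, hf.continuous⟩
  let S : C(Icc (0 : ℝ) 1, ℝ) × ℝ → C(Icc (0 : ℝ) 1, ℝ) := fun w => F.comp (pairConstCLM w)
  have hS : ContDiff ℝ n S := (contDiff_postcomp n F hf).comp pairConstCLM.contDiff
  -- `Ψ = 0` is the integral equation of the trajectory, rescaled to unit time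
  let Ψ : (ℝ × ℝ × ℝ) × C(Icc (0 : ℝ) 1, ℝ) → C(Icc (0 : ℝ) 1, ℝ) := fun w =>
    w.2 - constCLM w.1.2.1 - w.1.1 • primitiveCLM (S (w.2, w.1.2.2))
  have hΨ : ContDiff ℝ n Ψ := by
    have h1 : ContDiff ℝ n fun w : (ℝ × ℝ × ℝ) × C(Icc (0 : ℝ) 1, ℝ) =>
        primitiveCLM (S (w.2, w.1.2.2)) :=
      primitiveCLM.contDiff.comp (hS.comp (by fun_prop))
    have h2 : ContDiff ℝ n fun w : (ℝ × ℝ × ℝ) × C(Icc (0 : ℝ) 1, ℝ) => constCLM w.1.2.1 :=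
      constCLM.contDiff.comp (by fun_prop)
    have h3 : ContDiff ℝ n fun w : (ℝ × ℝ × ℝ) × C(Icc (0 : ℝ) 1, ℝ) => w.1.1 := by fun_prop
    exact (contDiff_snd.sub h2).sub (h3.smul h1)
  have hΨ0 : Ψ 0 = 0 := by simp [Ψ]
  -- at step-size `0` the integral term is absent, so the derivative in the trajectory is the identity
  have hinv : (fderiv ℝ Ψ 0 ∘L .inr ℝ (ℝ × ℝ × ℝ) C(Icc (0 : ℝ) 1, ℝ)).IsInvertible := by
    have h1 : HasFDerivAt Ψ (fderiv ℝ Ψ 0) ((ContinuousLinearMap.inr ℝ (ℝ × ℝ × ℝ)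
        C(Icc (0 : ℝ) 1, ℝ)) 0) := by
      rw [map_zero]
      exact (hΨ.differentiable hn0 0).hasFDerivAt
    have h2 := h1.comp 0 (ContinuousLinearMap.inr ℝ (ℝ × ℝ × ℝ)
        C(Icc (0 : ℝ) 1, ℝ)).hasFDerivAt
    have h3 : Ψ ∘ (ContinuousLinearMap.inr ℝ (ℝ × ℝ × ℝ) C(Icc (0 : ℝ) 1, ℝ)) = id := by
      funext u; simp [Ψ]
    rw [h3] at h2
    rw [h2.unique (hasFDerivAt_id _)]
    exact ⟨ContinuousLinearEquiv.refl ℝ _, rfl⟩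
  have hΨ' : ContDiffAt ℝ n Ψ 0 := hΨ.contDiffAt
  set U := hΨ'.implicitFunction hn0 hinv with hU
  have hUd : ContDiffAt ℝ n U 0 := hΨ'.contDiffAt_implicitFunction hn0 hinv
  have hUe : ∀ᶠ q in 𝓝 (0 : ℝ × ℝ × ℝ), Ψ (q, U q) = 0 := by
    simpa [hΨ0] using hΨ'.eventually_apply_implicitFunction hn0 hinv
  have hint : ∀ (u : C(Icc (0 : ℝ) 1, ℝ)) (α : ℝ),
      integralCLM (S (u, α)) = ∫ s in (0 : ℝ)..1, f (u (projIcc 0 1 zero_le_one s)) α :=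
    fun _ _ => rfl
  refine ⟨fun q => integralCLM (S (U q, q.2.2)), ?_, ?_, ?_⟩
  · exact integralCLM.contDiff.contDiffAt.comp 0 (hS.contDiffAt.comp 0
      (hUd.prodMk (by fun_prop)))
  · filter_upwards [hUe] with q hq hh
    rw [hint]
    refine timeMap_eq_of_integral_eq hh (hf.of_le hn1) (U q) fun t => ?_
    have := congrArg (fun v : C(Icc (0 : ℝ) 1, ℝ) => v t) hq
    have h2 : U q t - q.2.1 - q.1 * ∫ s in (0 : ℝ)..t,
      f (U q (projIcc 0 1 zero_le_one s)) q.2.2 = 0 := this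
    linarith
  · filter_upwards [hUe] with q hq hh
    have hUq : U q = constCLM q.2.1 := by
      simpa [Ψ, hh, sub_eq_zero] using hq
    rw [hUq, hint]
    simp [constCLM]

/-! ### Conjugacies from fundamental domains -/

/-- The parametrization of the orbits of an order isomorphism `g` which is affine from `[0, 1]` onto
the fundamental domain `[a, g a]` and turns `g` into the translation by `1`. -/
def orbitParam (g : ℝ ≃o ℝ) (a t : ℝ) : ℝ := (g ^ ⌊t⌋) (a + Int.fract t * (g a - a))

theorem orbitParam_add_one (g : ℝ ≃o ℝ) (a t : ℝ) :
    orbitParam g a (t + 1) = g (orbitParam g a t) := by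
  rw [orbitParam, orbitParam, Int.floor_add_one, Int.fract_add_one, ← mul_self_zpow]
  rfl

theorem orbitParam_sub_one (g : ℝ ≃o ℝ) (a t : ℝ) :
    g (orbitParam g a (t - 1)) = orbitParam g a t := by
  rw [← orbitParam_add_one, sub_add_cancel]

theorem orbitParam_of_mem_Icc (g : ℝ ≃o ℝ) (a : ℝ) {t : ℝ} (ht : t ∈ Icc (0 : ℝ) 1) :
    orbitParam g a t = a + t * (g a - a) := by
  have key : ∀ t ∈ Ico (0 : ℝ) 1, orbitParam g a t = a + t * (g a - a) := fun t ht => by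
    rw [orbitParam, Int.floor_eq_zero_iff.2 ht, Int.fract_eq_self.2 ht, zpow_zero]
    rfl
  rcases ht.2.lt_or_eq with h | rfl
  · exact key t ⟨ht.1, h⟩
  · have := orbitParam_add_one g a 0
    rw [zero_add, key 0 ⟨le_rfl, one_pos⟩] at this
    rw [this]
    simp

theorem orbitParam_strictMono {g : ℝ ≃o ℝ} {a : ℝ} (h : a < g a) :
    StrictMono (orbitParam g a) := by
  intro s t hst
  have hd : 0 < g a - a := sub_pos.2 h
  rcases (Int.floor_mono hst.le).eq_or_lt with hf | hf
  · rw [orbitParam, orbitParam, ← hf]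
    refine (g ^ ⌊s⌋).strictMono ?_
    have : Int.fract s < Int.fract t := by
      rw [Int.fract, Int.fract, hf]; linarith
    nlinarith
  · calc orbitParam g a s < (g ^ ⌊s⌋) (g a) := (g ^ ⌊s⌋).strictMono (by
          nlinarith [Int.fract_lt_one s])
      _ = (g ^ (⌊s⌋ + 1)) a := by rw [zpow_add_one]; rfl
      _ ≤ (g ^ ⌊t⌋) a := by
          obtain ⟨k, hk⟩ := Int.le.dest (Int.add_one_le_iff.2 hf)
          rw [← hk, zpow_add g (⌊s⌋ + 1)]
          refine (g ^ (⌊s⌋ + 1)).monotone ?_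
          rw [zpow_natCast]
          clear hk
          induction k with
          | zero => exact le_rfl
          | succ k ih =>
            refine ih.trans ?_
            rw [pow_succ]
            exact (g ^ k).monotone h.le
      _ ≤ orbitParam g a t := (g ^ ⌊t⌋).monotone (by
          nlinarith [Int.fract_nonneg t])

/-- The order-connected set `I` is invariant under `g` and `g` moves all its points to the right. -/
structure IsDriftRegion (g : ℝ ≃o ℝ) (I : Set ℝ) : Prop where
  ordConnected : I.OrdConnected
  apply_mem_iff : ∀ x, g x ∈ I ↔ x ∈ I
  lt_apply : ∀ x ∈ I, x < g x

namespace IsDriftRegion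

variable {g G : ℝ ≃o ℝ} {I I' : Set ℝ} {a a' : ℝ}

/-- Without fixed points in between, orbits pass every point. -/
theorem exists_lt_pow (hI : IsDriftRegion g I) {a x : ℝ} (ha : a ∈ I) (hx : x ∈ I) :
    ∃ n : ℕ, x < (g ^ n) a := by
  by_contra! hcon
  have hsucc : ∀ n : ℕ, (g ^ (n + 1)) a = g ((g ^ n) a) := fun n => by rw [pow_succ']; rfl
  have hmem : ∀ n : ℕ, (g ^ n) a ∈ I := fun n => by
    induction n with
    | zero => exact ha
    | succ n ih => rw [hsucc]; exact (hI.apply_mem_iff _).2 ih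
  have hmono : Monotone fun n : ℕ => (g ^ n) a :=
    monotone_nat_of_le_succ fun n => by rw [hsucc]; exact (hI.lt_apply _ (hmem n)).le
  have hlim := tendsto_atTop_ciSup hmono ⟨x, by rintro _ ⟨n, rfl⟩; exact hcon n⟩
  set L := ⨆ n : ℕ, (g ^ n) a
  have hLx : L ≤ x := le_of_tendsto' hlim hcon
  have haL : a ≤ L := hmono.ge_of_tendsto hlim 0
  have h1 : Tendsto (fun n : ℕ => (g ^ (n + 1)) a) atTop (𝓝 (g L)) := by
    simp only [hsucc]
    exact (g.continuous.tendsto L).comp hlim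
  have := tendsto_nhds_unique h1 (hlim.comp (tendsto_add_atTop_nat 1))
  exact (hI.lt_apply L (hI.ordConnected.out ha hx ⟨haL, hLx⟩)).ne' this

theorem zpow_mem (hI : IsDriftRegion g I) (n : ℤ) {x : ℝ} : (g ^ n) x ∈ I ↔ x ∈ I := by
  induction n generalizing x with
  | zero => rfl
  | succ n ih =>
    rw [zpow_add_one]
    exact (ih (x := g x)).trans (hI.apply_mem_iff x)
  | pred n ih =>
    rw [zpow_sub_one]
    refine (ih (x := g⁻¹ x)).trans ?_
    rw [← hI.apply_mem_iff]
    exact iff_of_eq (congrArg (· ∈ I) (g.apply_symm_apply x))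

theorem orbitParam_mem (hI : IsDriftRegion g I) (ha : a ∈ I) (t : ℝ) : orbitParam g a t ∈ I := by
  rw [orbitParam, hI.zpow_mem]
  refine hI.ordConnected.out ha ((hI.apply_mem_iff a).2 ha) ?_
  have := hI.lt_apply a ha
  constructor <;> nlinarith [Int.fract_nonneg t, Int.fract_lt_one t]

theorem exists_orbitParam_eq (hI : IsDriftRegion g I) (ha : a ∈ I) {x : ℝ} (hx : x ∈ I) :
    ∃ t, orbitParam g a t = x := by
  have hag := hI.lt_apply a ha
  have hmono := orbitParam_strictMono hag
  have hint : ∀ n : ℤ, orbitParam g a n = (g ^ n) a := fun n => by simp [orbitParam]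
  obtain ⟨n, hn⟩ := hI.exists_lt_pow ha hx
  obtain ⟨m, hm⟩ := hI.exists_lt_pow hx ha
  have hm' : (g ^ (-(m : ℤ))) a ≤ x := by
    have h1 : (g ^ (-(m : ℤ))) a < (g ^ (-(m : ℤ))) ((g ^ m) x) := (g ^ (-(m : ℤ))).strictMono hm
    have h2 : (g ^ (-(m : ℤ))) ((g ^ m) x) = x := by
      rw [zpow_neg, zpow_natCast]
      exact (g ^ m).symm_apply_apply x
    exact (h1.trans_eq h2).le
  have hbdd : ∀ z : ℤ, (g ^ z) a ≤ x → z ≤ n := fun z hz => by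
    have h1 : orbitParam g a z < orbitParam g a n := by
      rw [hint]
      exact (hz.trans_lt hn).trans_eq (by simpa using (hint n).symm)
    exact_mod_cast (hmono.lt_iff_lt.1 h1).le
  obtain ⟨k, hk, hkmax⟩ := Int.exists_greatest_of_bdd ⟨(n : ℤ), hbdd⟩ ⟨-(m : ℤ), hm'⟩
  have hk1 : x < (g ^ (k + 1)) a := by
    by_contra! hcon
    have := hkmax _ hcon
    lia
  set y := (g ^ k).symm x with hy
  have hxy : (g ^ k) y = x := (g ^ k).apply_symm_apply x
  have hay : a ≤ y := by rwa [← (g ^ k).le_iff_le, hxy]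
  have hyg : y < g a := by
    rw [← (g ^ k).lt_iff_lt, hxy]
    refine hk1.trans_eq ?_
    rw [zpow_add_one]; rfl
  have hd : 0 < g a - a := sub_pos.2 hag
  have hτ : (y - a) / (g a - a) ∈ Ico (0 : ℝ) 1 :=
    ⟨div_nonneg (sub_nonneg.2 hay) hd.le, (div_lt_one hd).2 (by linarith)⟩
  refine ⟨(y - a) / (g a - a) + k, ?_⟩
  rw [orbitParam, Int.floor_add_intCast, Int.fract_add_intCast, Int.floor_eq_zero_iff.2 hτ,
    Int.fract_eq_self.2 hτ, zero_add, div_mul_cancel₀ _ hd.ne', add_sub_cancel, hxy]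

end IsDriftRegion

/-- The map taking the orbit parametrization of `g` based at `a` to that of `G` based at `a'`. -/
def orbitTransport (g G : ℝ ≃o ℝ) (a a' x : ℝ) : ℝ :=
  orbitParam G a' (Function.invFun (orbitParam g a) x)

namespace IsDriftRegion

variable {g G : ℝ ≃o ℝ} {I I' : Set ℝ} {a a' : ℝ}

theorem orbitTransport_orbitParam (hI : IsDriftRegion g I) (ha : a ∈ I) (t : ℝ) :
    orbitTransport g G a a' (orbitParam g a t) = orbitParam G a' t := by
  rw [orbitTransport,
    Function.leftInverse_invFun (orbitParam_strictMono (hI.lt_apply a ha)).injective t]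

theorem strictMonoOn_orbitTransport (hI : IsDriftRegion g I) (hI' : IsDriftRegion G I')
    (ha : a ∈ I) (ha' : a' ∈ I') : StrictMonoOn (orbitTransport g G a a') I := by
  intro x hx y hy hxy
  obtain ⟨s, rfl⟩ := hI.exists_orbitParam_eq ha hx
  obtain ⟨t, rfl⟩ := hI.exists_orbitParam_eq ha hy
  rw [hI.orbitTransport_orbitParam ha, hI.orbitTransport_orbitParam ha]
  exact orbitParam_strictMono (hI'.lt_apply a' ha')
    ((orbitParam_strictMono (hI.lt_apply a ha)).lt_iff_lt.1 hxy)

theorem mapsTo_orbitTransport (hI' : IsDriftRegion G I') (ha' : a' ∈ I') (x : ℝ) :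
    orbitTransport g G a a' x ∈ I' := hI'.orbitParam_mem ha' _

theorem surjOn_orbitTransport (hI : IsDriftRegion g I) (hI' : IsDriftRegion G I')
    (ha : a ∈ I) (ha' : a' ∈ I') : SurjOn (orbitTransport g G a a') I I' := by
  intro y hy
  obtain ⟨t, rfl⟩ := hI'.exists_orbitParam_eq ha' hy
  exact ⟨orbitParam g a t, hI.orbitParam_mem ha t, hI.orbitTransport_orbitParam ha t⟩

theorem orbitTransport_apply (hI : IsDriftRegion g I) (ha : a ∈ I) {x : ℝ} (hx : x ∈ I) :
    orbitTransport g G a a' (g x) = G (orbitTransport g G a a' x) := by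
  obtain ⟨t, rfl⟩ := hI.exists_orbitParam_eq ha hx
  rw [← orbitParam_add_one, hI.orbitTransport_orbitParam ha, hI.orbitTransport_orbitParam ha,
    orbitParam_add_one]

theorem orbitTransport_eq_affineInterp (hI : IsDriftRegion g I) (ha : a ∈ I) {x : ℝ}
    (hx : x ∈ Icc a (g a)) :
    orbitTransport g G a a' x = affineInterp a a' (g a) (G a') x := by
  have hd : 0 < g a - a := sub_pos.2 (hI.lt_apply a ha)
  have ht : (x - a) / (g a - a) ∈ Icc (0 : ℝ) 1 :=
    ⟨div_nonneg (sub_nonneg.2 hx.1) hd.le, (div_le_one hd).2 (by linarith [hx.2])⟩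
  have hx' : x = orbitParam g a ((x - a) / (g a - a)) := by
    rw [orbitParam_of_mem_Icc g a ht, div_mul_cancel₀ _ hd.ne']; ring
  conv_lhs => rw [hx']
  rw [hI.orbitTransport_orbitParam ha, orbitParam_of_mem_Icc G a' ht, affineInterp]

end IsDriftRegion

/-- A map of the line assembled from its restrictions to the three intervals which are cut off by
the points `l ≤ u`, these points being sent to `l'` and `u'`. -/
def glueAt (l u l' u' : ℝ) (j₁ j₂ j₃ : ℝ → ℝ) (x : ℝ) : ℝ :=
  if x < l then j₁ x else if x = l then l' else if x < u then j₂ x else if x = u then u' else j₃ x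

section glue

variable {l u l' u' : ℝ} {j₁ j₂ j₃ : ℝ → ℝ}

theorem glueAt_of_lt {x : ℝ} (h : x < l) : glueAt l u l' u' j₁ j₂ j₃ x = j₁ x := by
  simp [glueAt, h]

theorem glueAt_left : glueAt l u l' u' j₁ j₂ j₃ l = l' := by simp [glueAt]

theorem glueAt_of_mem {x : ℝ} (h : x ∈ Ioo l u) : glueAt l u l' u' j₁ j₂ j₃ x = j₂ x := by
  simp [glueAt, h.1.not_gt, h.1.ne', h.2]

theorem glueAt_right (hlu : l ≤ u) (heq : l = u → l' = u') :
    glueAt l u l' u' j₁ j₂ j₃ u = u' := by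
  rcases hlu.eq_or_lt with h | h
  · subst h; rw [glueAt_left, heq rfl]
  · simp [glueAt, h.not_gt, h.ne']

theorem glueAt_of_gt {x : ℝ} (hlu : l ≤ u) (h : u < x) :
    glueAt l u l' u' j₁ j₂ j₃ x = j₃ x := by
  have hl := hlu.trans_lt h
  simp [glueAt, hl.not_gt, hl.ne', h.not_gt, h.ne']

theorem mem_regions (l u x : ℝ) : x < l ∨ x = l ∨ x ∈ Ioo l u ∨ x = u ∨ u < x := by
  rcases lt_trichotomy x l with h | h | h
  · exact .inl h
  · exact .inr (.inl h)
  · rcases lt_trichotomy x u with h' | h' | h'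
    · exact .inr (.inr (.inl ⟨h, h'⟩))
    · exact .inr (.inr (.inr (.inl h')))
    · exact .inr (.inr (.inr (.inr h')))

theorem strictMono_glueAt (hlu : l ≤ u) (hlu' : l' ≤ u') (heq : l = u ↔ l' = u')
    (m₁ : StrictMonoOn j₁ (Iio l)) (m₂ : StrictMonoOn j₂ (Ioo l u)) (m₃ : StrictMonoOn j₃ (Ioi u))
    (t₁ : MapsTo j₁ (Iio l) (Iio l')) (t₂ : MapsTo j₂ (Ioo l u) (Ioo l' u'))
    (t₃ : MapsTo j₃ (Ioi u) (Ioi u')) : StrictMono (glueAt l u l' u' j₁ j₂ j₃) := by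
  intro x y hxy
  have hlt : l < u → l' < u' := fun h => hlu'.lt_of_ne fun h' => h.ne (heq.2 h')
  rcases mem_regions l u x with hx | rfl | hx | rfl | hx
  · rw [glueAt_of_lt hx]
    have h1 : j₁ x < l' := t₁ hx
    rcases mem_regions l u y with hy | rfl | hy | rfl | hy
    · rw [glueAt_of_lt hy]; exact m₁ hx hy hxy
    · rwa [glueAt_left]
    · rw [glueAt_of_mem hy]; exact h1.trans (t₂ hy).1
    · rw [glueAt_right hlu heq.1]; exact h1.trans_le hlu'
    · rw [glueAt_of_gt hlu hy]; exact h1.trans_le (hlu'.trans (t₃ hy : u' < _).le)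
  · rw [glueAt_left]
    rcases mem_regions x u y with hy | rfl | hy | rfl | hy
    · exact absurd hxy hy.not_gt
    · exact absurd hxy (lt_irrefl _)
    · rw [glueAt_of_mem hy]; exact (t₂ hy).1
    · rw [glueAt_right hlu heq.1]; exact hlt hxy
    · rw [glueAt_of_gt hlu hy]; exact hlu'.trans_lt (t₃ hy)
  · rw [glueAt_of_mem hx]
    have h1 := t₂ hx
    rcases mem_regions l u y with hy | rfl | hy | rfl | hy
    · exact absurd hxy (hy.trans hx.1).not_gt
    · exact absurd hxy hx.1.not_gt
    · rw [glueAt_of_mem hy]; exact m₂ hx hy hxy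
    · rw [glueAt_right hlu heq.1]; exact h1.2
    · rw [glueAt_of_gt hlu hy]; exact h1.2.trans (t₃ hy)
  · rw [glueAt_right hlu heq.1]
    rcases mem_regions l x y with hy | rfl | hy | rfl | hy
    · exact absurd hxy (hy.trans_le hlu).not_gt
    · exact absurd hxy hlu.not_gt
    · exact absurd hxy hy.2.not_gt
    · exact absurd hxy (lt_irrefl _)
    · rw [glueAt_of_gt hlu hy]; exact t₃ hy
  · have hy : u < y := hx.trans hxy
    rw [glueAt_of_gt hlu hx, glueAt_of_gt hlu hy]
    exact m₃ hx hy hxy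

theorem surjective_glueAt (hlu : l ≤ u) (hlu' : l' ≤ u') (heq : l = u → l' = u')
    (s₁ : SurjOn j₁ (Iio l) (Iio l')) (s₂ : SurjOn j₂ (Ioo l u) (Ioo l' u'))
    (s₃ : SurjOn j₃ (Ioi u) (Ioi u')) : Function.Surjective (glueAt l u l' u' j₁ j₂ j₃) := by
  intro y
  rcases mem_regions l' u' y with hy | rfl | hy | rfl | hy
  · obtain ⟨x, hx, rfl⟩ := s₁ hy
    exact ⟨x, glueAt_of_lt hx⟩
  · exact ⟨l, glueAt_left⟩
  · obtain ⟨x, hx, rfl⟩ := s₂ hy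
    exact ⟨x, glueAt_of_mem hx⟩
  · exact ⟨u, glueAt_right hlu heq⟩
  · obtain ⟨x, hx, rfl⟩ := s₃ hy
    exact ⟨x, glueAt_of_gt hlu hx⟩

end glue

/-! ### The transcritical normal form at a fixed step-size and parameter -/

/-- The normal form map `x ↦ x + h x (β + x + x² e(x))` at a fixed step-size and parameter. -/
def nfMap (e : ℝ → ℝ) (h β x : ℝ) : ℝ := (1 + h * β) * x + h * x ^ 2 + h * x ^ 3 * e x

/-- The factor of the normal form which vanishes at the nonzero fixed point. -/
def nfRate (e : ℝ → ℝ) (β x : ℝ) : ℝ := β + x + x ^ 2 * e x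

/-- The tail `e` is bounded by `K` and `K`-Lipschitz on `[-ε, ε]`. -/
structure TailBound (ε K : ℝ) (e : ℝ → ℝ) : Prop where
  bound : ∀ x ∈ Icc (-ε) ε, |e x| ≤ K
  lip : ∀ x ∈ Icc (-ε) ε, ∀ y ∈ Icc (-ε) ε, |e x - e y| ≤ K * |x - y|

/-- Smallness of the interval `[-ε, ε]` relative to the tail bound `K`, and of `h` and `β`. -/
structure SmallParams (ε K h β : ℝ) : Prop where
  ε_pos : 0 < ε
  ε_le : ε ≤ 1 / 10
  K_nonneg : 0 ≤ K
  K_le : K * ε ≤ 1 / 10000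
  h_pos : 0 < h
  h_le : h ≤ 1
  β_le : |β| ≤ ε / 8

theorem nfMap_eq (e : ℝ → ℝ) (h β x : ℝ) : nfMap e h β x = x + h * (x * nfRate e β x) := by
  rw [nfMap, nfRate]; ring

theorem exists_eq_mul_of_abs_le {A d c : ℝ} (hc : 0 ≤ c) (h : |A| ≤ |d| * c) :
    ∃ E, |E| ≤ c ∧ A = d * E := by
  rcases eq_or_ne d 0 with rfl | hd
  · refine ⟨0, by simpa, ?_⟩
    rw [abs_zero, zero_mul] at h
    simpa using abs_nonpos_iff.1 h
  · refine ⟨A / d, ?_, by field_simp⟩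
    rw [abs_div, div_le_iff₀ (abs_pos.2 hd), mul_comm]
    exact h

section

variable {ε K h β : ℝ} {e : ℝ → ℝ}

theorem TailBound.exists_cubic_sub (he : TailBound ε K e) (hs : SmallParams ε K h β) {x y : ℝ}
    (hx : x ∈ Icc (-ε) ε) (hy : y ∈ Icc (-ε) ε) :
    ∃ E, |E| ≤ (|x| + |y|) / 1000 ∧ y ^ 3 * e y - x ^ 3 * e x = (y - x) * E := by
  refine exists_eq_mul_of_abs_le (by positivity) ?_
  have hx' := abs_le.2 hx
  have hy' := abs_le.2 hy
  have hKε := hs.K_le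
  have hK := hs.K_nonneg
  have hε := hs.ε_pos
  have hs0 : 0 ≤ |x| + |y| := by positivity
  have h1 : |y ^ 3 - x ^ 3| ≤ |y - x| * ((|x| + |y|) * (2 * ε)) := by
    rw [show y ^ 3 - x ^ 3 = (y - x) * (y ^ 2 + x * y + x ^ 2) by ring, abs_mul]
    refine mul_le_mul_of_nonneg_left ?_ (abs_nonneg _)
    calc |y ^ 2 + x * y + x ^ 2| ≤ |y| ^ 2 + |x| * |y| + |x| ^ 2 := by
          refine (abs_add_le _ _).trans (add_le_add ((abs_add_le _ _).trans ?_) ?_) <;>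
            simp [abs_mul]
      _ ≤ (|x| + |y|) * (|x| + |y|) := by nlinarith [abs_nonneg x, abs_nonneg y]
      _ ≤ (|x| + |y|) * (2 * ε) := by gcongr; linarith
  have h2 : |x ^ 3| ≤ (|x| + |y|) * ε ^ 2 := by
    rw [abs_pow, pow_succ, mul_comm]
    gcongr
    linarith [abs_nonneg y]
  rw [show y ^ 3 * e y - x ^ 3 * e x = (y ^ 3 - x ^ 3) * e y + x ^ 3 * (e y - e x) by ring]
  calc |(y ^ 3 - x ^ 3) * e y + x ^ 3 * (e y - e x)|
      ≤ |y ^ 3 - x ^ 3| * |e y| + |x ^ 3| * |e y - e x| := by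
        rw [← abs_mul, ← abs_mul]; exact abs_add_le _ _
    _ ≤ |y - x| * ((|x| + |y|) * (2 * ε)) * K + (|x| + |y|) * ε ^ 2 * (K * |y - x|) := by
        gcongr
        · exact he.bound y hy
        · exact he.lip y hy x hx
    _ = |y - x| * ((|x| + |y|) * (K * ε * (2 + ε))) := by ring
    _ ≤ |y - x| * ((|x| + |y|) / 1000) := by
        rw [div_eq_mul_inv]
        gcongr
        have := hs.ε_le
        nlinarith [mul_nonneg hK hε.le]

theorem TailBound.exists_quadratic_sub (he : TailBound ε K e) (hs : SmallParams ε K h β) {x y : ℝ}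
    (hx : x ∈ Icc (-ε) ε) (hy : y ∈ Icc (-ε) ε) :
    ∃ E, |E| ≤ 1 / 1000 ∧ y ^ 2 * e y - x ^ 2 * e x = (y - x) * E := by
  refine exists_eq_mul_of_abs_le (by positivity) ?_
  have hx' := abs_le.2 hx
  have hy' := abs_le.2 hy
  have hKε := hs.K_le
  have hK := hs.K_nonneg
  have hε := hs.ε_pos
  have h1 : |y ^ 2 - x ^ 2| ≤ |y - x| * (2 * ε) := by
    rw [show y ^ 2 - x ^ 2 = (y - x) * (y + x) by ring, abs_mul]
    gcongr
    exact (abs_add_le _ _).trans (by linarith)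
  have h2 : |x ^ 2| ≤ ε ^ 2 := by
    rw [abs_pow]
    gcongr
  rw [show y ^ 2 * e y - x ^ 2 * e x = (y ^ 2 - x ^ 2) * e y + x ^ 2 * (e y - e x) by ring]
  calc |(y ^ 2 - x ^ 2) * e y + x ^ 2 * (e y - e x)|
      ≤ |y ^ 2 - x ^ 2| * |e y| + |x ^ 2| * |e y - e x| := by
        rw [← abs_mul, ← abs_mul]; exact abs_add_le _ _
    _ ≤ |y - x| * (2 * ε) * K + ε ^ 2 * (K * |y - x|) := by
        gcongr
        · exact he.bound y hy
        · exact he.lip y hy x hx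
    _ = |y - x| * (K * ε * (2 + ε)) := by ring
    _ ≤ |y - x| * (1 / 1000) := by
        gcongr
        have := hs.ε_le
        nlinarith [mul_nonneg hK hε.le]

/-- The divided differences of the normal form. -/
theorem TailBound.exists_nfMap_sub (he : TailBound ε K e) (hs : SmallParams ε K h β) {x y : ℝ}
    (hx : x ∈ Icc (-ε) ε) (hy : y ∈ Icc (-ε) ε) :
    ∃ E, |E| ≤ (|x| + |y|) / 1000 ∧
      nfMap e h β y - nfMap e h β x = (y - x) * (1 + h * (β + x + y + E)) := by
  obtain ⟨E, hE, h1⟩ := he.exists_cubic_sub hs hx hy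
  refine ⟨E, hE, ?_⟩
  rw [nfMap, nfMap]
  linear_combination h * h1

theorem TailBound.exists_nfRate_sub (he : TailBound ε K e) (hs : SmallParams ε K h β) {x y : ℝ}
    (hx : x ∈ Icc (-ε) ε) (hy : y ∈ Icc (-ε) ε) :
    ∃ E, |E| ≤ 1 / 1000 ∧ nfRate e β y - nfRate e β x = (y - x) * (1 + E) := by
  obtain ⟨E, hE, h1⟩ := he.exists_quadratic_sub hs hx hy
  refine ⟨E, hE, ?_⟩
  rw [nfRate, nfRate]
  linear_combination h1

theorem SmallParams.abs_mul_le (hs : SmallParams ε K h β) {x y E : ℝ}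
    (hx : x ∈ Icc (-ε) ε) (hy : y ∈ Icc (-ε) ε) (hE : |E| ≤ (|x| + |y|) / 1000) :
    |h * (β + x + y + E)| ≤ 1 / 2 := by
  have hx' := abs_le.2 hx
  have hy' := abs_le.2 hy
  have := hs.ε_le
  have hβ := hs.β_le
  have h1 : |β + x + y + E| ≤ 1 / 2 := by
    have hE' : |E| ≤ 1 / 10 := by linarith
    clear hE
    rw [abs_le] at *
    constructor <;> linarith
  rw [abs_mul, abs_of_pos hs.h_pos]
  nlinarith [hs.h_pos, hs.h_le, abs_nonneg (β + x + y + E)]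

theorem TailBound.nfMap_sub_ge (he : TailBound ε K e) (hs : SmallParams ε K h β) {x y : ℝ}
    (hx : x ∈ Icc (-ε) ε) (hy : y ∈ Icc (-ε) ε) (hxy : x ≤ y) :
    (y - x) / 2 ≤ nfMap e h β y - nfMap e h β x := by
  obtain ⟨E, hE, h1⟩ := he.exists_nfMap_sub hs hx hy
  have h2 := abs_le.1 (hs.abs_mul_le hx hy hE)
  rw [h1]
  nlinarith

theorem TailBound.continuousOn (he : TailBound ε K e) (hs : SmallParams ε K h β) :
    ContinuousOn e (Icc (-ε) ε) :=
  (LipschitzOnWith.of_dist_le_mul (K := ⟨K, hs.K_nonneg⟩) fun x hx y hy => by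
    rw [Real.dist_eq, Real.dist_eq]
    exact he.lip x hx y hy).continuousOn

theorem TailBound.continuousOn_nfMap (he : TailBound ε K e) (hs : SmallParams ε K h β) :
    ContinuousOn (nfMap e h β) (Icc (-ε) ε) := by
  have := he.continuousOn hs
  unfold nfMap
  fun_prop

theorem TailBound.continuousOn_nfRate (he : TailBound ε K e) (hs : SmallParams ε K h β) :
    ContinuousOn (nfRate e β) (Icc (-ε) ε) := by
  have := he.continuousOn hs
  unfold nfRate
  fun_prop

theorem SmallParams.zero_mem (hs : SmallParams ε K h β) : (0 : ℝ) ∈ Icc (-ε) ε :=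
  ⟨by linarith [hs.ε_pos], hs.ε_pos.le⟩

theorem SmallParams.left_mem (hs : SmallParams ε K h β) : -ε ∈ Icc (-ε) ε :=
  ⟨le_rfl, by linarith [hs.ε_pos]⟩

theorem SmallParams.right_mem (hs : SmallParams ε K h β) : ε ∈ Icc (-ε) ε :=
  ⟨by linarith [hs.ε_pos], le_rfl⟩

/-- The rate has a root close to `-β`. -/
theorem TailBound.exists_root (he : TailBound ε K e) (hs : SmallParams ε K h β) :
    ∃ ω ∈ Ioo (-ε) ε, nfRate e β ω = 0 ∧ |ω + β| ≤ |ω| / 1000 := by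
  have hε := hs.ε_pos
  have h0 : nfRate e β 0 = β := by simp [nfRate]
  have hβ := abs_le.1 hs.β_le
  have hneg : nfRate e β (-ε) < 0 := by
    obtain ⟨E, hE, h1⟩ := he.exists_nfRate_sub (β := β) hs hs.left_mem hs.zero_mem
    rw [abs_le] at hE
    nlinarith
  have hpos : 0 < nfRate e β ε := by
    obtain ⟨E, hE, h1⟩ := he.exists_nfRate_sub (β := β) hs hs.zero_mem hs.right_mem
    rw [abs_le] at hE
    nlinarith
  obtain ⟨ω, hω, hroot⟩ := intermediate_value_Ioo (by linarith) (he.continuousOn_nfRate hs)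
    ⟨hneg, hpos⟩
  refine ⟨ω, hω, hroot, ?_⟩
  have hω' : ω ∈ Icc (-ε) ε := Ioo_subset_Icc_self hω
  have h1 : ω + β = -(ω * (ω * e ω)) := by
    rw [nfRate] at hroot; linear_combination hroot
  have h2 : |ω * e ω| ≤ 1 / 1000 := by
    rw [abs_mul]
    calc |ω| * |e ω| ≤ ε * K := mul_le_mul (abs_le.2 hω') (he.bound ω hω') (abs_nonneg _) hε.le
      _ ≤ 1 / 1000 := by linarith [hs.K_le]
  rw [h1, abs_neg, abs_mul]
  nlinarith [abs_nonneg ω]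

/-- Between and beyond the fixed points, the normal form moves points as the product of the
distances to the two fixed points does. -/
theorem TailBound.exists_nfMap_sub_self (he : TailBound ε K e) (hs : SmallParams ε K h β)
    {ω x : ℝ} (hω : ω ∈ Icc (-ε) ε) (hroot : nfRate e β ω = 0) (hx : x ∈ Icc (-ε) ε) :
    ∃ c > 0, nfMap e h β x - x = c * (x * (x - ω)) := by
  obtain ⟨E, hE, h1⟩ := he.exists_nfRate_sub (β := β) hs hω hx
  rw [hroot, sub_zero] at h1
  rw [abs_le] at hE
  refine ⟨h * (1 + E), mul_pos hs.h_pos (by linarith), ?_⟩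
  rw [nfMap_eq, h1]
  ring

/-- An order isomorphism of the line which agrees with the normal form on `[-ε, ε]`, together with
the direction in which it moves points, as determined by the fixed points `0` and `ω`. -/
structure IsNFExtension (e : ℝ → ℝ) (ε h β ω : ℝ) (g : ℝ ≃o ℝ) : Prop where
  eq_nfMap : ∀ x ∈ Icc (-ε) ε, g x = nfMap e h β x
  zero : g 0 = 0
  root : g ω = ω
  lower : ∀ x < min 0 ω, x < g x
  inner : ∀ x ∈ Ioo (min 0 ω) (max 0 ω), g x < x
  upper : ∀ x, max 0 ω < x → x < g x

/-- Outside `[-ε, ε]` the normal form is continued with slope `1`. -/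
theorem TailBound.exists_extension (he : TailBound ε K e) (hs : SmallParams ε K h β) {ω : ℝ}
    (hω : ω ∈ Ioo (-ε) ε) (hroot : nfRate e β ω = 0) :
    ∃ g : ℝ ≃o ℝ, IsNFExtension e ε h β ω g := by
  have hε := hs.ε_pos
  -- the projection onto `[-ε, ε]`
  let c : ℝ → ℝ := fun x => max (-ε) (min x ε)
  have hc : ∀ x, c x ∈ Icc (-ε) ε := fun x =>
    ⟨le_max_left _ _, max_le (by linarith) (min_le_right _ _)⟩
  have hcc : Continuous c := by fun_prop
  have hcs : ∀ x ∈ Icc (-ε) ε, c x = x := fun x hx => by simp [c, hx.1, hx.2]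
  have hcm : ∀ x y, x ≤ y → c x ≤ c y ∧ c y - c x ≤ y - x := fun x y hxy => by
    simp only [c]
    refine ⟨max_le_max le_rfl (min_le_min_right _ hxy), ?_⟩
    rcases le_total x ε with h1 | h1 <;> rcases le_total y ε with h2 | h2 <;>
      rcases le_total (-ε) x with h3 | h3 <;> rcases le_total (-ε) y with h4 | h4 <;>
      rcases le_total (-ε) ε with h5 | h5 <;>
      simp only [min_eq_left, min_eq_right, max_eq_left, max_eq_right, *] <;> linarith
  let g₀ : ℝ → ℝ := fun x => nfMap e h β (c x) + (x - c x)
  have hmono : StrictMono g₀ := fun x y hxy => by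
    have h1 := hcm x y hxy.le
    have h2 := he.nfMap_sub_ge hs (hc x) (hc y) h1.1
    simp only [g₀]
    linarith
  have hcont : Continuous g₀ := by
    have h1 : Continuous fun x => nfMap e h β (c x) := (he.continuousOn_nfMap hs).comp_continuous
      hcc hc
    simp only [g₀]
    fun_prop
  obtain ⟨M, hM⟩ := isCompact_Icc.exists_bound_of_continuousOn (he.continuousOn_nfMap hs)
  have hfar : ∀ x, |g₀ x - x| ≤ M + ε := fun x => by
    have h1 := hM (c x) (hc x)
    have h2 := abs_le.2 (hc x)
    rw [Real.norm_eq_abs] at h1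
    simp only [g₀]
    rw [abs_le] at *
    constructor <;> linarith
  have hsurj : Function.Surjective g₀ := by
    refine hcont.surjective ?_ ?_
    · exact tendsto_atTop_mono (fun x => by linarith [(abs_le.1 (hfar x)).1] :
        ∀ x, x - (M + ε) ≤ g₀ x) (tendsto_atTop_add_const_right _ _ tendsto_id)
    · exact tendsto_atBot_mono (fun x => by linarith [(abs_le.1 (hfar x)).2] :
        ∀ x, g₀ x ≤ x + (M + ε)) (tendsto_atBot_add_const_right _ _ tendsto_id)
  have hg : ∀ x, ∃ a > 0, g₀ x - x = a * (c x * (c x - ω)) := fun x => by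
    obtain ⟨a, ha, h1⟩ := he.exists_nfMap_sub_self hs (Ioo_subset_Icc_self hω) hroot (hc x)
    exact ⟨a, ha, by rw [← h1]; simp only [g₀]; ring⟩
  have hω0 : -ε < min 0 ω := lt_min (by linarith) hω.1
  have hω1 : max 0 ω < ε := max_lt hε hω.2
  refine ⟨hmono.orderIsoOfSurjective g₀ hsurj, ⟨fun x hx => ?_, ?_, ?_, ?_, ?_, ?_⟩⟩
  · simp [g₀, hcs x hx]
  · simp [g₀, hcs 0 hs.zero_mem, nfMap]
  · simp [g₀, hcs ω (Ioo_subset_Icc_self hω), nfMap_eq, hroot]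
  · intro x hx
    obtain ⟨a, ha, h1⟩ := hg x
    have h2 : c x < min 0 ω := max_lt hω0 (lt_of_le_of_lt (min_le_left _ _) hx)
    rw [lt_min_iff] at h2
    rw [← sub_pos, StrictMono.coe_orderIsoOfSurjective, h1]
    exact mul_pos ha (mul_pos_of_neg_of_neg h2.1 (by linarith))
  · intro x hx
    obtain ⟨a, ha, h1⟩ := hg x
    rw [hcs x ⟨(hω0.trans hx.1).le, (hx.2.trans hω1).le⟩] at h1
    rw [← sub_neg, StrictMono.coe_orderIsoOfSurjective, h1]
    refine mul_neg_of_pos_of_neg ha ?_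
    rcases le_total 0 ω with h0 | h0
    · rw [min_eq_left h0, max_eq_right h0] at hx
      exact mul_neg_of_pos_of_neg hx.1 (by linarith [hx.2])
    · rw [min_eq_right h0, max_eq_left h0] at hx
      exact mul_neg_of_neg_of_pos hx.2 (by linarith [hx.1])
  · intro x hx
    obtain ⟨a, ha, h1⟩ := hg x
    have h2 : max 0 ω < c x := lt_max_of_lt_right (lt_min hx hω1)
    rw [max_lt_iff] at h2
    rw [← sub_pos, StrictMono.coe_orderIsoOfSurjective, h1]
    exact mul_pos ha (mul_pos h2.1 (by linarith))

namespace IsNFExtension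

variable {ω : ℝ} {g : ℝ ≃o ℝ}

theorem min_root (hg : IsNFExtension e ε h β ω g) : g (min 0 ω) = min 0 ω := by
  rcases min_choice 0 ω with h | h <;> rw [h]
  exacts [hg.zero, hg.root]

theorem max_root (hg : IsNFExtension e ε h β ω g) : g (max 0 ω) = max 0 ω := by
  rcases max_choice 0 ω with h | h <;> rw [h]
  exacts [hg.zero, hg.root]

theorem isDriftRegion_lower (hg : IsNFExtension e ε h β ω g) :
    IsDriftRegion g (Iio (min 0 ω)) where
  ordConnected := ordConnected_Iio
  apply_mem_iff x := by
    rw [mem_Iio, mem_Iio]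
    conv_lhs => rw [← hg.min_root]
    exact g.lt_iff_lt
  lt_apply := hg.lower

theorem isDriftRegion_upper (hg : IsNFExtension e ε h β ω g) :
    IsDriftRegion g (Ioi (max 0 ω)) where
  ordConnected := ordConnected_Ioi
  apply_mem_iff x := by
    rw [mem_Ioi, mem_Ioi]
    conv_lhs => rw [← hg.max_root]
    exact g.lt_iff_lt
  lt_apply := hg.upper

theorem apply_mem_inner (hg : IsNFExtension e ε h β ω g) (x : ℝ) :
    g x ∈ Ioo (min 0 ω) (max 0 ω) ↔ x ∈ Ioo (min 0 ω) (max 0 ω) := by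
  rw [mem_Ioo, mem_Ioo]
  conv_lhs => rw [← hg.max_root, ← hg.min_root]
  rw [g.lt_iff_lt, g.lt_iff_lt]

/-- Between the fixed points the normal form moves points to the left, and its inverse moves them to
the right. -/
theorem isDriftRegion_inner (hg : IsNFExtension e ε h β ω g) :
    IsDriftRegion g⁻¹ (Ioo (min 0 ω) (max 0 ω)) where
  ordConnected := ordConnected_Ioo
  apply_mem_iff x := by
    rw [← hg.apply_mem_inner]
    exact iff_of_eq (congrArg (· ∈ _) (g.apply_symm_apply x))
  lt_apply x hx := by
    rw [← g.lt_iff_lt]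
    exact (hg.inner x hx).trans_eq (g.apply_symm_apply x).symm

/-- On the image of `[-ε, ε]`, the local inverse is the inverse of the extension. -/
theorem localInv_eq (hg : IsNFExtension e ε h β ω g) {y : ℝ} (hy : g.symm y ∈ Icc (-ε) ε) :
    localInv (nfMap e h β) ε y = g.symm y := by
  have hinj : InjOn (nfMap e h β) (Icc (-ε) ε) := fun x hx z hz hxz => by
    rw [← hg.eq_nfMap x hx, ← hg.eq_nfMap z hz] at hxz
    exact g.injective hxz
  have h1 : nfMap e h β (g.symm y) = y := by rw [← hg.eq_nfMap _ hy, g.apply_symm_apply]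
  conv_lhs => rw [← h1]
  exact hinj.leftInvOn_invFunOn hy

end IsNFExtension

end

/-! ### Distance between corresponding orbits of two normal forms -/

/-- A tail together with the nonzero fixed point `ω` (which is `0` if `β = 0`) of its normal form and
an extension of the normal form to the line. -/
structure IsNFSystem (ε K h β : ℝ) (e : ℝ → ℝ) (ω : ℝ) (g : ℝ ≃o ℝ) : Prop where
  small : SmallParams ε K h β
  tail : TailBound ε K e
  root_mem : ω ∈ Ioo (-ε) ε
  root_eq : nfRate e β ω = 0
  root_near : |ω + β| ≤ |ω| / 1000
  ext : IsNFExtension e ε h β ω g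

theorem TailBound.exists_system {ε K h β : ℝ} {e : ℝ → ℝ} (he : TailBound ε K e)
    (hs : SmallParams ε K h β) : ∃ ω g, IsNFSystem ε K h β e ω g := by
  obtain ⟨ω, h1, h2, h3⟩ := he.exists_root hs
  obtain ⟨g, hg⟩ := he.exists_extension hs h1 h2
  exact ⟨ω, g, hs, he, h1, h2, h3, hg⟩

section

variable {ε K h β δ ω ω' : ℝ} {e e' : ℝ → ℝ} {g G : ℝ ≃o ℝ}

namespace IsNFSystem

theorem lo_mem (H : IsNFSystem ε K h β e ω g) : -ε < min 0 ω :=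
  lt_min (by linarith [H.small.ε_pos]) H.root_mem.1

theorem hi_mem (H : IsNFSystem ε K h β e ω g) : max 0 ω < ε :=
  max_lt H.small.ε_pos H.root_mem.2

theorem lower_subset (H : IsNFSystem ε K h β e ω g) {x : ℝ} (hx : x ∈ Ico (-ε) (min 0 ω)) :
    x ∈ Icc (-ε) ε :=
  ⟨hx.1, (hx.2.trans_le (min_le_left _ _)).le.trans H.small.ε_pos.le⟩

theorem upper_subset (H : IsNFSystem ε K h β e ω g) {x : ℝ} (hx : x ∈ Ioc (max 0 ω) ε) :
    x ∈ Icc (-ε) ε :=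
  ⟨by linarith [hx.1, le_max_left 0 ω, H.small.ε_pos], hx.2⟩

theorem inner_subset (H : IsNFSystem ε K h β e ω g) {x : ℝ}
    (hx : x ∈ Icc (min 0 ω) (max 0 ω)) : x ∈ Icc (-ε) ε :=
  ⟨(H.lo_mem.trans_le hx.1).le, (hx.2.trans_lt H.hi_mem).le⟩

theorem lower_bound (H : IsNFSystem ε K h β e ω g) {x : ℝ} (hx : x < min 0 ω) :
    x < 0 ∧ β ≤ 11 / 10 * -x := by
  obtain ⟨h0, h1⟩ := lt_min_iff.1 hx
  refine ⟨h0, ?_⟩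
  have := H.root_near
  rcases abs_cases ω with ⟨h2, h3⟩ | ⟨h2, h3⟩ <;> rw [h2, abs_le] at this <;> linarith

theorem upper_bound (H : IsNFSystem ε K h β e ω g) {x : ℝ} (hx : max 0 ω < x) :
    0 < x ∧ -β ≤ 11 / 10 * x := by
  obtain ⟨h0, h1⟩ := max_lt_iff.1 hx
  refine ⟨h0, ?_⟩
  have := H.root_near
  rcases abs_cases ω with ⟨h2, h3⟩ | ⟨h2, h3⟩ <;> rw [h2, abs_le] at this <;> linarith

theorem root_neg (H : IsNFSystem ε K h β e ω g) (hβ : 0 < β) : ω < 0 ∧ -(2 * β) < ω ∧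
    ω < -(β / 2) := by
  have := H.root_near
  rcases abs_cases ω with ⟨h2, h3⟩ | ⟨h2, h3⟩ <;> rw [h2, abs_le] at this <;>
    refine ⟨?_, ?_, ?_⟩ <;> linarith

theorem root_pos (H : IsNFSystem ε K h β e ω g) (hβ : β < 0) : 0 < ω ∧ ω < 2 * (-β) ∧
    -β / 2 < ω := by
  have := H.root_near
  rcases abs_cases ω with ⟨h2, h3⟩ | ⟨h2, h3⟩ <;> rw [h2, abs_le] at this <;>
    refine ⟨?_, ?_, ?_⟩ <;> linarith

theorem root_zero (H : IsNFSystem ε K h β e ω g) (hβ : β = 0) : ω = 0 := by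
  have := H.root_near
  rw [hβ, add_zero] at this
  exact abs_nonpos_iff.1 (by linarith [abs_nonneg ω])

/-- Points between the fixed points, in units of `-β`. -/
theorem exists_inner_coord (H : IsNFSystem ε K h β e ω g) (hβ : β ≠ 0) {x : ℝ}
    (hx : x ∈ Ioo (min 0 ω) (max 0 ω)) : ∃ a, 0 < a ∧ a ≤ 2 ∧ x = -β * a := by
  refine ⟨-x / β, ?_, ?_, by field_simp⟩
  all_goals
    rcases lt_or_gt_of_ne hβ with h0 | h0
    · have h1 := H.root_pos h0
      rw [min_eq_left h1.1.le, max_eq_right h1.1.le] at hx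
      first
      | exact div_pos_of_neg_of_neg (by linarith [hx.1]) h0
      | rw [div_le_iff_of_neg h0]; linarith [hx.2]
    · have h1 := H.root_neg h0
      rw [min_eq_right h1.1.le, max_eq_left h1.1.le] at hx
      first
      | exact div_pos (by linarith [hx.2]) h0
      | rw [div_le_iff₀ h0]; linarith [hx.1]

end IsNFSystem

/-- One step of two normal forms: the distance of two points changes by a factor governed by
`β + x + X`, up to an error from the difference of the tails. -/
theorem nfMap_pair_step (hs : SmallParams ε K h β) (he' : TailBound ε K e')
    (hδ : ∀ x ∈ Icc (-ε) ε, |e x - e' x| ≤ δ) {x X : ℝ} (hx : x ∈ Icc (-ε) ε)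
    (hX : X ∈ Icc (-ε) ε) :
    ∃ Q, |Q - (β + x + X)| ≤ (|x| + |X|) / 1000 ∧ 1 / 2 ≤ 1 + h * Q ∧
      |nfMap e' h β X - nfMap e h β x| ≤ (1 + h * Q) * |X - x| + h * (δ * |x| ^ 3) ∧
      (1 + h * Q) * |X - x| ≤ |nfMap e' h β X - nfMap e h β x| + h * (δ * |x| ^ 3) := by
  obtain ⟨E, hE, h1⟩ := he'.exists_nfMap_sub hs hx hX
  have h2 := (abs_le.1 (hs.abs_mul_le hx hX hE)).1
  refine ⟨β + x + X + E, by simpa using hE, by linarith, ?_⟩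
  have h3 : |nfMap e' h β x - nfMap e h β x| ≤ h * (δ * |x| ^ 3) := by
    have : nfMap e' h β x - nfMap e h β x = -(h * ((e x - e' x) * x ^ 3)) := by
      rw [nfMap, nfMap]; ring
    rw [this, abs_neg, abs_mul, abs_mul, abs_pow, abs_of_pos hs.h_pos]
    have := hs.h_pos
    gcongr
    exact hδ x hx
  have h4 : (1 + h * (β + x + X + E)) * |X - x| = |nfMap e' h β X - nfMap e' h β x| := by
    rw [h1, abs_mul, mul_comm, abs_of_nonneg (show 0 ≤ 1 + h * (β + x + X + E) by linarith)]
  rw [h4]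
  constructor
  · exact (abs_sub_le _ (nfMap e' h β x) _).trans (add_le_add le_rfl h3)
  · have := abs_sub_le (nfMap e' h β X) (nfMap e h β x) (nfMap e' h β x)
    rw [abs_sub_comm (nfMap e h β x)] at this
    linarith

theorem SmallParams.abs_cube_le (hs : SmallParams ε K h β) {x : ℝ} (hx : x ∈ Icc (-ε) ε) :
    |x| ^ 3 ≤ |x| := by
  have h1 : |x| ≤ 1 := (abs_le.2 hx).trans (by linarith [hs.ε_le])
  exact pow_le_of_le_one (abs_nonneg x) h1 (by norm_num)

/-- Below the fixed points the normal forms contract. -/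
theorem lower_step (H : IsNFSystem ε K h β e ω g) (H' : IsNFSystem ε K h β e' ω' G)
    (hδ0 : 0 ≤ δ) (hδ : ∀ x ∈ Icc (-ε) ε, |e x - e' x| ≤ δ) {x X : ℝ}
    (hx : x ∈ Ico (-ε) (min 0 ω)) (hX : X ∈ Ico (-ε) (min 0 ω')) (hd : |X - x| ≤ 4 * δ) :
    |nfMap e' h β X - nfMap e h β x| ≤ 4 * δ := by
  have hs := H.small
  obtain ⟨Q, hQ, hQ2, hfwd, -⟩ := nfMap_pair_step hs H'.tail hδ (H.lower_subset hx)
    (H'.lower_subset hX)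
  obtain ⟨hx0, hx1⟩ := H.lower_bound hx.2
  obtain ⟨hX0, hX1⟩ := H'.lower_bound hX.2
  have h3 := hs.abs_cube_le (H.lower_subset hx)
  rw [abs_of_neg hx0] at *
  rw [abs_of_neg hX0] at *
  -- both points lie beyond the fixed points near `-β`, so `x + X` dominates `β`
  have hQ3 : Q ≤ (x + X) / 4 := by linarith [(abs_le.1 hQ).2]
  have hhδ : 0 ≤ h * δ := mul_nonneg hs.h_pos.le hδ0
  calc _ ≤ _ := hfwd
    _ ≤ (1 + h * Q) * (4 * δ) + h * (δ * -x) := by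
        have := hs.h_pos
        gcongr
    _ = 4 * δ + h * δ * (4 * Q - x) := by ring
    _ ≤ 4 * δ + h * δ * 0 := by gcongr; linarith
    _ = 4 * δ := by ring

/-- Above the fixed points the inverses of the normal forms contract. -/
theorem upper_step (H : IsNFSystem ε K h β e ω g) (H' : IsNFSystem ε K h β e' ω' G)
    (hδ0 : 0 ≤ δ) (hδ : ∀ x ∈ Icc (-ε) ε, |e x - e' x| ≤ δ) {x X : ℝ}
    (hx : x ∈ Ioc (max 0 ω) ε) (hX : X ∈ Ioc (max 0 ω') ε)
    (hd : |nfMap e' h β X - nfMap e h β x| ≤ 4 * δ) : |X - x| ≤ 4 * δ := by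
  have hs := H.small
  obtain ⟨Q, hQ, hQ2, -, hbwd⟩ := nfMap_pair_step hs H'.tail hδ (H.upper_subset hx)
    (H'.upper_subset hX)
  obtain ⟨hx0, hx1⟩ := H.upper_bound hx.1
  obtain ⟨hX0, hX1⟩ := H'.upper_bound hX.1
  have h3 := hs.abs_cube_le (H.upper_subset hx)
  rw [abs_of_pos hx0] at *
  rw [abs_of_pos hX0] at *
  -- both points lie beyond the fixed points near `-β`, so `x + X` dominates `β`
  have hQ3 : (x + X) / 4 ≤ Q := by linarith [(abs_le.1 hQ).1]
  have hhδ : 0 ≤ h * δ := mul_nonneg hs.h_pos.le hδ0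
  refine le_of_mul_le_mul_left ?_ (by linarith : 0 < 1 + h * Q)
  calc _ ≤ _ := hbwd
    _ ≤ 4 * δ + h * (δ * x) := by
        have := hs.h_pos
        gcongr
    _ = (1 + h * Q) * (4 * δ) - h * δ * (4 * Q - x) := by ring
    _ ≤ (1 + h * Q) * (4 * δ) - h * δ * 0 := by gcongr; linarith
    _ = _ := by ring

theorem SmallParams.cube_le_inner (hs : SmallParams ε K h β) {a : ℝ} (ha : 0 ≤ a) (ha2 : a ≤ 2) :
    |-β * a| ^ 3 ≤ |β| / 100 := by
  have h1 : |β| ≤ 1 / 80 := by linarith [hs.β_le, hs.ε_le]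
  have h2 := abs_nonneg β
  rw [abs_mul, abs_neg, abs_of_nonneg ha]
  calc (|β| * a) ^ 3 ≤ (|β| * 2) ^ 3 := by gcongr
    _ = |β| * (8 * |β| ^ 2) := by ring
    _ ≤ |β| * (8 * (1 / 80) ^ 2) := by gcongr
    _ ≤ |β| / 100 := by linarith

/-- On the inner third next to `0`, the normal forms contract if `β < 0`. -/
theorem inner_step_neg (H : IsNFSystem ε K h β e ω g) (H' : IsNFSystem ε K h β e' ω' G)
    (hβ : β < 0) (hδ0 : 0 ≤ δ) (hδ : ∀ x ∈ Icc (-ε) ε, |e x - e' x| ≤ δ) {a b : ℝ}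
    (ha : 0 < a) (ha3 : a ≤ 1 / 3) (hb : 0 < b) (hb3 : b ≤ 1 / 3)
    (hx : -β * a ∈ Icc (-ε) ε) (hX : -β * b ∈ Icc (-ε) ε) (hd : |-β * b - -β * a| ≤ δ) :
    |nfMap e' h β (-β * b) - nfMap e h β (-β * a)| ≤ δ := by
  have hs := H.small
  obtain ⟨Q, hQ, hQ2, hfwd, -⟩ := nfMap_pair_step hs H'.tail hδ hx hX
  have h3 := hs.cube_le_inner ha.le (by linarith)
  rw [abs_of_neg hβ] at h3
  rw [abs_of_pos (mul_pos (neg_pos.2 hβ) ha), abs_of_pos (mul_pos (neg_pos.2 hβ) hb)] at hQ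
  have hQ3 : Q ≤ β / 100 := by nlinarith [(abs_le.1 hQ).2]
  have hhδ : 0 ≤ h * δ := mul_nonneg hs.h_pos.le hδ0
  calc _ ≤ _ := hfwd
    _ ≤ (1 + h * Q) * δ + h * (δ * (-β / 100)) := by
        have := hs.h_pos
        gcongr
    _ = δ + h * δ * (Q - β / 100) := by ring
    _ ≤ δ + h * δ * 0 := by gcongr; linarith
    _ = δ := by ring

/-- On the inner third next to `0`, the inverses of the normal forms contract if `β > 0`. -/
theorem inner_step_pos (H : IsNFSystem ε K h β e ω g) (H' : IsNFSystem ε K h β e' ω' G)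
    (hβ : 0 < β) (hδ0 : 0 ≤ δ) (hδ : ∀ x ∈ Icc (-ε) ε, |e x - e' x| ≤ δ) {a b : ℝ}
    (ha : 0 < a) (ha3 : a ≤ 1 / 3) (hb : 0 < b) (hb3 : b ≤ 1 / 3)
    (hx : -β * a ∈ Icc (-ε) ε) (hX : -β * b ∈ Icc (-ε) ε)
    (hd : |nfMap e' h β (-β * b) - nfMap e h β (-β * a)| ≤ δ) : |-β * b - -β * a| ≤ δ := by
  have hs := H.small
  obtain ⟨Q, hQ, hQ2, -, hbwd⟩ := nfMap_pair_step hs H'.tail hδ hx hX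
  have h3 := hs.cube_le_inner ha.le (by linarith)
  rw [abs_of_pos hβ] at h3
  rw [abs_of_neg (mul_neg_of_neg_of_pos (neg_neg_of_pos hβ) ha),
    abs_of_neg (mul_neg_of_neg_of_pos (neg_neg_of_pos hβ) hb)] at hQ
  have hQ3 : β / 100 ≤ Q := by nlinarith [(abs_le.1 hQ).1]
  have hhδ : 0 ≤ h * δ := mul_nonneg hs.h_pos.le hδ0
  refine le_of_mul_le_mul_left ?_ (by linarith : 0 < 1 + h * Q)
  calc _ ≤ _ := hbwd
    _ ≤ δ + h * (δ * (β / 100)) := by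
        have := hs.h_pos
        gcongr
    _ = (1 + h * Q) * δ - h * δ * (Q - β / 100) := by ring
    _ ≤ (1 + h * Q) * δ - h * δ * 0 := by gcongr; linarith
    _ = _ := by ring

/-- In units of `-β` the normal forms are, up to the tail, Euler steps of size `h β` for the logistic
equation `a' = a (1 - a)`, and the distance of two points `a`, `b` is multiplied by
`1 + h β (1 - (a + b))`. The weight `1 + 5 (a + b)` grows at least at that rate away from `0`; the
slack absorbs the tails and their difference. -/
theorem weight_supersolution {a b : ℝ} (ha : 1 / 3 ≤ a) (ha2 : a ≤ 2) (hb : 1 / 3 ≤ b)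
    (hb2 : b ≤ 2) :
    (1 - 999 / 1000 * (a + b)) * (1 + 5 * (a + b)) + 1 / 10000 ≤
      5 * (a * (1 - a) + b * (1 - b)) - 1 / 500 := by
  nlinarith [mul_nonneg (sub_nonneg.2 ha) (sub_nonneg.2 hb),
    mul_nonneg (sub_nonneg.2 ha) (sub_nonneg.2 ha2), mul_nonneg (sub_nonneg.2 hb) (sub_nonneg.2 hb2)]

/-- The normal form in units of `-β`. -/
theorem IsNFSystem.exists_scaled_step (H : IsNFSystem ε K h β e ω g) {a : ℝ} (ha : 0 ≤ a)
    (ha2 : a ≤ 2) (hx : -β * a ∈ Icc (-ε) ε) :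
    ∃ r, |r| ≤ 1 / 5000 ∧ nfMap e h β (-β * a) = -β * (a + h * β * (a * (1 - a) + r)) := by
  refine ⟨β * a ^ 3 * e (-β * a), ?_, by rw [nfMap]; ring⟩
  have hs := H.small
  have hK := hs.K_nonneg
  rw [abs_mul, abs_mul, abs_of_nonneg (show 0 ≤ a ^ 3 by positivity)]
  calc |β| * a ^ 3 * |e (-β * a)| ≤ ε / 8 * 2 ^ 3 * K := by
        have := hs.β_le
        have := hs.ε_pos
        have := H.tail.bound _ hx
        gcongr
    _ ≤ 1 / 5000 := by linarith [hs.K_le]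

/-- Away from `0`, a weighted distance is not increased by the normal forms if `β > 0`. -/
theorem weighted_step_pos (H : IsNFSystem ε K h β e ω g) (H' : IsNFSystem ε K h β e' ω' G)
    (hβ : 0 < β) (hδ0 : 0 ≤ δ) (hδ : ∀ x ∈ Icc (-ε) ε, |e x - e' x| ≤ δ) {a b a₁ b₁ : ℝ}
    (ha : 1 / 3 ≤ a) (ha2 : a ≤ 2) (hb : 1 / 3 ≤ b) (hb2 : b ≤ 2)
    (hx : -β * a ∈ Icc (-ε) ε) (hX : -β * b ∈ Icc (-ε) ε)
    (ha₁ : nfMap e h β (-β * a) = -β * a₁) (hb₁ : nfMap e' h β (-β * b) = -β * b₁)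
    (hd : |-β * b - -β * a| ≤ 100 * δ * (1 + 5 * (a + b))) :
    |-β * b₁ - -β * a₁| ≤ 100 * δ * (1 + 5 * (a₁ + b₁)) := by
  have hs := H.small
  have hh := hs.h_pos
  obtain ⟨Q, hQ, hQ2, hfwd, -⟩ := nfMap_pair_step hs H'.tail hδ hx hX
  rw [ha₁, hb₁] at hfwd
  have h3 := hs.cube_le_inner (by linarith : 0 ≤ a) ha2
  rw [abs_of_pos hβ] at h3
  rw [abs_of_neg (mul_neg_of_neg_of_pos (neg_neg_of_pos hβ) (by linarith)),
    abs_of_neg (mul_neg_of_neg_of_pos (neg_neg_of_pos hβ) (by linarith))] at hQ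
  have hQ3 : Q ≤ β * (1 - 999 / 1000 * (a + b)) := by linarith [(abs_le.1 hQ).2]
  obtain ⟨r, hr, hr1⟩ := H.exists_scaled_step (by linarith) ha2 hx
  obtain ⟨s, hs', hs1⟩ := H'.exists_scaled_step (by linarith) hb2 hX
  have ea : a₁ = a + h * β * (a * (1 - a) + r) :=
    mul_left_cancel₀ (neg_ne_zero.2 hβ.ne') (ha₁.symm.trans hr1)
  have eb : b₁ = b + h * β * (b * (1 - b) + s) :=
    mul_left_cancel₀ (neg_ne_zero.2 hβ.ne') (hb₁.symm.trans hs1)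
  have hw := weight_supersolution ha ha2 hb hb2
  have hhβδ : 0 ≤ 100 * (h * β * δ) := by positivity
  have hq := mul_le_mul_of_nonneg_left hQ3 hh.le
  rw [abs_le] at hr hs'
  calc _ ≤ _ := hfwd
    _ ≤ (1 + h * (β * (1 - 999 / 1000 * (a + b)))) * (100 * δ * (1 + 5 * (a + b)))
          + h * (δ * (β / 100)) := by gcongr; linarith
    _ = 100 * δ * (1 + 5 * (a + b)) + 100 * (h * β * δ) *
          ((1 - 999 / 1000 * (a + b)) * (1 + 5 * (a + b)) + 1 / 10000) := by ring
    _ ≤ 100 * δ * (1 + 5 * (a + b)) + 100 * (h * β * δ) *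
          (5 * (a * (1 - a) + r + (b * (1 - b) + s))) := by gcongr; linarith
    _ = 100 * δ * (1 + 5 * (a₁ + b₁)) := by rw [ea, eb]; ring

/-- Away from `0`, a weighted distance is not increased by the inverses of the normal forms if
`β < 0`. -/
theorem weighted_step_neg (H : IsNFSystem ε K h β e ω g) (H' : IsNFSystem ε K h β e' ω' G)
    (hβ : β < 0) (hδ0 : 0 ≤ δ) (hδ : ∀ x ∈ Icc (-ε) ε, |e x - e' x| ≤ δ) {a b a₁ b₁ : ℝ}
    (ha : 1 / 3 ≤ a) (ha2 : a ≤ 2) (hb : 1 / 3 ≤ b) (hb2 : b ≤ 2)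
    (hx : -β * a ∈ Icc (-ε) ε) (hX : -β * b ∈ Icc (-ε) ε)
    (ha₁ : nfMap e h β (-β * a) = -β * a₁) (hb₁ : nfMap e' h β (-β * b) = -β * b₁)
    (hd : |-β * b₁ - -β * a₁| ≤ 100 * δ * (1 + 5 * (a₁ + b₁))) :
    |-β * b - -β * a| ≤ 100 * δ * (1 + 5 * (a + b)) := by
  have hs := H.small
  have hh := hs.h_pos
  obtain ⟨Q, hQ, hQ2, -, hbwd⟩ := nfMap_pair_step hs H'.tail hδ hx hX
  rw [ha₁, hb₁] at hbwd
  have h3 := hs.cube_le_inner (by linarith : 0 ≤ a) ha2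
  rw [abs_of_neg hβ] at h3
  rw [abs_of_pos (mul_pos (neg_pos.2 hβ) (by linarith)),
    abs_of_pos (mul_pos (neg_pos.2 hβ) (by linarith))] at hQ
  have hQ3 : β * (1 - 999 / 1000 * (a + b)) ≤ Q := by linarith [(abs_le.1 hQ).1]
  obtain ⟨r, hr, hr1⟩ := H.exists_scaled_step (by linarith) ha2 hx
  obtain ⟨s, hs', hs1⟩ := H'.exists_scaled_step (by linarith) hb2 hX
  have ea : a₁ = a + h * β * (a * (1 - a) + r) :=
    mul_left_cancel₀ (neg_ne_zero.2 hβ.ne) (ha₁.symm.trans hr1)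
  have eb : b₁ = b + h * β * (b * (1 - b) + s) :=
    mul_left_cancel₀ (neg_ne_zero.2 hβ.ne) (hb₁.symm.trans hs1)
  have hw := weight_supersolution ha ha2 hb hb2
  have hhβδ : 0 ≤ 100 * (h * -β * δ) := by
    have := neg_pos.2 hβ
    positivity
  rw [abs_le] at hr hs'
  refine le_of_mul_le_mul_left ?_ (by linarith : 0 < 1 + h * Q)
  calc _ ≤ _ := hbwd
    _ ≤ 100 * δ * (1 + 5 * (a₁ + b₁)) + h * (δ * (-β / 100)) := by gcongr
    _ = 100 * δ * (1 + 5 * (a + b)) - 100 * (h * -β * δ) *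
          (5 * (a * (1 - a) + r + (b * (1 - b) + s)) - 1 / 10000) := by rw [ea, eb]; ring
    _ ≤ 100 * δ * (1 + 5 * (a + b)) - 100 * (h * -β * δ) *
          ((1 - 999 / 1000 * (a + b)) * (1 + 5 * (a + b))) := by gcongr; linarith
    _ = (1 + h * (β * (1 - 999 / 1000 * (a + b)))) * (100 * δ * (1 + 5 * (a + b))) := by ring
    _ ≤ (1 + h * Q) * (100 * δ * (1 + 5 * (a + b))) := by gcongr

/-- The nonzero fixed points of the two normal forms are close. -/
theorem abs_root_sub_le (H : IsNFSystem ε K h β e ω g) (H' : IsNFSystem ε K h β e' ω' G)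
    (hδ : ∀ x ∈ Icc (-ε) ε, |e x - e' x| ≤ δ) : |ω - ω'| ≤ 4 * δ := by
  have hω := Ioo_subset_Icc_self H.root_mem
  obtain ⟨E, hE, h1⟩ := H'.tail.exists_nfRate_sub (β := β) H.small
    (Ioo_subset_Icc_self H'.root_mem) hω
  rw [H'.root_eq, sub_zero] at h1
  have h2 : (ω - ω') * (1 + E) = -(ω ^ 2 * (e ω - e' ω)) := by
    have := H.root_eq
    rw [nfRate] at this h1
    linear_combination -h1 + this
  have h3 : |ω - ω'| * (1 + E) = ω ^ 2 * |e ω - e' ω| := by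
    rw [abs_le] at hE
    have := congrArg abs h2
    rwa [abs_mul, abs_neg, abs_mul, abs_of_pos (by linarith : 0 < 1 + E), abs_pow, sq_abs] at this
  have h4 := hδ ω hω
  have h5 : ω ^ 2 ≤ 1 := by
    have := (abs_le.2 hω).trans H.small.ε_le
    rw [← sq_abs]
    nlinarith [abs_nonneg ω]
  rw [abs_le] at hE
  nlinarith [abs_nonneg (ω - ω'), abs_nonneg (e ω - e' ω)]

end

theorem forward_orbit_induction {P : ℝ → Prop} (h0 : ∀ t ∈ Icc (0 : ℝ) 1, P t)
    (hstep : ∀ t, 0 ≤ t → P t → P (t + 1)) : ∀ t, 0 ≤ t → P t := by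
  have key : ∀ n : ℕ, ∀ t : ℝ, 0 ≤ t → t ≤ n + 1 → P t := by
    intro n
    induction n with
    | zero => intro t h1 h2; exact h0 t ⟨h1, by simpa using h2⟩
    | succ n ih =>
      intro t h1 h2
      rcases le_total t 1 with h | h
      · exact h0 t ⟨h1, h⟩
      · push_cast at h2
        have := hstep (t - 1) (by linarith) (ih _ (by linarith) (by linarith))
        rwa [sub_add_cancel] at this
  intro t ht
  obtain ⟨n, hn⟩ := exists_nat_ge t
  exact key n t ht (by linarith)

theorem backward_orbit_induction {P : ℝ → Prop} (h0 : ∀ t ∈ Icc (0 : ℝ) 1, P t)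
    (hstep : ∀ t, t ≤ 1 → P t → P (t - 1)) : ∀ t, t ≤ 1 → P t := by
  have := forward_orbit_induction (P := fun t => P (1 - t))
    (fun t ht => h0 _ ⟨by linarith [ht.2], by linarith [ht.1]⟩)
    (fun t ht h => by
      have := hstep (1 - t) (by linarith) h
      rwa [sub_sub] at this)
  intro t ht
  have h1 := this (1 - t) (by linarith)
  rwa [sub_sub_cancel] at h1

theorem orbitParam_zero (g : ℝ ≃o ℝ) (a : ℝ) : orbitParam g a 0 = a := by
  rw [orbitParam_of_mem_Icc g a ⟨le_rfl, zero_le_one⟩]; ring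

theorem orbitParam_one (g : ℝ ≃o ℝ) (a : ℝ) : orbitParam g a 1 = g a := by
  rw [orbitParam_of_mem_Icc g a ⟨zero_le_one, le_rfl⟩]; ring

section

variable {ε K h β δ ω ω' : ℝ} {e e' : ℝ → ℝ} {g G : ℝ ≃o ℝ}

namespace IsNFSystem

theorem orbit_lower_mem (H : IsNFSystem ε K h β e ω g) {t : ℝ} (ht : 0 ≤ t) :
    orbitParam g (-ε) t ∈ Ico (-ε) (min 0 ω) := by
  refine ⟨?_, H.ext.isDriftRegion_lower.orbitParam_mem H.lo_mem t⟩
  conv_lhs => rw [← orbitParam_zero g (-ε)]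
  exact (orbitParam_strictMono (H.ext.lower _ H.lo_mem)).monotone ht

theorem upper_base_mem (H : IsNFSystem ε K h β e ω g) : g.symm ε ∈ Ioi (max 0 ω) := by
  rw [← H.ext.isDriftRegion_upper.apply_mem_iff, g.apply_symm_apply]
  exact H.hi_mem

theorem orbit_upper_mem (H : IsNFSystem ε K h β e ω g) {t : ℝ} (ht : t ≤ 1) :
    orbitParam g (g.symm ε) t ∈ Ioc (max 0 ω) ε := by
  refine ⟨H.ext.isDriftRegion_upper.orbitParam_mem H.upper_base_mem t, ?_⟩
  have := (orbitParam_strictMono (H.ext.upper _ H.upper_base_mem)).monotone ht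
  rwa [orbitParam_one, g.apply_symm_apply] at this

theorem start_mem (H : IsNFSystem ε K h β e ω g) (hβ : β ≠ 0) :
    -β / 3 ∈ Ioo (min 0 ω) (max 0 ω) := by
  rcases lt_or_gt_of_ne hβ with h0 | h0
  · have h1 := H.root_pos h0
    rw [min_eq_left h1.1.le, max_eq_right h1.1.le]
    constructor <;> linarith [h1.2.2]
  · have h1 := H.root_neg h0
    rw [min_eq_right h1.1.le, max_eq_left h1.1.le]
    constructor <;> linarith [h1.2.2]

theorem inner_base_mem (H : IsNFSystem ε K h β e ω g) (hβ : β ≠ 0) :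
    g (-β / 3) ∈ Ioo (min 0 ω) (max 0 ω) := (H.ext.apply_mem_inner _).2 (H.start_mem hβ)

theorem inner_base_lt (H : IsNFSystem ε K h β e ω g) (hβ : β ≠ 0) :
    g (-β / 3) < g⁻¹ (g (-β / 3)) :=
  H.ext.isDriftRegion_inner.lt_apply _ (H.inner_base_mem hβ)

theorem orbit_inner_mem (H : IsNFSystem ε K h β e ω g) (hβ : β ≠ 0) (t : ℝ) :
    orbitParam g⁻¹ (g (-β / 3)) t ∈ Ioo (min 0 ω) (max 0 ω) :=
  H.ext.isDriftRegion_inner.orbitParam_mem (H.inner_base_mem hβ) t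

theorem orbit_inner_one (g : ℝ ≃o ℝ) (x : ℝ) : orbitParam g⁻¹ (g x) 1 = x := by
  rw [orbitParam_one]; exact g.symm_apply_apply x

theorem orbit_inner_ge (H : IsNFSystem ε K h β e ω g) (hβ : β ≠ 0) {t : ℝ} (ht : 1 ≤ t) :
    -β / 3 ≤ orbitParam g⁻¹ (g (-β / 3)) t := by
  conv_lhs => rw [← orbit_inner_one g (-β / 3)]
  exact (orbitParam_strictMono (H.inner_base_lt hβ)).monotone ht

theorem orbit_inner_le (H : IsNFSystem ε K h β e ω g) (hβ : β ≠ 0) {t : ℝ} (ht : t ≤ 1) :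
    orbitParam g⁻¹ (g (-β / 3)) t ≤ -β / 3 := by
  conv_rhs => rw [← orbit_inner_one g (-β / 3)]
  exact (orbitParam_strictMono (H.inner_base_lt hβ)).monotone ht

/-- One step to the right on the inner orbits undoes the normal form. -/
theorem nfMap_orbit_inner (H : IsNFSystem ε K h β e ω g) (hβ : β ≠ 0) (t : ℝ) :
    nfMap e h β (orbitParam g⁻¹ (g (-β / 3)) (t + 1)) = orbitParam g⁻¹ (g (-β / 3)) t := by
  rw [← H.ext.eq_nfMap _ (H.inner_subset (Ioo_subset_Icc_self (H.orbit_inner_mem hβ _))),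
    orbitParam_add_one]
  exact g.apply_symm_apply _

end IsNFSystem

theorem orbit_lower_close (H : IsNFSystem ε K h β e ω g) (H' : IsNFSystem ε K h β e' ω' G)
    (hδ0 : 0 ≤ δ) (hδ : ∀ x ∈ Icc (-ε) ε, |e x - e' x| ≤ δ) {t : ℝ} (ht : 0 ≤ t) :
    |orbitParam G (-ε) t - orbitParam g (-ε) t| ≤ 4 * δ := by
  have step : ∀ t, 0 ≤ t → |orbitParam G (-ε) t - orbitParam g (-ε) t| ≤ 4 * δ →
      |orbitParam G (-ε) (t + 1) - orbitParam g (-ε) (t + 1)| ≤ 4 * δ := fun t ht h => by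
    rw [orbitParam_add_one, orbitParam_add_one,
      H.ext.eq_nfMap _ (H.lower_subset (H.orbit_lower_mem ht)),
      H'.ext.eq_nfMap _ (H'.lower_subset (H'.orbit_lower_mem ht))]
    exact lower_step H H' hδ0 hδ (H.orbit_lower_mem ht) (H'.orbit_lower_mem ht) h
  refine forward_orbit_induction (fun t ht => ?_) step t ht
  have h1 := step 0 le_rfl (by simpa [orbitParam_zero] using hδ0)
  rw [zero_add, orbitParam_one, orbitParam_one] at h1
  rw [orbitParam_of_mem_Icc _ _ ht, orbitParam_of_mem_Icc _ _ ht,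
    show -ε + t * (G (-ε) - -ε) - (-ε + t * (g (-ε) - -ε)) = t * (G (-ε) - g (-ε)) by ring,
    abs_mul, abs_of_nonneg ht.1]
  nlinarith [ht.1, ht.2, abs_nonneg (G (-ε) - g (-ε))]

theorem orbit_upper_close (H : IsNFSystem ε K h β e ω g) (H' : IsNFSystem ε K h β e' ω' G)
    (hδ0 : 0 ≤ δ) (hδ : ∀ x ∈ Icc (-ε) ε, |e x - e' x| ≤ δ) {t : ℝ} (ht : t ≤ 1) :
    |orbitParam G (G.symm ε) t - orbitParam g (g.symm ε) t| ≤ 4 * δ := by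
  have step : ∀ t, t ≤ 1 → |orbitParam G (G.symm ε) t - orbitParam g (g.symm ε) t| ≤ 4 * δ →
      |orbitParam G (G.symm ε) (t - 1) - orbitParam g (g.symm ε) (t - 1)| ≤ 4 * δ :=
    fun t ht h => by
    have ht' : t - 1 ≤ 1 := by linarith
    rw [← orbitParam_sub_one g, ← orbitParam_sub_one G,
      H.ext.eq_nfMap _ (H.upper_subset (H.orbit_upper_mem ht')),
      H'.ext.eq_nfMap _ (H'.upper_subset (H'.orbit_upper_mem ht'))] at h
    exact upper_step H H' hδ0 hδ (H.orbit_upper_mem ht') (H'.orbit_upper_mem ht') h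
  refine backward_orbit_induction (fun t ht => ?_) step t ht
  have h1 := step 1 le_rfl (by
    simpa only [orbitParam_one, OrderIso.apply_symm_apply, sub_self, abs_zero] using
      mul_nonneg zero_le_four hδ0)
  rw [sub_self, orbitParam_zero, orbitParam_zero] at h1
  rw [orbitParam_of_mem_Icc _ _ ht, orbitParam_of_mem_Icc _ _ ht, G.apply_symm_apply,
    g.apply_symm_apply,
    show G.symm ε + t * (ε - G.symm ε) - (g.symm ε + t * (ε - g.symm ε))
      = (1 - t) * (G.symm ε - g.symm ε) by ring, abs_mul,
    abs_of_nonneg (by linarith [ht.2] : 0 ≤ 1 - t)]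
  nlinarith [ht.1, ht.2, abs_nonneg (G.symm ε - g.symm ε)]

/-- On the fundamental domain between the fixed points the conjugacy is affine and fixes the right
end point, so it moves points by at most as much as the left end point. -/
theorem orbit_inner_start_close (H : IsNFSystem ε K h β e ω g) (H' : IsNFSystem ε K h β e' ω' G)
    (hβ : β ≠ 0) (hδ0 : 0 ≤ δ) (hδ : ∀ x ∈ Icc (-ε) ε, |e x - e' x| ≤ δ) {t : ℝ}
    (ht : t ∈ Icc (0 : ℝ) 1) :
    |orbitParam G⁻¹ (G (-β / 3)) t - orbitParam g⁻¹ (g (-β / 3)) t| ≤ δ := by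
  have hm := H.inner_subset (Ioo_subset_Icc_self (H.start_mem hβ))
  obtain ⟨Q, -, -, hfwd, -⟩ := nfMap_pair_step H.small H'.tail hδ hm hm
  rw [sub_self, abs_zero, mul_zero, zero_add, ← H.ext.eq_nfMap _ hm, ← H'.ext.eq_nfMap _ hm]
    at hfwd
  have h1 : |G (-β / 3) - g (-β / 3)| ≤ δ := by
    refine hfwd.trans ?_
    have h2 := H.small.abs_cube_le hm
    have h3 : |-β / 3| ≤ 1 := (abs_le.2 hm).trans (by linarith [H.small.ε_le])
    calc h * (δ * |-β / 3| ^ 3) ≤ 1 * (δ * 1) := by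
          have := H.small.h_pos
          have := H.small.h_le
          gcongr
          linarith
      _ = δ := by ring
  have e1 : (g⁻¹ : ℝ ≃o ℝ) (g (-β / 3)) = -β / 3 := g.symm_apply_apply _
  have e2 : (G⁻¹ : ℝ ≃o ℝ) (G (-β / 3)) = -β / 3 := G.symm_apply_apply _
  rw [orbitParam_of_mem_Icc _ _ ht, orbitParam_of_mem_Icc _ _ ht, e1, e2,
    show G (-β / 3) + t * (-β / 3 - G (-β / 3)) - (g (-β / 3) + t * (-β / 3 - g (-β / 3)))
      = (1 - t) * (G (-β / 3) - g (-β / 3)) by ring, abs_mul,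
    abs_of_nonneg (by linarith [ht.2] : 0 ≤ 1 - t)]
  nlinarith [ht.1, ht.2, abs_nonneg (G (-β / 3) - g (-β / 3))]

/-- Between the fixed points, towards `0` the distance of corresponding orbits is controlled by
contraction and towards the other fixed point by the weighted distance. -/
theorem orbit_inner_close (H : IsNFSystem ε K h β e ω g) (H' : IsNFSystem ε K h β e' ω' G)
    (hβ : β ≠ 0) (hδ0 : 0 ≤ δ) (hδ : ∀ x ∈ Icc (-ε) ε, |e x - e' x| ≤ δ) (t : ℝ) :
    |orbitParam G⁻¹ (G (-β / 3)) t - orbitParam g⁻¹ (g (-β / 3)) t| ≤ 2100 * δ := by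
  set S := orbitParam g⁻¹ (g (-β / 3)) with hS
  set T := orbitParam G⁻¹ (G (-β / 3)) with hT
  have h0 : ∀ t ∈ Icc (0 : ℝ) 1, |T t - S t| ≤ δ := fun t ht =>
    orbit_inner_start_close H H' hβ hδ0 hδ ht
  have hSm : ∀ t, S t ∈ Icc (-ε) ε := fun t =>
    H.inner_subset (Ioo_subset_Icc_self (H.orbit_inner_mem hβ t))
  have hTm : ∀ t, T t ∈ Icc (-ε) ε := fun t =>
    H'.inner_subset (Ioo_subset_Icc_self (H'.orbit_inner_mem hβ t))
  choose a ha0 ha2 hSa using fun t => H.exists_inner_coord hβ (H.orbit_inner_mem hβ t)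
  choose b hb0 hb2 hTb using fun t => H'.exists_inner_coord hβ (H'.orbit_inner_mem hβ t)
  have hSn : ∀ t, nfMap e h β (-β * a (t + 1)) = -β * a t := fun t => by
    rw [← hSa, ← hSa]; exact H.nfMap_orbit_inner hβ t
  have hTn : ∀ t, nfMap e' h β (-β * b (t + 1)) = -β * b t := fun t => by
    rw [← hTb, ← hTb]; exact H'.nfMap_orbit_inner hβ t
  have hw0 : ∀ t ∈ Icc (0 : ℝ) 1, |T t - S t| ≤ 100 * δ * (1 + 5 * (a t + b t)) := fun t ht => by
    refine (h0 t ht).trans ?_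
    nlinarith [ha0 t, hb0 t, mul_nonneg hδ0 (add_pos (ha0 t) (hb0 t)).le]
  -- `a, b ≤ 2` and `100 * (1 + 5 * (2 + 2)) = 2100`
  have hw : ∀ t, |T t - S t| ≤ 100 * δ * (1 + 5 * (a t + b t)) → |T t - S t| ≤ 2100 * δ :=
    fun t ht => by nlinarith [ha2 t, hb2 t]
  have hSge : ∀ t, 1 ≤ t → -β / 3 ≤ -β * a t := fun t ht => by
    rw [← hSa]; exact H.orbit_inner_ge hβ ht
  have hTge : ∀ t, 1 ≤ t → -β / 3 ≤ -β * b t := fun t ht => by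
    rw [← hTb]; exact H'.orbit_inner_ge hβ ht
  have hSle : ∀ t, t ≤ 1 → -β * a t ≤ -β / 3 := fun t ht => by
    rw [← hSa]; exact H.orbit_inner_le hβ ht
  have hTle : ∀ t, t ≤ 1 → -β * b t ≤ -β / 3 := fun t ht => by
    rw [← hTb]; exact H'.orbit_inner_le hβ ht
  have hSm' : ∀ t, -β * a t ∈ Icc (-ε) ε := fun t => by rw [← hSa]; exact hSm t
  have hTm' : ∀ t, -β * b t ∈ Icc (-ε) ε := fun t => by rw [← hTb]; exact hTm t
  have hST : ∀ t, T t - S t = -β * b t - -β * a t := fun t => by rw [← hSa, ← hTb]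
  simp only [hST] at h0 hw0 hw ⊢
  -- Both orbits increase with `t`, and applying the normal forms decreases `t` by `1`. For `β < 0`
  -- they go from `0` to the other fixed points, for `β > 0` from the other fixed points to `0`.
  rcases lt_or_gt_of_ne hβ with hneg | hpos
  · rcases le_total 0 t with ht | ht
    · refine hw t (forward_orbit_induction
        (P := fun t => |-β * b t - -β * a t| ≤ 100 * δ * (1 + 5 * (a t + b t))) hw0
        (fun t ht h => ?_) t ht)
      have h1 : 1 / 3 ≤ a (t + 1) := by nlinarith [hSge (t + 1) (by linarith)]
      have h2 : 1 / 3 ≤ b (t + 1) := by nlinarith [hTge (t + 1) (by linarith)]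
      exact weighted_step_neg H H' hneg hδ0 hδ h1 (ha2 _) h2 (hb2 _) (hSm' _) (hTm' _)
        (hSn t) (hTn t) h
    · refine le_trans (backward_orbit_induction (P := fun t => |-β * b t - -β * a t| ≤ δ) h0
        (fun t ht h => ?_) t (ht.trans zero_le_one)) (by linarith)
      have h1 : a t ≤ 1 / 3 := by nlinarith [hSle t ht]
      have h2 : b t ≤ 1 / 3 := by nlinarith [hTle t ht]
      have h3 := hSn (t - 1)
      have h4 := hTn (t - 1)
      rw [sub_add_cancel] at h3 h4
      rw [← h3, ← h4]
      exact inner_step_neg H H' hneg hδ0 hδ (ha0 t) h1 (hb0 t) h2 (hSm' _) (hTm' _) h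
  · rcases le_total 0 t with ht | ht
    · refine le_trans (forward_orbit_induction (P := fun t => |-β * b t - -β * a t| ≤ δ) h0
        (fun t ht h => ?_) t ht) (by linarith)
      have h1 : a (t + 1) ≤ 1 / 3 := by nlinarith [hSge (t + 1) (by linarith)]
      have h2 : b (t + 1) ≤ 1 / 3 := by nlinarith [hTge (t + 1) (by linarith)]
      refine inner_step_pos H H' hpos hδ0 hδ (ha0 _) h1 (hb0 _) h2 (hSm' _) (hTm' _) ?_
      rw [hSn, hTn]
      exact h
    · refine hw t (backward_orbit_induction
        (P := fun t => |-β * b t - -β * a t| ≤ 100 * δ * (1 + 5 * (a t + b t))) hw0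
        (fun t ht h => ?_) t (ht.trans zero_le_one))
      have h1 : 1 / 3 ≤ a t := by nlinarith [hSle t ht]
      have h2 : 1 / 3 ≤ b t := by nlinarith [hTle t ht]
      have h3 := hSn (t - 1)
      have h4 := hTn (t - 1)
      rw [sub_add_cancel] at h3 h4
      exact weighted_step_pos H H' hpos hδ0 hδ h1 (ha2 _) h2 (hb2 _) (hSm' _) (hTm' _) h3 h4 h

/-! ### The conjugacy between two normal forms -/

/-- The conjugacy obtained by transporting orbits below, between and above the fixed points. The
inverses move points to the right between the fixed points and parametrize the orbits there; the
base point `g (-β / 3)` makes `[g (-β / 3), -β / 3]` the fundamental domain. -/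
def nfConj (ε β ω ω' : ℝ) (g G : ℝ ≃o ℝ) : ℝ → ℝ :=
  glueAt (min 0 ω) (max 0 ω) (min 0 ω') (max 0 ω') (orbitTransport g G (-ε) (-ε))
    (orbitTransport g⁻¹ G⁻¹ (g (-β / 3)) (G (-β / 3)))
    (orbitTransport g G (g.symm ε) (G.symm ε))

theorem IsNFSystem.fixed_eq_iff (H : IsNFSystem ε K h β e ω g) :
    min 0 ω = max 0 ω ↔ β = 0 := by
  have hiff : min 0 ω = max 0 ω ↔ 0 = ω := by
    rcases le_total 0 ω with h0 | h0
    · rw [min_eq_left h0, max_eq_right h0]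
    · rw [min_eq_right h0, max_eq_left h0, eq_comm]
  rw [hiff]
  constructor
  · intro h0
    by_contra hβ
    rcases lt_or_gt_of_ne hβ with h1 | h1
    · exact (H.root_pos h1).1.ne h0
    · exact (H.root_neg h1).1.ne h0.symm
  · intro h0
    exact (H.root_zero h0).symm

theorem IsNFSystem.inner_nonempty (H : IsNFSystem ε K h β e ω g) {x : ℝ}
    (hx : x ∈ Ioo (min 0 ω) (max 0 ω)) : β ≠ 0 := fun h0 =>
  (hx.1.trans hx.2).ne (H.fixed_eq_iff.2 h0)

theorem strictMono_nfConj (H : IsNFSystem ε K h β e ω g) (H' : IsNFSystem ε K h β e' ω' G) :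
    StrictMono (nfConj ε β ω ω' g G) := by
  refine strictMono_glueAt min_le_max min_le_max (H.fixed_eq_iff.trans H'.fixed_eq_iff.symm)
    ?_ ?_ ?_ ?_ ?_ ?_
  · exact H.ext.isDriftRegion_lower.strictMonoOn_orbitTransport H'.ext.isDriftRegion_lower
      H.lo_mem H'.lo_mem
  · intro x hx
    have hβ := H.inner_nonempty hx
    exact H.ext.isDriftRegion_inner.strictMonoOn_orbitTransport H'.ext.isDriftRegion_inner
      (H.inner_base_mem hβ) (H'.inner_base_mem hβ) hx
  · exact H.ext.isDriftRegion_upper.strictMonoOn_orbitTransport H'.ext.isDriftRegion_upper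
      H.upper_base_mem H'.upper_base_mem
  · exact fun x _ => H'.ext.isDriftRegion_lower.mapsTo_orbitTransport H'.lo_mem x
  · exact fun x hx => H'.ext.isDriftRegion_inner.mapsTo_orbitTransport
      (H'.inner_base_mem (H.inner_nonempty hx)) x
  · exact fun x _ => H'.ext.isDriftRegion_upper.mapsTo_orbitTransport H'.upper_base_mem x

theorem surjective_nfConj (H : IsNFSystem ε K h β e ω g) (H' : IsNFSystem ε K h β e' ω' G) :
    Function.Surjective (nfConj ε β ω ω' g G) := by
  refine surjective_glueAt min_le_max min_le_max
    (H.fixed_eq_iff.trans H'.fixed_eq_iff.symm).1 ?_ ?_ ?_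
  · exact H.ext.isDriftRegion_lower.surjOn_orbitTransport H'.ext.isDriftRegion_lower
      H.lo_mem H'.lo_mem
  · intro x hx
    have hβ := H'.inner_nonempty hx
    exact H.ext.isDriftRegion_inner.surjOn_orbitTransport H'.ext.isDriftRegion_inner
      (H.inner_base_mem hβ) (H'.inner_base_mem hβ) hx
  · exact H.ext.isDriftRegion_upper.surjOn_orbitTransport H'.ext.isDriftRegion_upper
      H.upper_base_mem H'.upper_base_mem

theorem nfConj_min : nfConj ε β ω ω' g G (min 0 ω) = min 0 ω' := glueAt_left

theorem nfConj_max (H : IsNFSystem ε K h β e ω g) (H' : IsNFSystem ε K h β e' ω' G) :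
    nfConj ε β ω ω' g G (max 0 ω) = max 0 ω' :=
  glueAt_right min_le_max (H.fixed_eq_iff.trans H'.fixed_eq_iff.symm).1

theorem nfConj_zero (H : IsNFSystem ε K h β e ω g) (H' : IsNFSystem ε K h β e' ω' G) :
    nfConj ε β ω ω' g G 0 = 0 := by
  rcases le_total β 0 with h0 | h0
  · have key : ∀ {e ω g}, IsNFSystem ε K h β e ω g → min 0 ω = 0 := fun H => by
      rcases h0.eq_or_lt with h1 | h1
      · rw [H.root_zero h1, min_self]
      · exact min_eq_left (H.root_pos h1).1.le
    have := nfConj_min (ε := ε) (β := β) (ω := ω) (ω' := ω') (g := g) (G := G)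
    rwa [key H, key H'] at this
  · have key : ∀ {e ω g}, IsNFSystem ε K h β e ω g → max 0 ω = 0 := fun H => by
      rcases h0.eq_or_lt with h1 | h1
      · rw [H.root_zero h1.symm, max_self]
      · exact max_eq_left (H.root_neg h1).1.le
    have := nfConj_max H H'
    rwa [key H, key H'] at this

theorem nfConj_apply (H : IsNFSystem ε K h β e ω g) (H' : IsNFSystem ε K h β e' ω' G) (x : ℝ) :
    nfConj ε β ω ω' g G (g x) = G (nfConj ε β ω ω' g G x) := by
  rcases mem_regions (min 0 ω) (max 0 ω) x with hx | rfl | hx | rfl | hx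
  · have hx' : g x < min 0 ω := (H.ext.isDriftRegion_lower.apply_mem_iff x).2 hx
    rw [nfConj, glueAt_of_lt hx, glueAt_of_lt hx']
    exact H.ext.isDriftRegion_lower.orbitTransport_apply H.lo_mem hx
  · rw [H.ext.min_root, nfConj_min, H'.ext.min_root]
  · have hβ := H.inner_nonempty hx
    have hx' := (H.ext.apply_mem_inner x).2 hx
    rw [nfConj, glueAt_of_mem hx, glueAt_of_mem hx']
    have := H.ext.isDriftRegion_inner.orbitTransport_apply (G := G⁻¹) (a' := G (-β / 3))
      (H.inner_base_mem hβ) hx'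
    rw [show (g⁻¹ : ℝ ≃o ℝ) (g x) = x from g.symm_apply_apply x] at this
    rw [this]
    exact (G.apply_symm_apply _).symm
  · rw [H.ext.max_root, nfConj_max H H', H'.ext.max_root]
  · have hx' : max 0 ω < g x := (H.ext.isDriftRegion_upper.apply_mem_iff x).2 hx
    rw [nfConj, glueAt_of_gt min_le_max hx, glueAt_of_gt min_le_max hx']
    exact H.ext.isDriftRegion_upper.orbitTransport_apply H.upper_base_mem hx

theorem nfConj_lower_start (H : IsNFSystem ε K h β e ω g) {x : ℝ}
    (hx : x ∈ Icc (-ε) (g (-ε))) :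
    nfConj ε β ω ω' g G x = affineInterp (-ε) (-ε) (g (-ε)) (G (-ε)) x := by
  have hx' : x < min 0 ω :=
    hx.2.trans_lt ((H.ext.isDriftRegion_lower.apply_mem_iff _).2 H.lo_mem)
  rw [nfConj, glueAt_of_lt hx']
  exact H.ext.isDriftRegion_lower.orbitTransport_eq_affineInterp H.lo_mem hx

theorem nfConj_upper_start (H : IsNFSystem ε K h β e ω g) {x : ℝ}
    (hx : x ∈ Icc (g.symm ε) ε) :
    nfConj ε β ω ω' g G x = affineInterp (g.symm ε) (G.symm ε) ε ε x := by
  have hx' : max 0 ω < x := H.upper_base_mem.trans_le hx.1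
  rw [nfConj, glueAt_of_gt min_le_max hx']
  have := H.ext.isDriftRegion_upper.orbitTransport_eq_affineInterp (G := G) (a' := G.symm ε)
    H.upper_base_mem (x := x) (by rwa [g.apply_symm_apply])
  rwa [g.apply_symm_apply, G.apply_symm_apply] at this

theorem nfConj_inner_start (H : IsNFSystem ε K h β e ω g) (hβ : β ≠ 0) {x : ℝ}
    (hx : x ∈ Icc (g (-β / 3)) (-β / 3)) :
    nfConj ε β ω ω' g G x
      = affineInterp (g (-β / 3)) (G (-β / 3)) (-β / 3) (-β / 3) x := by
  have hx' : x ∈ Ioo (min 0 ω) (max 0 ω) :=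
    ⟨(H.inner_base_mem hβ).1.trans_le hx.1, hx.2.trans_lt (H.start_mem hβ).2⟩
  rw [nfConj, glueAt_of_mem hx']
  have e1 : (g⁻¹ : ℝ ≃o ℝ) (g (-β / 3)) = -β / 3 := g.symm_apply_apply _
  have e2 : (G⁻¹ : ℝ ≃o ℝ) (G (-β / 3)) = -β / 3 := G.symm_apply_apply _
  have := H.ext.isDriftRegion_inner.orbitTransport_eq_affineInterp (G := G⁻¹) (a' := G (-β / 3))
    (H.inner_base_mem hβ) (x := x) (by rwa [e1])
  rwa [e1, e2] at this

theorem nfConj_left (H : IsNFSystem ε K h β e ω g) : nfConj ε β ω ω' g G (-ε) = -ε := by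
  rw [nfConj_lower_start H ⟨le_rfl, (H.ext.lower _ H.lo_mem).le⟩]
  simp [affineInterp]

theorem nfConj_right (H : IsNFSystem ε K h β e ω g) : nfConj ε β ω ω' g G ε = ε := by
  have h1 : g.symm ε < ε := by
    have := H.ext.upper _ H.upper_base_mem
    rwa [g.apply_symm_apply] at this
  rw [nfConj_upper_start H ⟨h1.le, le_rfl⟩, affineInterp,
    div_self (sub_pos.2 h1).ne']
  ring

theorem abs_sub_nfConj_le (H : IsNFSystem ε K h β e ω g) (H' : IsNFSystem ε K h β e' ω' G)
    (hδ0 : 0 ≤ δ) (hδ : ∀ x ∈ Icc (-ε) ε, |e x - e' x| ≤ δ) {x : ℝ} (hx : x ∈ Icc (-ε) ε) :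
    |x - nfConj ε β ω ω' g G x| ≤ 2100 * δ := by
  have hroot := abs_root_sub_le H H' hδ
  have hmin : |min 0 ω - min 0 ω'| ≤ |ω - ω'| := by simpa using abs_min_sub_min_le_max 0 ω 0 ω'
  have hmax : |max 0 ω - max 0 ω'| ≤ |ω - ω'| := by simpa using abs_max_sub_max_le_max 0 ω 0 ω'
  rcases mem_regions (min 0 ω) (max 0 ω) x with hx' | rfl | hx' | rfl | hx'
  · obtain ⟨t, rfl⟩ := H.ext.isDriftRegion_lower.exists_orbitParam_eq H.lo_mem hx'
    have ht : 0 ≤ t := by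
      have h1 := hx.1
      conv_lhs at h1 => rw [← orbitParam_zero g (-ε)]
      exact (orbitParam_strictMono (H.ext.lower _ H.lo_mem)).le_iff_le.1 h1
    rw [nfConj, glueAt_of_lt hx', H.ext.isDriftRegion_lower.orbitTransport_orbitParam H.lo_mem,
      abs_sub_comm]
    linarith [orbit_lower_close H H' hδ0 hδ ht]
  · rw [nfConj_min]; linarith
  · have hβ := H.inner_nonempty hx'
    obtain ⟨t, rfl⟩ := H.ext.isDriftRegion_inner.exists_orbitParam_eq (H.inner_base_mem hβ) hx'
    rw [nfConj, glueAt_of_mem hx',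
      H.ext.isDriftRegion_inner.orbitTransport_orbitParam (H.inner_base_mem hβ), abs_sub_comm]
    exact orbit_inner_close H H' hβ hδ0 hδ t
  · rw [nfConj_max H H']; linarith
  · obtain ⟨t, rfl⟩ := H.ext.isDriftRegion_upper.exists_orbitParam_eq H.upper_base_mem hx'
    have ht : t ≤ 1 := by
      have h1 := hx.2
      conv_rhs at h1 => rw [← g.apply_symm_apply ε, ← orbitParam_one]
      exact (orbitParam_strictMono (H.ext.upper _ H.upper_base_mem)).le_iff_le.1 h1
    rw [nfConj, glueAt_of_gt min_le_max hx',
      H.ext.isDriftRegion_upper.orbitTransport_orbitParam H.upper_base_mem, abs_sub_comm]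
    linarith [orbit_upper_close H H' hδ0 hδ ht]

end

section

variable {ε K h β δ ω ω' : ℝ} {e e' : ℝ → ℝ} {g G : ℝ ≃o ℝ}

namespace IsNFSystem

theorem iterate_inner_mem (H : IsNFSystem ε K h β e ω g) (hβ : β ≠ 0) (n : ℕ) :
    (nfMap e h β)^[n] (-β / 3) ∈ Ioo (min 0 ω) (max 0 ω) := by
  induction n with
  | zero => exact H.start_mem hβ
  | succ n ih =>
    rw [Function.iterate_succ_apply', ← H.ext.eq_nfMap _ (H.inner_subset (Ioo_subset_Icc_self ih))]
    exact (H.ext.apply_mem_inner _).2 ih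

theorem symm_mem_inner (H : IsNFSystem ε K h β e ω g) {x : ℝ}
    (hx : x ∈ Ioo (min 0 ω) (max 0 ω)) : g.symm x ∈ Ioo (min 0 ω) (max 0 ω) := by
  rw [← H.ext.apply_mem_inner, g.apply_symm_apply]; exact hx

theorem localInv_inner (H : IsNFSystem ε K h β e ω g) {x : ℝ}
    (hx : x ∈ Ioo (min 0 ω) (max 0 ω)) : localInv (nfMap e h β) ε x = g.symm x :=
  H.ext.localInv_eq (H.inner_subset (Ioo_subset_Icc_self (H.symm_mem_inner hx)))

theorem localInv_iterate_inner_mem (H : IsNFSystem ε K h β e ω g) (hβ : β ≠ 0) (n : ℕ) :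
    (localInv (nfMap e h β) ε)^[n] (-β / 3) ∈ Ioo (min 0 ω) (max 0 ω) := by
  induction n with
  | zero => exact H.start_mem hβ
  | succ n ih =>
    rw [Function.iterate_succ_apply', H.localInv_inner ih]
    exact H.symm_mem_inner ih

theorem iterate_lower_mem (H : IsNFSystem ε K h β e ω g) (n : ℕ) :
    (nfMap e h β)^[n] (-ε) ∈ Ico (-ε) (min 0 ω) := by
  induction n with
  | zero => exact ⟨le_rfl, H.lo_mem⟩
  | succ n ih =>
    rw [Function.iterate_succ_apply', ← H.ext.eq_nfMap _ (H.lower_subset ih)]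
    exact ⟨ih.1.trans (H.ext.lower _ ih.2).le, (H.ext.isDriftRegion_lower.apply_mem_iff _).2 ih.2⟩

theorem iterate_lower_ge (H : IsNFSystem ε K h β e ω g) {n : ℕ} (hn : 1 ≤ n) :
    g (-ε) ≤ (nfMap e h β)^[n] (-ε) := by
  obtain ⟨m, rfl⟩ := Nat.exists_eq_add_of_le' hn
  have hm := H.iterate_lower_mem m
  rw [Function.iterate_succ_apply', ← H.ext.eq_nfMap _ (H.lower_subset hm)]
  exact g.monotone hm.1

theorem symm_upper_mem (H : IsNFSystem ε K h β e ω g) {x : ℝ} (hx : x ∈ Ioc (max 0 ω) ε) :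
    g.symm x ∈ Ioc (max 0 ω) ε := by
  have h1 : g.symm x ∈ Ioi (max 0 ω) := by
    rw [← H.ext.isDriftRegion_upper.apply_mem_iff, g.apply_symm_apply]
    exact hx.1
  refine ⟨h1, le_trans ?_ hx.2⟩
  have := H.ext.upper _ h1
  rw [g.apply_symm_apply] at this
  exact this.le

theorem localInv_upper (H : IsNFSystem ε K h β e ω g) {x : ℝ} (hx : x ∈ Ioc (max 0 ω) ε) :
    localInv (nfMap e h β) ε x = g.symm x :=
  H.ext.localInv_eq (H.upper_subset (H.symm_upper_mem hx))

theorem localInv_iterate_upper_mem (H : IsNFSystem ε K h β e ω g) (n : ℕ) :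
    (localInv (nfMap e h β) ε)^[n] ε ∈ Ioc (max 0 ω) ε := by
  induction n with
  | zero => exact ⟨H.hi_mem, le_rfl⟩
  | succ n ih =>
    rw [Function.iterate_succ_apply', H.localInv_upper ih]
    exact H.symm_upper_mem ih

end IsNFSystem

theorem nfConj_mem_Icc_iff (H : IsNFSystem ε K h β e ω g) (H' : IsNFSystem ε K h β e' ω' G)
    {x : ℝ} : nfConj ε β ω ω' g G x ∈ Icc (-ε) ε ↔ x ∈ Icc (-ε) ε := by
  have hm := strictMono_nfConj H H'
  rw [mem_Icc, mem_Icc]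
  conv_lhs => rw [← nfConj_left (ω' := ω') (G := G) H]
  conv_lhs => rhs; rhs; rw [← nfConj_right (ω' := ω') (G := G) H]
  rw [hm.le_iff_le, hm.le_iff_le]

theorem builtFromFundamentalDomains_nfConj (H : IsNFSystem ε K h β e ω g)
    (H' : IsNFSystem ε K h β e' ω' G) :
    BuiltFromFundamentalDomains (nfMap e h β) (nfMap e' h β) ε β (nfConj ε β ω ω' g G) := by
  have hmono := strictMono_nfConj H H'
  have hmem : ∀ {x}, x ∈ Icc (-ε) ε → nfConj ε β ω ω' g G x ∈ Icc (-ε) ε := fun hx =>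
    (nfConj_mem_Icc_iff H H').2 hx
  have hfwd : ∀ {x}, g.symm x ∈ Icc (-ε) ε →
      nfConj ε β ω ω' g G x = nfMap e' h β (nfConj ε β ω ω' g G (localInv (nfMap e h β) ε x)) :=
    fun {x} hx => by
      rw [H.ext.localInv_eq hx, ← H'.ext.eq_nfMap _ (hmem hx), ← nfConj_apply H H',
        g.apply_symm_apply]
  have hbwd : ∀ {x}, x ∈ Icc (-ε) ε →
      nfConj ε β ω ω' g G x = localInv (nfMap e' h β) ε (nfConj ε β ω ω' g G (nfMap e h β x)) :=
    fun {x} hx => by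
      rw [← H.ext.eq_nfMap _ hx, nfConj_apply H H', H'.ext.localInv_eq] <;>
        rw [G.symm_apply_apply]
      exact hmem hx
  have hlast : localInv (nfMap e h β) ε ε = g.symm ε := H.localInv_upper ⟨H.hi_mem, le_rfl⟩
  have hlast' : localInv (nfMap e' h β) ε ε = G.symm ε := H'.localInv_upper ⟨H'.hi_mem, le_rfl⟩
  refine ⟨fun hβ x hx => ?_, fun hβ n _ x hx => ?_, fun hβ n x hx => ?_, fun x hx => ?_,
    fun n hn x hx => ?_, fun x hx => ?_, fun n hn x hx => ?_, nfConj_zero H H',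
    fun y hy hfix hne => ?_⟩
  · have h1 := H.inner_subset (Ioo_subset_Icc_self (H.start_mem hβ))
    rw [← H.ext.eq_nfMap _ h1] at hx ⊢
    rw [← H'.ext.eq_nfMap _ h1]
    exact nfConj_inner_start H hβ hx
  · exact hfwd (H.inner_subset (Ioo_subset_Icc_self (H.symm_mem_inner
      ⟨(H.iterate_inner_mem hβ _).1.trans_le hx.1, hx.2.trans_lt (H.iterate_inner_mem hβ _).2⟩)))
  · exact hbwd (H.inner_subset ⟨(H.localInv_iterate_inner_mem hβ _).1.le.trans hx.1,
      hx.2.trans (H.localInv_iterate_inner_mem hβ _).2.le⟩)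
  · rw [← H.ext.eq_nfMap _ H.small.left_mem] at hx ⊢
    rw [← H'.ext.eq_nfMap _ H.small.left_mem]
    exact nfConj_lower_start H hx
  · refine hfwd (H.lower_subset ⟨?_, ?_⟩)
    · rw [g.le_symm_apply]
      exact (H.iterate_lower_ge hn).trans hx.1
    · have h1 : g.symm x ∈ Iio (min 0 ω) := by
        rw [← H.ext.isDriftRegion_lower.apply_mem_iff, g.apply_symm_apply]
        exact hx.2.trans_lt (H.iterate_lower_mem _).2
      exact h1
  · rw [hlast] at hx ⊢
    rw [hlast']
    exact nfConj_upper_start H hx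
  · exact hbwd (H.upper_subset ⟨(H.localInv_iterate_upper_mem _).1.trans_le hx.1,
      hx.2.trans (H.localInv_iterate_upper_mem _).2⟩)
  · have hgy : g y = y := (H.ext.eq_nfMap _ hy).trans hfix
    refine ⟨?_, fun h0 => hne ?_⟩
    · rw [← H'.ext.eq_nfMap _ (hmem hy), ← nfConj_apply H H', hgy]
    · rw [← nfConj_zero H H'] at h0
      exact hmono.injective h0

/-- Two normal forms with `δ`-close tails are conjugate, at a fixed step-size and parameter, by an
increasing homeomorphism which is `O(δ)`-close to the identity, with an absolute constant. -/
theorem exists_nf_conjugacy (hs : SmallParams ε K h β) (he : TailBound ε K e)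
    (he' : TailBound ε K e') (hδ0 : 0 ≤ δ) (hδ : ∀ x ∈ Icc (-ε) ε, |e x - e' x| ≤ δ) :
    ∃ J : ℝ ≃o ℝ, BuiltFromFundamentalDomains (nfMap e h β) (nfMap e' h β) ε β J ∧
      (∀ x ∈ Icc (-ε) ε, J (nfMap e h β x) = nfMap e' h β (J x)) ∧
      (∀ x, J x ∈ Icc (-ε) ε ↔ x ∈ Icc (-ε) ε) ∧
      ∀ x ∈ Icc (-ε) ε, |x - J x| ≤ 2100 * δ := by
  obtain ⟨ω, g, H⟩ := he.exists_system hs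
  obtain ⟨ω', G, H'⟩ := he'.exists_system hs
  refine ⟨(strictMono_nfConj H H').orderIsoOfSurjective _ (surjective_nfConj H H'),
    builtFromFundamentalDomains_nfConj H H', fun x hx => ?_, fun x => nfConj_mem_Icc_iff H H',
    fun x hx => abs_sub_nfConj_le H H' hδ0 hδ hx⟩
  rw [StrictMono.coe_orderIsoOfSurjective, ← H.ext.eq_nfMap _ hx, nfConj_apply H H',
    H'.ext.eq_nfMap _ ((nfConj_mem_Icc_iff H H').2 hx)]

end

/-! ### Expansions of the time-`h` map and of the method at the equilibrium -/

/-- An inequality between continuous germs extends from `h > 0`, `x ≠ 0` to `h ≥ 0`. -/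
theorem eventually_le_of_pos {u v : ℝ × ℝ × ℝ → ℝ} {n : ℕ} (hu : ContDiffAt ℝ n u 0)
    (hv : ContDiffAt ℝ n v 0)
    (h : ∀ᶠ q in 𝓝 (0 : ℝ × ℝ × ℝ), 0 < q.1 → q.2.1 ≠ 0 → u q ≤ v q) :
    ∀ᶠ q in 𝓝 (0 : ℝ × ℝ × ℝ), 0 ≤ q.1 → u q ≤ v q := by
  filter_upwards [hu.eventually (by simp), hv.eventually (by simp), eventually_eventually_nhds.2 h]
    with q h1 h2 h3 h4
  have hcl : q ∈ closure {q : ℝ × ℝ × ℝ | 0 < q.1 ∧ q.2.1 ≠ 0} := by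
    have : {q : ℝ × ℝ × ℝ | 0 < q.1 ∧ q.2.1 ≠ 0} = Ioi 0 ×ˢ ({0}ᶜ ×ˢ univ) := by
      ext q; simp
    rw [this, closure_prod_eq, closure_prod_eq, closure_Ioi, (dense_compl_singleton (0 : ℝ)).closure_eq]
    exact ⟨h4, trivial, subset_closure trivial⟩
  have : (𝓝[{q : ℝ × ℝ × ℝ | 0 < q.1 ∧ q.2.1 ≠ 0}] q).NeBot := mem_closure_iff_nhdsWithin_neBot.1 hcl
  refine le_of_tendsto_of_tendsto (b := 𝓝[{q : ℝ × ℝ × ℝ | 0 < q.1 ∧ q.2.1 ≠ 0}] q)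
    (h1.continuousAt.tendsto.mono_left nhdsWithin_le_nhds)
    (h2.continuousAt.tendsto.mono_left nhdsWithin_le_nhds) ?_
  filter_upwards [nhdsWithin_le_nhds h3, self_mem_nhdsWithin] with q' h5 h6
  exact h5 h6.1 h6.2

theorem eventually_eq_of_pos {u v : ℝ × ℝ × ℝ → ℝ} {n : ℕ} (hu : ContDiffAt ℝ n u 0)
    (hv : ContDiffAt ℝ n v 0)
    (h : ∀ᶠ q in 𝓝 (0 : ℝ × ℝ × ℝ), 0 < q.1 → q.2.1 ≠ 0 → u q = v q) :
    ∀ᶠ q in 𝓝 (0 : ℝ × ℝ × ℝ), 0 ≤ q.1 → u q = v q := by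
  filter_upwards [eventually_le_of_pos hu hv (h.mono fun q hq h1 h2 => (hq h1 h2).le),
    eventually_le_of_pos hv hu (h.mono fun q hq h1 h2 => (hq h1 h2).ge)] with q h1 h2 h3
  exact le_antisymm (h1 h3) (h2 h3)

theorem exists_step_quotient {n : ℕ} {F : ℝ × ℝ × ℝ → ℝ}
    (hF : ContDiffAt ℝ ((n + 1 : ℕ) : WithTop ℕ∞) F 0) :
    ∃ Q : ℝ × ℝ × ℝ → ℝ, ContDiffAt ℝ n Q 0 ∧
      ∀ᶠ q in 𝓝 (0 : ℝ × ℝ × ℝ), F q = F (0, q.2.1, q.2.2) + q.1 * Q q := by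
  obtain ⟨Q, hQ, h⟩ := exists_hadamard_quotient (ContinuousLinearMap.fst ℝ ℝ (ℝ × ℝ)) (1, 0, 0) hF
  refine ⟨Q, hQ, h.mono fun q hq => ?_⟩
  have : q - (ContinuousLinearMap.fst ℝ ℝ (ℝ × ℝ)) q • ((1, 0, 0) : ℝ × ℝ × ℝ)
      = (0, q.2.1, q.2.2) := by ext <;> simp
  rwa [this] at hq

theorem exists_space_quotient {n : ℕ} {F : ℝ × ℝ × ℝ → ℝ}
    (hF : ContDiffAt ℝ ((n + 1 : ℕ) : WithTop ℕ∞) F 0) :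
    ∃ Q : ℝ × ℝ × ℝ → ℝ, ContDiffAt ℝ n Q 0 ∧
      ∀ᶠ q in 𝓝 (0 : ℝ × ℝ × ℝ), F q = F (q.1, 0, q.2.2) + q.2.1 * Q q := by
  obtain ⟨Q, hQ, h⟩ := exists_hadamard_quotient
    ((ContinuousLinearMap.fst ℝ ℝ ℝ).comp (ContinuousLinearMap.snd ℝ ℝ (ℝ × ℝ))) (0, 1, 0) hF
  refine ⟨Q, hQ, h.mono fun q hq => ?_⟩
  have : q - ((ContinuousLinearMap.fst ℝ ℝ ℝ).comp (ContinuousLinearMap.snd ℝ ℝ (ℝ × ℝ))) q •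
      ((0, 1, 0) : ℝ × ℝ × ℝ) = (q.1, 0, q.2.2) := by ext <;> simp
  rwa [this] at hq

theorem tendsto_drop_step :
    Tendsto (fun q : ℝ × ℝ × ℝ => ((0, q.2.1, q.2.2) : ℝ × ℝ × ℝ)) (𝓝 0) (𝓝 0) := by
  have : Continuous fun q : ℝ × ℝ × ℝ => ((0, q.2.1, q.2.2) : ℝ × ℝ × ℝ) := by fun_prop
  exact this.tendsto 0

theorem tendsto_drop_space :
    Tendsto (fun q : ℝ × ℝ × ℝ => ((q.1, 0, q.2.2) : ℝ × ℝ × ℝ)) (𝓝 0) (𝓝 0) := by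
  have : Continuous fun q : ℝ × ℝ × ℝ => ((q.1, 0, q.2.2) : ℝ × ℝ × ℝ) := by fun_prop
  exact this.tendsto 0

/-- A smooth germ which is `O(h^p)` for `h > 0` is `h^p` times a smooth germ. -/
theorem exists_pow_quotient {n : ℕ} {C : ℝ} (p : ℕ) : ∀ {G : ℝ × ℝ × ℝ → ℝ},
    ContDiffAt ℝ ((n + p : ℕ) : WithTop ℕ∞) G 0 →
    (∀ᶠ q in 𝓝 (0 : ℝ × ℝ × ℝ), 0 < q.1 → |G q| ≤ C * q.1 ^ p) →
    ∃ R : ℝ × ℝ × ℝ → ℝ, ContDiffAt ℝ n R 0 ∧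
      ∀ᶠ q in 𝓝 (0 : ℝ × ℝ × ℝ), 0 ≤ q.1 → G q = q.1 ^ p * R q := by
  induction p with
  | zero => exact fun {G} hG _ => ⟨G, hG, by simp⟩
  | succ p ih =>
    intro G hG hb
    have hpow : ContDiffAt ℝ ((n + (p + 1) : ℕ) : WithTop ℕ∞)
        (fun q : ℝ × ℝ × ℝ => C * q.1 ^ (p + 1)) 0 := by fun_prop
    have h1 := eventually_le_of_pos hG hpow
      (hb.mono fun q hq h0 _ => (le_abs_self _).trans (hq h0))
    have h2 := eventually_le_of_pos hG.neg hpow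
      (hb.mono fun q hq h0 _ => (neg_le_abs _).trans (hq h0))
    -- the bound at `h = 0`
    have h0 : ∀ᶠ q in 𝓝 (0 : ℝ × ℝ × ℝ), G (0, q.2.1, q.2.2) = 0 := by
      filter_upwards [tendsto_drop_step.eventually h1, tendsto_drop_step.eventually h2]
        with q h3 h4
      have h3 := h3 le_rfl
      have h4 := h4 le_rfl
      simp only [ne_eq, Nat.add_eq_zero_iff, one_ne_zero, and_false, not_false_eq_true, zero_pow,
        mul_zero] at h3 h4
      linarith
    obtain ⟨Q, hQ, hGQ⟩ := exists_step_quotient (n := n + p) hG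
    obtain ⟨R, hR, hQR⟩ := ih hQ (by
      filter_upwards [hb, hGQ, h0] with q h3 h4 h5 hq
      have h6 := h3 hq
      rw [h4, h5, zero_add, abs_mul, abs_of_pos hq, pow_succ] at h6
      refine le_of_mul_le_mul_left ?_ hq
      linarith)
    refine ⟨R, hR, ?_⟩
    filter_upwards [hQR, hGQ, h0] with q h3 h4 h5 hq
    rw [h4, h5, h3 hq]
    ring

/-- Taking quotients by `x` preserves closeness of order `h^p`. -/
theorem exists_close_quotients {n k p : ℕ} {u v R : ℝ × ℝ × ℝ → ℝ}
    (hu : ContDiffAt ℝ ((n + 1 : ℕ) : WithTop ℕ∞) u 0)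
    (hv : ContDiffAt ℝ ((n + 1 : ℕ) : WithTop ℕ∞) v 0)
    (hR : ContDiffAt ℝ ((k + 1 : ℕ) : WithTop ℕ∞) R 0)
    (h : ∀ᶠ q in 𝓝 (0 : ℝ × ℝ × ℝ), 0 ≤ q.1 → u q - v q = q.1 ^ p * R q) :
    ∃ U V T : ℝ × ℝ × ℝ → ℝ, ContDiffAt ℝ n U 0 ∧ ContDiffAt ℝ n V 0 ∧ ContDiffAt ℝ k T 0 ∧
      (∀ᶠ q in 𝓝 (0 : ℝ × ℝ × ℝ), u q = u (q.1, 0, q.2.2) + q.2.1 * U q) ∧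
      (∀ᶠ q in 𝓝 (0 : ℝ × ℝ × ℝ), v q = v (q.1, 0, q.2.2) + q.2.1 * V q) ∧
      ∀ᶠ q in 𝓝 (0 : ℝ × ℝ × ℝ), 0 ≤ q.1 → U q - V q = q.1 ^ p * T q := by
  obtain ⟨U, hU, hU'⟩ := exists_space_quotient hu
  obtain ⟨V, hV, hV'⟩ := exists_space_quotient hv
  obtain ⟨T, hT, hT'⟩ := exists_space_quotient hR
  refine ⟨U, V, T, hU, hV, hT, hU', hV', ?_⟩
  refine eventually_eq_of_pos (n := 0) ((hU.of_le (by simp)).sub (hV.of_le (by simp)))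
    (ContDiffAt.mul (by fun_prop) (hT.of_le (by simp))) ?_
  filter_upwards [hU', hV', hT', h, tendsto_drop_space.eventually h] with q h1 h2 h3 h4 h5 hq hx
  have h4 := h4 hq.le
  have h5 : u (q.1, 0, q.2.2) - v (q.1, 0, q.2.2) = q.1 ^ p * R (q.1, 0, q.2.2) := h5 hq.le
  rw [h1, h2, h3] at h4
  refine mul_left_cancel₀ hx ?_
  linear_combination h4 - h5

/-- The map `Φ` expands at the equilibrium as `Φ = x + h x (A₀ + A₁ x + A₂ x²)`, for `h ≥ 0`, with
coefficients of class `C^m` that satisfy the transcritical conditions. -/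
structure HasExpansion (m : ℕ) (Φ : ℝ → ℝ → ℝ → ℝ) (A₀ A₁ : ℝ × ℝ → ℝ) (A₂ : ℝ × ℝ × ℝ → ℝ) :
    Prop where
  smooth₀ : ContDiffAt ℝ m A₀ 0
  smooth₁ : ContDiffAt ℝ m A₁ 0
  smooth₂ : ContDiffAt ℝ m A₂ 0
  eq : ∀ᶠ q in 𝓝 (0 : ℝ × ℝ × ℝ), 0 ≤ q.1 → Φ q.1 q.2.1 q.2.2 =
    q.2.1 + q.1 * (q.2.1 * (A₀ (q.1, q.2.2) + q.2.1 * A₁ (q.1, q.2.2) + q.2.1 ^ 2 * A₂ q))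
  zero : A₀ 0 = 0
  ne_zero : A₁ 0 ≠ 0
  deriv_ne_zero : deriv (fun α => A₀ (0, α)) 0 ≠ 0

theorem hasDerivAt_id_mul {W : ℝ → ℝ} (hW : ContinuousAt W 0) :
    HasDerivAt (fun x => x * W x) (W 0) 0 := by
  rw [hasDerivAt_iff_tendsto_slope]
  refine (hW.tendsto.mono_left nhdsWithin_le_nhds).congr' ?_
  filter_upwards [self_mem_nhdsWithin] with x hx
  have hx' : x ≠ 0 := hx
  rw [slope_def_field]
  field_simp
  ring

/-- The derivatives of a vector field `x A(x, α)` that enter the transcritical conditions. -/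
theorem transcritical_coefficients {f : ℝ → ℝ → ℝ} {A P : ℝ × ℝ × ℝ → ℝ}
    (hf : TranscriticalConditions f) {n : ℕ} (hn : n ≠ 0) (hA : ContDiffAt ℝ n A 0)
    (hP : ContDiffAt ℝ n P 0)
    (hfA : ∀ᶠ q in 𝓝 (0 : ℝ × ℝ × ℝ), q.1 = 0 → f q.2.1 q.2.2 = q.2.1 * A q)
    (hAP : ∀ᶠ q in 𝓝 (0 : ℝ × ℝ × ℝ), A q = A (q.1, 0, q.2.2) + q.2.1 * P q) :
    A 0 = 0 ∧ P 0 ≠ 0 ∧ deriv (fun α => A (0, 0, α)) 0 ≠ 0 := by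
  have hmapα : Tendsto (fun α : ℝ => ((0, 0, α) : ℝ × ℝ × ℝ)) (𝓝 0) (𝓝 0) := by
    have : Continuous fun α : ℝ => ((0, 0, α) : ℝ × ℝ × ℝ) := by fun_prop
    exact this.tendsto 0
  have hmapx : Tendsto (fun x : ℝ => ((0, x, 0) : ℝ × ℝ × ℝ)) (𝓝 0) (𝓝 0) := by
    have : Continuous fun x : ℝ => ((0, x, 0) : ℝ × ℝ × ℝ) := by fun_prop
    exact this.tendsto 0
  have hx : ∀ᶠ α in 𝓝 (0 : ℝ), deriv (fun x => f x α) 0 = A (0, 0, α) := by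
    filter_upwards [hmapα.eventually (eventually_eventually_nhds.2 hfA),
      hmapα.eventually (hA.eventually (by simp))] with α h1 h2
    have hm : ContinuousAt (fun x : ℝ => ((0, x, α) : ℝ × ℝ × ℝ)) 0 := by fun_prop
    have h3 := hasDerivAt_id_mul (W := fun x => A (0, x, α))
      (ContinuousAt.comp (f := fun x : ℝ => ((0, x, α) : ℝ × ℝ × ℝ)) h2.continuousAt hm)
    refine (h3.congr_of_eventuallyEq ?_).deriv
    exact (hm.tendsto.eventually h1).mono fun x hx => hx rfl
  have hA0 : A 0 = 0 := by
    rw [← hf.deriv_x]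
    exact hx.self_of_nhds.symm
  refine ⟨hA0, fun hP0 => ?_, ?_⟩
  · refine hf.deriv_xx ?_
    have hP1 : ContDiffAt ℝ 1 P 0 := hP.of_le (by exact_mod_cast Nat.one_le_iff_ne_zero.2 hn)
    have hPx : ContDiffAt ℝ 1 (fun x : ℝ => P (0, x, 0)) 0 :=
      ContDiffAt.comp (0 : ℝ) (f := fun x : ℝ => ((0, x, 0) : ℝ × ℝ × ℝ)) hP1 (by fun_prop)
    have hsq : ∀ᶠ x in 𝓝 (0 : ℝ), f x 0 = x * (x * P (0, x, 0)) := by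
      filter_upwards [hmapx.eventually hfA, hmapx.eventually hAP] with x h1 h2
      have h2 : A (0, x, 0) = A (0, 0, 0) + x * P (0, x, 0) := h2
      have h3 : A (0, 0, 0) = 0 := hA0
      rw [h1 rfl, h2, h3, zero_add]
    have hd : ∀ᶠ x in 𝓝 (0 : ℝ), deriv (fun x => f x 0) x
        = x * (2 * P (0, x, 0) + x * deriv (fun x => P (0, x, 0)) x) := by
      filter_upwards [eventually_eventually_nhds.2 hsq, hPx.eventually (by simp)] with x h1 h2
      have h3 := (h2.differentiableAt one_ne_zero).hasDerivAt
      have h4 := (hasDerivAt_id x).mul ((hasDerivAt_id x).mul h3)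
      have h5 : (fun x => f x 0) =ᶠ[𝓝 x] (id * (id * fun x => P (0, x, 0))) := h1
      rw [h5.deriv_eq, h4.deriv]
      simp only [id_eq, one_mul, Pi.mul_apply]
      ring
    have hd' : (deriv fun x => f x 0) =ᶠ[𝓝 0] fun x =>
      x * (2 * P (0, x, 0) + x * deriv (fun x => P (0, x, 0)) x) := hd
    have hcd : ContinuousAt (deriv fun x => P (0, x, 0)) 0 :=
      (hPx.continuousAt_fderiv one_ne_zero).clm_apply continuousAt_const
    have hW := hasDerivAt_id_mul
      (W := fun x => 2 * P (0, x, 0) + x * deriv (fun x => P (0, x, 0)) x)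
      ((continuousAt_const.mul hPx.continuousAt).add (continuousAt_id.mul hcd))
    rw [hd'.deriv_eq, hW.deriv, zero_mul, add_zero]
    have : P (0, 0, 0) = 0 := hP0
    rw [this, mul_zero]
  · have hx' : (fun α => deriv (fun x => f x α) 0) =ᶠ[𝓝 0] fun α => A (0, 0, α) := hx
    rw [← hx'.deriv_eq]
    exact hf.deriv_xα

theorem eventually_of_box {h₁ ε₁ α₁ : ℝ} (hh : 0 < h₁) (hε : 0 < ε₁) (hα : 0 < α₁)
    {P : ℝ → ℝ → ℝ → Prop}
    (H : ∀ h ∈ Icc (0 : ℝ) h₁, ∀ x ∈ Icc (-ε₁) ε₁, ∀ α ∈ Icc (-α₁) α₁, P h x α) :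
    ∀ᶠ q in 𝓝 (0 : ℝ × ℝ × ℝ), 0 ≤ q.1 → P q.1 q.2.1 q.2.2 := by
  have h1 : ∀ᶠ h in 𝓝 (0 : ℝ), h ≤ h₁ := (gt_mem_nhds hh).mono fun _ h => le_of_lt h
  have h2 : ∀ᶠ x in 𝓝 (0 : ℝ), x ∈ Icc (-ε₁) ε₁ := Icc_mem_nhds (by linarith) hε
  have h3 : ∀ᶠ α in 𝓝 (0 : ℝ), α ∈ Icc (-α₁) α₁ := Icc_mem_nhds (by linarith) hα
  have h4 : ∀ᶠ q in 𝓝 (0 : ℝ) ×ˢ (𝓝 (0 : ℝ) ×ˢ 𝓝 (0 : ℝ)), q.1 ≤ h₁ ∧ q.2.1 ∈ Icc (-ε₁) ε₁ ∧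
      q.2.2 ∈ Icc (-α₁) α₁ := h1.prod_mk (h2.prod_mk h3)
  rw [← nhds_prod_eq, ← nhds_prod_eq] at h4
  exact h4.mono fun q hq h0 => H _ ⟨h0, hq.1⟩ _ hq.2.1 _ hq.2.2

/-- The coefficient of a map fixing the equilibrium vanishes there, also at step-size `0`. -/
theorem increment_at_equilibrium {n : ℕ} {Φ : ℝ → ℝ → ℝ → ℝ} {g : ℝ × ℝ × ℝ → ℝ}
    (hg : ContDiffAt ℝ n g 0)
    (hΦg : ∀ᶠ q in 𝓝 (0 : ℝ × ℝ × ℝ), 0 ≤ q.1 → Φ q.1 q.2.1 q.2.2 = q.2.1 + q.1 * g q)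
    (hΦ : ∀ᶠ q in 𝓝 (0 : ℝ × ℝ × ℝ), 0 ≤ q.1 → Φ q.1 0 q.2.2 = 0) :
    ∀ᶠ q in 𝓝 (0 : ℝ × ℝ × ℝ), 0 ≤ q.1 → g (q.1, 0, q.2.2) = 0 := by
  refine eventually_eq_of_pos (n := n) (ContDiffAt.comp (0 : ℝ × ℝ × ℝ)
    (f := fun q : ℝ × ℝ × ℝ => ((q.1, 0, q.2.2) : ℝ × ℝ × ℝ)) hg (by fun_prop))
    contDiffAt_const ?_
  filter_upwards [tendsto_drop_space.eventually hΦg, hΦ] with q h1 h2 hq _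
  have h3 : Φ q.1 0 q.2.2 = 0 + q.1 * g (q.1, 0, q.2.2) := h1 hq.le
  have h4 := h2 hq.le
  rw [h4, zero_add] at h3
  exact (mul_eq_zero.1 h3.symm).resolve_left hq.ne'

theorem HasExpansion.of_quotients {n : ℕ} {Φ : ℝ → ℝ → ℝ → ℝ} {g A P A₂ : ℝ × ℝ × ℝ → ℝ}
    (hA : ContDiffAt ℝ n A 0) (hP : ContDiffAt ℝ n P 0) (hA₂ : ContDiffAt ℝ n A₂ 0)
    (hΦg : ∀ᶠ q in 𝓝 (0 : ℝ × ℝ × ℝ), 0 ≤ q.1 → Φ q.1 q.2.1 q.2.2 = q.2.1 + q.1 * g q)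
    (hg0 : ∀ᶠ q in 𝓝 (0 : ℝ × ℝ × ℝ), 0 ≤ q.1 → g (q.1, 0, q.2.2) = 0)
    (hgA : ∀ᶠ q in 𝓝 (0 : ℝ × ℝ × ℝ), g q = g (q.1, 0, q.2.2) + q.2.1 * A q)
    (hAP : ∀ᶠ q in 𝓝 (0 : ℝ × ℝ × ℝ), A q = A (q.1, 0, q.2.2) + q.2.1 * P q)
    (hPA₂ : ∀ᶠ q in 𝓝 (0 : ℝ × ℝ × ℝ), P q = P (q.1, 0, q.2.2) + q.2.1 * A₂ q)
    (h0 : A 0 = 0) (h1 : P 0 ≠ 0) (h2 : deriv (fun α => A (0, 0, α)) 0 ≠ 0) :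
    HasExpansion n Φ (fun q => A (q.1, 0, q.2)) (fun q => P (q.1, 0, q.2)) A₂ where
  smooth₀ := ContDiffAt.comp (0 : ℝ × ℝ) (f := fun q : ℝ × ℝ => ((q.1, 0, q.2) : ℝ × ℝ × ℝ)) hA
    (by fun_prop)
  smooth₁ := ContDiffAt.comp (0 : ℝ × ℝ) (f := fun q : ℝ × ℝ => ((q.1, 0, q.2) : ℝ × ℝ × ℝ)) hP
    (by fun_prop)
  smooth₂ := hA₂
  eq := by
    filter_upwards [hΦg, hg0, hgA, hAP, hPA₂] with q e1 e2 e3 e4 e5 hq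
    rw [e1 hq, e3, e2 hq, e4, e5]
    ring
  zero := h0
  ne_zero := h1
  deriv_ne_zero := h2

/-- Closeness of order `h^p`, as `(h, x, α) → 0` with `h ≥ 0`, of the coefficients of two
expansions. -/
structure AreClose (p : ℕ) (A₀ A₁ : ℝ × ℝ → ℝ) (A₂ : ℝ × ℝ × ℝ → ℝ) (B₀ B₁ : ℝ × ℝ → ℝ)
    (B₂ : ℝ × ℝ × ℝ → ℝ) : Prop where
  close₀ : (fun q => A₀ q - B₀ q) =O[𝓝[{q | 0 ≤ q.1}] 0] fun q => q.1 ^ p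
  close₁ : (fun q => A₁ q - B₁ q) =O[𝓝[{q | 0 ≤ q.1}] 0] fun q => q.1 ^ p
  close₂ : (fun q => A₂ q - B₂ q) =O[𝓝[{q | 0 ≤ q.1}] 0] fun q => q.1 ^ p

theorem isBigO_of_eq_pow_mul {E : Type*} [NormedAddCommGroup E] [NormedSpace ℝ E] {n p : ℕ}
    {u R : ℝ × E → ℝ} (hR : ContDiffAt ℝ n R 0)
    (h : ∀ᶠ q in 𝓝 (0 : ℝ × E), 0 ≤ q.1 → u q = q.1 ^ p * R q) :
    u =O[𝓝[{q | 0 ≤ q.1}] 0] fun q => q.1 ^ p := by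
  have h1 : (fun q : ℝ × E => q.1 ^ p * R q) =O[𝓝[{q | 0 ≤ q.1}] 0] fun q => q.1 ^ p * 1 :=
    (Asymptotics.isBigO_refl _ _).mul
      ((hR.continuousAt.tendsto.mono_left nhdsWithin_le_nhds).isBigO_one ℝ)
  simp only [mul_one] at h1
  refine h1.congr' ?_ EventuallyEq.rfl
  filter_upwards [nhdsWithin_le_nhds h, self_mem_nhdsWithin] with q h2 h3
  exact (h2 h3).symm

theorem tendsto_planeEmbedding :
    Tendsto (fun q : ℝ × ℝ => ((q.1, 0, q.2) : ℝ × ℝ × ℝ)) (𝓝 0) (𝓝 0) := by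
  have : Continuous fun q : ℝ × ℝ => ((q.1, 0, q.2) : ℝ × ℝ × ℝ) := by fun_prop
  exact this.tendsto 0

theorem isBigO_plane {p n : ℕ} {u v R : ℝ × ℝ × ℝ → ℝ} (hR : ContDiffAt ℝ n R 0)
    (h : ∀ᶠ q in 𝓝 (0 : ℝ × ℝ × ℝ), 0 ≤ q.1 → u q - v q = q.1 ^ p * R q) :
    (fun q : ℝ × ℝ => u (q.1, 0, q.2) - v (q.1, 0, q.2)) =O[𝓝[{q | 0 ≤ q.1}] 0]
      fun q => q.1 ^ p :=
  isBigO_of_eq_pow_mul (ContDiffAt.comp (0 : ℝ × ℝ)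
    (f := fun q : ℝ × ℝ => ((q.1, 0, q.2) : ℝ × ℝ × ℝ)) hR (by fun_prop))
    (tendsto_planeEmbedding.eventually h)

theorem timeMap_equilibrium {f : ℝ → ℝ → ℝ} {h x α : ℝ} (hh : 0 ≤ h)
    (hf : ContDiff ℝ 1 (fun q : ℝ × ℝ => f q.1 q.2)) (h0 : f x α = 0) :
    timeMap f h x α = x := by
  refine timeMap_eq_of_isSolutionOn (u := fun _ => x) hh hf ⟨rfl, fun t _ => ?_⟩
  simpa [h0] using hasDerivWithinAt_const t (Icc 0 h) x

/-- Expansions of the time-`h` map and of the method, with close coefficients. -/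
theorem TCHypotheses.exists_expansions {p : ℕ} (hp : 1 ≤ p) {f : ℝ → ℝ → ℝ}
    {φ : ℝ → ℝ → ℝ → ℝ} (H : TCHypotheses p (p + 7) f φ) :
    ∃ (A₀ A₁ : ℝ × ℝ → ℝ) (A₂ : ℝ × ℝ × ℝ → ℝ) (B₀ B₁ : ℝ × ℝ → ℝ) (B₂ : ℝ × ℝ × ℝ → ℝ),
      HasExpansion (p + 3) (timeMap f) A₀ A₁ A₂ ∧ HasExpansion (p + 3) φ B₀ B₁ B₂ ∧
      AreClose p A₀ A₁ A₂ B₀ B₁ B₂ := by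
  have hf1 : ContDiff ℝ 1 (fun q : ℝ × ℝ => f q.1 q.2) :=
    H.smooth_f.of_le (by exact_mod_cast Nat.le_add_left 1 (p + 5))
  obtain ⟨g, hg, hΦg, hgf⟩ := exists_timeMap_increment (by lia) H.smooth_f
  obtain ⟨C, hC⟩ : ∃ C : ℝ, ∀ᶠ q in 𝓝 (0 : ℝ × ℝ × ℝ), 0 ≤ q.1 →
      |timeMap f q.1 q.2.1 q.2.2 - φ q.1 q.2.1 q.2.2| ≤ C * q.1 ^ (p + 1) := by
    obtain ⟨h₁, hh, ε₁, hε, α₁, hα, C, -, hC⟩ := H.order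
    exact ⟨C, eventually_of_box hh hε hα
      (P := fun h x α => |timeMap f h x α - φ h x α| ≤ C * h ^ (p + 1)) hC⟩
  have hφ0 : ∀ᶠ q in 𝓝 (0 : ℝ × ℝ × ℝ), 0 ≤ q.1 → φ q.1 0 q.2.2 = 0 := by
    obtain ⟨h₁, hh, α₁, hα, h0⟩ := H.equilibrium
    exact eventually_of_box hh one_pos hα (P := fun h _ α => φ h 0 α = 0)
      fun h hh x _ α hα => h0 h hh α hα
  have hf0 : ∀ᶠ q in 𝓝 (0 : ℝ × ℝ × ℝ), 0 ≤ q.1 → f 0 q.2.2 = 0 := by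
    obtain ⟨α₁, hα, h0⟩ := H.transcritical.equilibrium
    exact eventually_of_box one_pos one_pos hα (P := fun _ _ α => f 0 α = 0)
      fun h _ x _ α hα => h0 α hα
  have hΦ0 : ∀ᶠ q in 𝓝 (0 : ℝ × ℝ × ℝ), 0 ≤ q.1 → timeMap f q.1 0 q.2.2 = 0 :=
    hf0.mono fun q hq h0 => timeMap_equilibrium h0 hf1 (hq h0)
  obtain ⟨g', hg', hφg⟩ : ∃ g' : ℝ × ℝ × ℝ → ℝ, ContDiffAt ℝ (p + 6 : ℕ) g' 0 ∧
      ∀ᶠ q in 𝓝 (0 : ℝ × ℝ × ℝ), 0 ≤ q.1 → φ q.1 q.2.1 q.2.2 = q.2.1 + q.1 * g' q := by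
    obtain ⟨ψ, hψ, h₁, hh, ε₁, hε, α₁, hα, hφψ⟩ := H.smooth_φ
    have hφψ := eventually_of_box hh hε hα (P := fun h x α => φ h x α = ψ (h, x, α)) hφψ
    obtain ⟨g', hg', hψg⟩ := exists_step_quotient (n := p + 6) hψ
    refine ⟨g', hg', ?_⟩
    filter_upwards [hψg, hφψ, tendsto_drop_step.eventually hφψ, tendsto_drop_step.eventually hC]
      with q e1 e2 e3 e4 hq
    have e4 := e4 le_rfl
    rw [zero_pow (Nat.succ_ne_zero p), mul_zero, timeMap_zero hf1] at e4
    have e5 : q.2.1 = φ 0 q.2.1 q.2.2 := sub_eq_zero.1 (abs_nonpos_iff.1 e4)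
    have e3 : φ 0 q.2.1 q.2.2 = ψ (0, q.2.1, q.2.2) := e3 le_rfl
    rw [e2 hq]
    change ψ q = _
    rw [e1, ← e3, ← e5]
  have hclose : ∀ᶠ q in 𝓝 (0 : ℝ × ℝ × ℝ), 0 < q.1 → |g q - g' q| ≤ C * q.1 ^ p := by
    filter_upwards [hC, hΦg, hφg] with q e1 e2 e3 hq
    have e4 := e1 hq.le
    rw [e2 hq.le, e3 hq.le, show q.2.1 + q.1 * g q - (q.2.1 + q.1 * g' q) = q.1 * (g q - g' q) by
      ring, abs_mul, abs_of_pos hq, pow_succ] at e4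
    refine le_of_mul_le_mul_left ?_ hq
    linarith
  have hsub : ContDiffAt ℝ ((6 + p : ℕ) : WithTop ℕ∞) (fun q => g q - g' q) 0 := by
    rw [add_comm 6 p]
    exact hg.sub hg'
  obtain ⟨R, hR, hRe⟩ := exists_pow_quotient (n := 6) p hsub hclose
  obtain ⟨A, B, R₁, hA, hB, hR₁, hgA, hgB, hR₁e⟩ :=
    exists_close_quotients (n := p + 5) (k := 5) hg hg' hR hRe
  obtain ⟨P, Q, R₂, hP, hQ, hR₂, hAP, hBQ, hR₂e⟩ :=
    exists_close_quotients (n := p + 4) (k := 4) hA hB hR₁ hR₁e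
  obtain ⟨A₂, B₂, R₃, hA₂, hB₂, hR₃, hPA₂, hQB₂, hR₃e⟩ :=
    exists_close_quotients (n := p + 3) (k := 3) hP hQ hR₂ hR₂e
  have hA' : ContDiffAt ℝ (p + 3 : ℕ) A 0 := hA.of_le (by exact_mod_cast (by lia : p + 3 ≤ p + 5))
  have hB' : ContDiffAt ℝ (p + 3 : ℕ) B 0 := hB.of_le (by exact_mod_cast (by lia : p + 3 ≤ p + 5))
  have hP' : ContDiffAt ℝ (p + 3 : ℕ) P 0 := hP.of_le (by exact_mod_cast (by lia : p + 3 ≤ p + 4))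
  have hQ' : ContDiffAt ℝ (p + 3 : ℕ) Q 0 := hQ.of_le (by exact_mod_cast (by lia : p + 3 ≤ p + 4))
  have hg0 := increment_at_equilibrium hg hΦg hΦ0
  have hg0' := increment_at_equilibrium hg' hφg hφ0
  have hp0 : p ≠ 0 := by lia
  -- at step-size `0` the increments of both maps are the vector field
  have hfA : ∀ᶠ q in 𝓝 (0 : ℝ × ℝ × ℝ), q.1 = 0 → f q.2.1 q.2.2 = q.2.1 * A q := by
    filter_upwards [hgf, hgA, hg0] with q e1 e2 e3 hq
    rw [← e1 hq, e2, e3 hq.ge, zero_add]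
  have hfB : ∀ᶠ q in 𝓝 (0 : ℝ × ℝ × ℝ), q.1 = 0 → f q.2.1 q.2.2 = q.2.1 * B q := by
    filter_upwards [hfA, hR₁e] with q e1 e2 hq
    have e3 := e2 hq.ge
    rw [hq, zero_pow hp0, zero_mul, sub_eq_zero] at e3
    rw [e1 hq, e3]
  obtain ⟨a0, a1, a2⟩ := transcritical_coefficients H.transcritical (by lia) hA' hP' hfA hAP
  obtain ⟨b0, b1, b2⟩ := transcritical_coefficients H.transcritical (by lia) hB' hQ' hfB hBQ
  exact ⟨_, _, A₂, _, _, B₂, .of_quotients hA' hP' hA₂ hΦg hg0 hgA hAP hPA₂ a0 a1 a2,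
    .of_quotients hB' hQ' hB₂ hφg hg0' hgB hBQ hQB₂ b0 b1 b2,
    isBigO_plane hR₁ hR₁e, isBigO_plane hR₂ hR₂e, isBigO_of_eq_pow_mul hR₃ hR₃e⟩

/-! ### Closeness of the normal form tails -/

section

variable {X E : Type*} [NormedAddCommGroup E] [NormedSpace ℝ E] {l : Filter X} {k : X → ℝ}

theorem ContDiffAt.isBigO_comp_sub {F : E → ℝ} {x₀ : E} {n : WithTop ℕ∞} (hF : ContDiffAt ℝ n F x₀)
    (hn : n ≠ 0) {u v : X → E} (hu : Tendsto u l (𝓝 x₀)) (hv : Tendsto v l (𝓝 x₀))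
    (huv : (fun x => u x - v x) =O[l] k) : (fun x => F (u x) - F (v x)) =O[l] k :=
  ((hF.hasStrictFDerivAt hn).isBigO_sub.comp_tendsto (hu.prodMk_nhds hv)).trans huv

theorem isBigO_mul_sub_mul {u u' v v' : X → ℝ} {a b : ℝ} (hu : Tendsto u l (𝓝 a))
    (hv : Tendsto v' l (𝓝 b)) (huu : (fun x => u x - u' x) =O[l] k)
    (hvv : (fun x => v x - v' x) =O[l] k) : (fun x => u x * v x - u' x * v' x) =O[l] k := by
  have h1 : (fun x => u x * (v x - v' x)) =O[l] fun x => 1 * k x := (hu.isBigO_one ℝ).mul hvv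
  have h2 : (fun x => (u x - u' x) * v' x) =O[l] fun x => k x * 1 := huu.mul (hv.isBigO_one ℝ)
  simp only [one_mul, mul_one] at h1 h2
  exact (h1.add h2).congr_left fun x => by ring

end

/-- `a` is a smooth local inverse, with the step-size as a parameter, of the parameter change
`β = A₀(h, α)`. -/
structure IsParamInverse (m : ℕ) (A₀ a : ℝ × ℝ → ℝ) : Prop where
  smooth : ContDiffAt ℝ m a 0
  zero : a 0 = 0
  right_inv : ∀ᶠ q in 𝓝 (0 : ℝ × ℝ), A₀ (q.1, a q) = q.2
  left_inv : ∀ᶠ q in 𝓝 (0 : ℝ × ℝ), a (q.1, A₀ q) = q.2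

theorem fderiv_apply_param {A₀ : ℝ × ℝ → ℝ} {n : WithTop ℕ∞} (hA : ContDiffAt ℝ n A₀ 0)
    (hn : n ≠ 0) : fderiv ℝ A₀ 0 (0, 1) = deriv (fun α => A₀ (0, α)) 0 := by
  have h1 : HasDerivAt (fun α : ℝ => ((0, α) : ℝ × ℝ)) (0, 1) 0 :=
    (hasDerivAt_const _ _).prodMk (hasDerivAt_id _)
  exact (HasFDerivAt.comp_hasDerivAt (f := fun α : ℝ => ((0, α) : ℝ × ℝ)) (0 : ℝ)
    (hA.differentiableAt hn).hasFDerivAt h1).deriv.symm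

theorem exists_paramInverse {m : ℕ} (hm : m ≠ 0) {A₀ : ℝ × ℝ → ℝ} (hA : ContDiffAt ℝ m A₀ 0)
    (h0 : A₀ 0 = 0) (hd : deriv (fun α => A₀ (0, α)) 0 ≠ 0) : ∃ a, IsParamInverse m A₀ a := by
  have hm' : (m : WithTop ℕ∞) ≠ 0 := by exact_mod_cast hm
  let F : (ℝ × ℝ) × ℝ → ℝ := fun w => A₀ (w.1.1, w.2) - w.1.2
  have hF : ContDiffAt ℝ m F 0 := by
    have : ContDiffAt ℝ m (fun w : (ℝ × ℝ) × ℝ => A₀ (w.1.1, w.2)) 0 :=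
      ContDiffAt.comp (0 : (ℝ × ℝ) × ℝ) (f := fun w : (ℝ × ℝ) × ℝ => ((w.1.1, w.2) : ℝ × ℝ)) hA
        (by fun_prop)
    exact this.sub (by fun_prop)
  have hF0 : F 0 = 0 := by
    have : A₀ (0, 0) = 0 := h0
    simp [F, this]
  have hinv : (fderiv ℝ F 0 ∘L .inr ℝ (ℝ × ℝ) ℝ).IsInvertible := by
    have h1 : HasFDerivAt F (fderiv ℝ F 0) (ContinuousLinearMap.inr ℝ (ℝ × ℝ) ℝ 0) := by
      rw [map_zero]
      exact (hF.differentiableAt hm').hasFDerivAt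
    have h2 := (h1.comp 0 (ContinuousLinearMap.inr ℝ (ℝ × ℝ) ℝ).hasFDerivAt).hasDerivAt.deriv
    have h3 : F ∘ (ContinuousLinearMap.inr ℝ (ℝ × ℝ) ℝ) = fun α => A₀ (0, α) := by
      funext u; simp [F]
    rw [h3] at h2
    rw [h2] at hd
    refine ⟨ContinuousLinearEquiv.unitsEquivAut ℝ (Units.mk0 _ hd), ?_⟩
    ext
    simp
  refine ⟨hF.implicitFunction hm' hinv, hF.contDiffAt_implicitFunction hm' hinv,
    hF.implicitFunction_apply_self hm' hinv, ?_, ?_⟩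
  · have := hF.eventually_apply_implicitFunction hm' hinv
    rw [hF0] at this
    exact this.mono fun q hq => sub_eq_zero.1 hq
  · have h1 := hF.eventually_apply_eq_iff_implicitFunction hm' hinv
    rw [hF0] at h1
    have hlim : Tendsto (fun q : ℝ × ℝ => (((q.1, A₀ q), q.2) : (ℝ × ℝ) × ℝ)) (𝓝 0) (𝓝 0) := by
      have : ContinuousAt (fun q : ℝ × ℝ => (((q.1, A₀ q), q.2) : (ℝ × ℝ) × ℝ)) 0 :=
        (continuousAt_fst.prodMk hA.continuousAt).prodMk continuousAt_snd
      have h2 := this.tendsto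
      rw [h0] at h2
      exact h2
    exact (hlim.eventually h1).mono fun q hq => hq.1 (by simp [F])

/-- The tail of the normal form, in terms of the expansion coefficients. -/
def nfTail (A₁ : ℝ × ℝ → ℝ) (A₂ : ℝ × ℝ × ℝ → ℝ) (a : ℝ × ℝ → ℝ) (q : ℝ × ℝ × ℝ) : ℝ :=
  A₂ (q.1, q.2.1 * (A₁ (q.1, a (q.1, q.2.2)))⁻¹, a (q.1, q.2.2)) *
    ((A₁ (q.1, a (q.1, q.2.2)))⁻¹ * (A₁ (q.1, a (q.1, q.2.2)))⁻¹)

theorem contDiffAt_paramPoint {m : ℕ} {a : ℝ × ℝ → ℝ} (ha : ContDiffAt ℝ m a 0) :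
    ContDiffAt ℝ m (fun q : ℝ × ℝ × ℝ => ((q.1, a (q.1, q.2.2)) : ℝ × ℝ)) 0 :=
  contDiffAt_fst.prodMk (ContDiffAt.comp (0 : ℝ × ℝ × ℝ)
    (f := fun q : ℝ × ℝ × ℝ => ((q.1, q.2.2) : ℝ × ℝ)) ha (by fun_prop))

section

variable {m p : ℕ} {Φ φ : ℝ → ℝ → ℝ → ℝ} {A₀ A₁ B₀ B₁ a b : ℝ × ℝ → ℝ} {A₂ B₂ : ℝ × ℝ × ℝ → ℝ}

theorem IsParamInverse.tendsto_paramPoint (ha : IsParamInverse m A₀ a) :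
    Tendsto (fun q : ℝ × ℝ × ℝ => ((q.1, a (q.1, q.2.2)) : ℝ × ℝ)) (𝓝 0) (𝓝 0) := by
  have := (contDiffAt_paramPoint ha.smooth).continuousAt.tendsto
  have h0 : ((0 : ℝ × ℝ × ℝ).1, a ((0 : ℝ × ℝ × ℝ).1, (0 : ℝ × ℝ × ℝ).2.2)) = (0 : ℝ × ℝ) :=
    Prod.ext rfl ha.zero
  rwa [h0] at this

theorem IsParamInverse.contDiffAt_inv (ha : IsParamInverse m A₀ a) (hA₁ : ContDiffAt ℝ m A₁ 0)
    (hne : A₁ 0 ≠ 0) :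
    ContDiffAt ℝ m (fun q : ℝ × ℝ × ℝ => (A₁ (q.1, a (q.1, q.2.2)))⁻¹) 0 := by
  have h0 : ((0 : ℝ × ℝ × ℝ).1, a ((0 : ℝ × ℝ × ℝ).1, (0 : ℝ × ℝ × ℝ).2.2)) = (0 : ℝ × ℝ) :=
    Prod.ext rfl ha.zero
  refine (ContDiffAt.comp (0 : ℝ × ℝ × ℝ)
    (f := fun q : ℝ × ℝ × ℝ => ((q.1, a (q.1, q.2.2)) : ℝ × ℝ)) (by rwa [h0])
    (contDiffAt_paramPoint ha.smooth)).inv ?_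
  simpa only [Function.comp, h0] using hne

theorem IsParamInverse.tailPoint_zero (ha : IsParamInverse m A₀ a) :
    ((0 : ℝ × ℝ × ℝ).1, (0 : ℝ × ℝ × ℝ).2.1 * (A₁ ((0 : ℝ × ℝ × ℝ).1,
      a ((0 : ℝ × ℝ × ℝ).1, (0 : ℝ × ℝ × ℝ).2.2)))⁻¹,
      a ((0 : ℝ × ℝ × ℝ).1, (0 : ℝ × ℝ × ℝ).2.2)) = (0 : ℝ × ℝ × ℝ) :=
  Prod.ext rfl (Prod.ext (zero_mul _) ha.zero)

/-- The argument of the coefficient `A₂` in the tail. -/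
theorem IsParamInverse.contDiffAt_tailPoint (ha : IsParamInverse m A₀ a)
    (hA₁ : ContDiffAt ℝ m A₁ 0) (hne : A₁ 0 ≠ 0) :
    ContDiffAt ℝ m (fun q : ℝ × ℝ × ℝ =>
      ((q.1, q.2.1 * (A₁ (q.1, a (q.1, q.2.2)))⁻¹, a (q.1, q.2.2)) : ℝ × ℝ × ℝ)) 0 := by
  have h1 : ContDiffAt ℝ m (fun q : ℝ × ℝ × ℝ => q.2.1) 0 := by fun_prop
  exact contDiffAt_fst.prodMk ((h1.mul (ha.contDiffAt_inv hA₁ hne)).prodMk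
    (contDiffAt_paramPoint ha.smooth).snd)

theorem IsParamInverse.tendsto_tailPoint (ha : IsParamInverse m A₀ a)
    (hA₁ : ContDiffAt ℝ m A₁ 0) (hne : A₁ 0 ≠ 0) :
    Tendsto (fun q : ℝ × ℝ × ℝ =>
      ((q.1, q.2.1 * (A₁ (q.1, a (q.1, q.2.2)))⁻¹, a (q.1, q.2.2)) : ℝ × ℝ × ℝ)) (𝓝 0) (𝓝 0) := by
  have := (ha.contDiffAt_tailPoint hA₁ hne).continuousAt.tendsto
  rwa [ha.tailPoint_zero] at this

theorem IsParamInverse.contDiffAt_nfTail (ha : IsParamInverse m A₀ a)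
    (hA₁ : ContDiffAt ℝ m A₁ 0) (hne : A₁ 0 ≠ 0) (hA₂ : ContDiffAt ℝ m A₂ 0) :
    ContDiffAt ℝ m (nfTail A₁ A₂ a) 0 := by
  refine ContDiffAt.mul (ContDiffAt.comp (0 : ℝ × ℝ × ℝ) (f := fun q : ℝ × ℝ × ℝ =>
      ((q.1, q.2.1 * (A₁ (q.1, a (q.1, q.2.2)))⁻¹, a (q.1, q.2.2)) : ℝ × ℝ × ℝ)) ?_
    (ha.contDiffAt_tailPoint hA₁ hne))
    ((ha.contDiffAt_inv hA₁ hne).mul (ha.contDiffAt_inv hA₁ hne))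
  rwa [ha.tailPoint_zero]

theorem tendsto_stepFilter {E F : Type*} [TopologicalSpace E] [TopologicalSpace F] [Zero E]
    [Zero F] {f : ℝ × E → ℝ × F} (hf : Tendsto f (𝓝 0) (𝓝 0)) (h : ∀ q, (f q).1 = q.1) :
    Tendsto f (𝓝[{q | 0 ≤ q.1}] 0) (𝓝[{q | 0 ≤ q.1}] 0) :=
  tendsto_nhdsWithin_of_tendsto_nhds_of_eventually_within _ (hf.mono_left nhdsWithin_le_nhds)
    (by filter_upwards [self_mem_nhdsWithin] with q hq; simpa [h q] using hq)

theorem tendsto_plane : Tendsto (fun q : ℝ × ℝ × ℝ => ((q.1, q.2.2) : ℝ × ℝ)) (𝓝 0) (𝓝 0) := by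
  have : Continuous fun q : ℝ × ℝ × ℝ => ((q.1, q.2.2) : ℝ × ℝ) := by fun_prop
  exact this.tendsto 0

theorem tendsto_paramChange {B₀ : ℝ × ℝ → ℝ} (hB : ContDiffAt ℝ m B₀ 0) (h0 : B₀ 0 = 0) :
    Tendsto (fun q : ℝ × ℝ => ((q.1, B₀ q) : ℝ × ℝ)) (𝓝 0) (𝓝 0) := by
  have h := (continuousAt_fst.prodMk hB.continuousAt).tendsto
  rw [h0] at h
  exact h

theorem isBigO_prodMk_zero {X E : Type*} [NormedAddCommGroup E] {l : Filter X} {u : X → E}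
    {k : X → ℝ} (h : u =O[l] k) : (fun x => ((0 : ℝ), u x)) =O[l] k :=
  (Asymptotics.isBigO_zero _ _).prod_left h

/-- The parameter shift, which aligns the normal form parameters of close maps, is close to the
identity. -/
theorem IsParamInverse.isBigO_shift (hb : IsParamInverse m B₀ b)
    (hA : ContDiffAt ℝ m A₀ 0) (hA0 : A₀ 0 = 0) (hB : ContDiffAt ℝ m B₀ 0) (hB0 : B₀ 0 = 0)
    (hm : m ≠ 0) (hAB : (fun q => A₀ q - B₀ q) =O[𝓝[{q | 0 ≤ q.1}] 0] fun q => q.1 ^ p) :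
    (fun q : ℝ × ℝ => b (q.1, A₀ q) - q.2) =O[𝓝[{q | 0 ≤ q.1}] 0] fun q => q.1 ^ p := by
  have hm' : (m : WithTop ℕ∞) ≠ 0 := by exact_mod_cast hm
  refine (hb.smooth.isBigO_comp_sub hm' (u := fun q : ℝ × ℝ => ((q.1, A₀ q) : ℝ × ℝ))
    (v := fun q : ℝ × ℝ => ((q.1, B₀ q) : ℝ × ℝ))
    ((tendsto_paramChange hA hA0).mono_left nhdsWithin_le_nhds)
    ((tendsto_paramChange hB hB0).mono_left nhdsWithin_le_nhds)
    (k := fun q : ℝ × ℝ => q.1 ^ p) ?_).congr' ?_ EventuallyEq.rfl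
  · simpa only [Prod.mk_sub_mk, sub_self] using isBigO_prodMk_zero hAB
  · filter_upwards [nhdsWithin_le_nhds hb.left_inv] with q hq
    rw [hq]

/-- The inverse parameter changes of close maps are close. -/
theorem IsParamInverse.isBigO_sub (ha : IsParamInverse m A₀ a) (hb : IsParamInverse m B₀ b)
    (hA : ContDiffAt ℝ m A₀ 0) (hA0 : A₀ 0 = 0) (hB : ContDiffAt ℝ m B₀ 0) (hB0 : B₀ 0 = 0)
    (hm : m ≠ 0) (hAB : (fun q => A₀ q - B₀ q) =O[𝓝[{q | 0 ≤ q.1}] 0] fun q => q.1 ^ p) :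
    (fun q : ℝ × ℝ × ℝ => a (q.1, q.2.2) - b (q.1, q.2.2)) =O[𝓝[{q | 0 ≤ q.1}] 0]
      fun q => q.1 ^ p := by
  have h1 := ((hb.isBigO_shift hA hA0 hB hB0 hm hAB).comp_tendsto
    (tendsto_stepFilter ha.tendsto_paramPoint fun _ => rfl)).neg_left
  refine h1.congr' ?_ EventuallyEq.rfl
  filter_upwards [nhdsWithin_le_nhds (tendsto_plane.eventually ha.right_inv)] with q hq
  simp only [Function.comp] at hq ⊢
  rw [hq]
  ring

theorem AreClose.isBigO_nfTail (hAB : AreClose p A₀ A₁ A₂ B₀ B₁ B₂)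
    (hA : HasExpansion m Φ A₀ A₁ A₂) (hB : HasExpansion m φ B₀ B₁ B₂)
    (ha : IsParamInverse m A₀ a) (hb : IsParamInverse m B₀ b) (hm : m ≠ 0) :
    (fun q => nfTail A₁ A₂ a q - nfTail B₁ B₂ b q) =O[𝓝[{q | 0 ≤ q.1}] 0] fun q => q.1 ^ p := by
  have hm' : (m : WithTop ℕ∞) ≠ 0 := by exact_mod_cast hm
  have hab := ha.isBigO_sub hb hA.smooth₀ hA.zero hB.smooth₀ hB.zero hm hAB.close₀
  have hpa := ha.tendsto_paramPoint.mono_left (nhdsWithin_le_nhds (s := {q : ℝ × ℝ × ℝ | 0 ≤ q.1}))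
  have hpb := hb.tendsto_paramPoint.mono_left (nhdsWithin_le_nhds (s := {q : ℝ × ℝ × ℝ | 0 ≤ q.1}))
  have hpab : (fun q : ℝ × ℝ × ℝ => ((q.1, a (q.1, q.2.2)) : ℝ × ℝ) - (q.1, b (q.1, q.2.2)))
      =O[𝓝[{q | 0 ≤ q.1}] 0] fun q => q.1 ^ p := by
    simpa only [Prod.mk_sub_mk, sub_self] using isBigO_prodMk_zero hab
  have h1 : (fun q : ℝ × ℝ × ℝ => A₁ (q.1, a (q.1, q.2.2)) - B₁ (q.1, b (q.1, q.2.2)))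
      =O[𝓝[{q | 0 ≤ q.1}] 0] fun q => q.1 ^ p :=
    ((hA.smooth₁.isBigO_comp_sub hm' hpa hpb hpab).add (hAB.close₁.comp_tendsto
      (tendsto_stepFilter hb.tendsto_paramPoint fun _ => rfl))).congr_left fun q => by
        simp only [Function.comp]; ring
  have htA : Tendsto (fun q : ℝ × ℝ × ℝ => A₁ (q.1, a (q.1, q.2.2))) (𝓝[{q | 0 ≤ q.1}] 0)
      (𝓝 (A₁ 0)) := hA.smooth₁.continuousAt.tendsto.comp hpa
  have htB : Tendsto (fun q : ℝ × ℝ × ℝ => B₁ (q.1, b (q.1, q.2.2))) (𝓝[{q | 0 ≤ q.1}] 0)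
      (𝓝 (B₁ 0)) := hB.smooth₁.continuousAt.tendsto.comp hpb
  have h2 : (fun q : ℝ × ℝ × ℝ => (A₁ (q.1, a (q.1, q.2.2)))⁻¹ - (B₁ (q.1, b (q.1, q.2.2)))⁻¹)
      =O[𝓝[{q | 0 ≤ q.1}] 0] fun q => q.1 ^ p := by
    have h3 : (fun q : ℝ × ℝ × ℝ => -((A₁ (q.1, a (q.1, q.2.2)))⁻¹ *
        (B₁ (q.1, b (q.1, q.2.2)))⁻¹) *
        (A₁ (q.1, a (q.1, q.2.2)) - B₁ (q.1, b (q.1, q.2.2))))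
        =O[𝓝[{q | 0 ≤ q.1}] 0] fun q => 1 * q.1 ^ p :=
      ((((htA.inv₀ hA.ne_zero).mul (htB.inv₀ hB.ne_zero)).neg).isBigO_one ℝ).mul h1
    simp only [one_mul] at h3
    refine h3.congr' ?_ EventuallyEq.rfl
    filter_upwards [htA.eventually_ne hA.ne_zero, htB.eventually_ne hB.ne_zero] with q hqA hqB
    field_simp
    ring
  have hq2 : Tendsto (fun q : ℝ × ℝ × ℝ => q.2.1) (𝓝[{q | 0 ≤ q.1}] 0) (𝓝 0) := by
    have : Continuous fun q : ℝ × ℝ × ℝ => q.2.1 := by fun_prop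
    exact (this.tendsto 0).mono_left nhdsWithin_le_nhds
  have htA' := htA.inv₀ hA.ne_zero
  have htB' := htB.inv₀ hB.ne_zero
  have h4 := isBigO_mul_sub_mul hq2 htB' (u' := fun q : ℝ × ℝ × ℝ => q.2.1)
    (by simpa only [sub_self] using Asymptotics.isBigO_zero (fun q : ℝ × ℝ × ℝ => q.1 ^ p) _) h2
  have hta := (ha.tendsto_tailPoint hA.smooth₁ hA.ne_zero).mono_left
    (nhdsWithin_le_nhds (s := {q : ℝ × ℝ × ℝ | 0 ≤ q.1}))
  have htb := (hb.tendsto_tailPoint hB.smooth₁ hB.ne_zero)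
  have h5 := (hA.smooth₂.isBigO_comp_sub hm' hta (htb.mono_left nhdsWithin_le_nhds)
    (k := fun q => q.1 ^ p)
    (by simpa only [Prod.mk_sub_mk, sub_self] using isBigO_prodMk_zero (h4.prod_left hab))).add
    (hAB.close₂.comp_tendsto (tendsto_stepFilter htb fun _ => rfl))
  exact isBigO_mul_sub_mul (u' := fun q : ℝ × ℝ × ℝ =>
      B₂ (q.1, q.2.1 * (B₁ (q.1, b (q.1, q.2.2)))⁻¹, b (q.1, q.2.2)))
    (hA.smooth₂.continuousAt.tendsto.comp hta) (htB'.mul htB')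
    (h5.congr_left fun q => by simp only [Function.comp]; ring)
    (isBigO_mul_sub_mul htA' htB' h2 h2)
end

/-! ### Estimates on a small box -/

theorem eventually_of_norm_le {E : Type*} [NormedAddCommGroup E] {P : E → Prop}
    (h : ∀ᶠ q in 𝓝 (0 : E), P q) : ∀ᶠ s in 𝓝[>] (0 : ℝ), ∀ q, ‖q‖ ≤ s → P q := by
  obtain ⟨δ, hδ, H⟩ := Metric.eventually_nhds_iff_ball.1 h
  filter_upwards [Ioo_mem_nhdsGT hδ] with s hs q hq
  exact H q (by simpa using hq.trans_lt hs.2)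

theorem Asymptotics.IsBigO.eventually_abs_le {E : Type*} [NormedAddCommGroup E] {p : ℕ}
    {u : ℝ × E → ℝ} (h : u =O[𝓝[{q | 0 ≤ q.1}] 0] fun q => q.1 ^ p) :
    ∀ᶠ K in atTop, ∀ᶠ s in 𝓝[>] (0 : ℝ), ∀ q, ‖q‖ ≤ s → 0 ≤ q.1 → |u q| ≤ K * q.1 ^ p := by
  obtain ⟨c, hc⟩ := h.bound
  rw [eventually_nhdsWithin_iff] at hc
  filter_upwards [eventually_ge_atTop c] with K hK
  filter_upwards [eventually_of_norm_le hc] with s hs q hq h0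
  refine (hs q hq h0).trans ?_
  rw [Real.norm_of_nonneg (pow_nonneg h0 p)]
  exact mul_le_mul_of_nonneg_right hK (pow_nonneg h0 p)

/-- The linearising multiplier and the parameter change transform the map into normal form. -/
theorem HasExpansion.eventually_transforms {m : ℕ} {Φ : ℝ → ℝ → ℝ → ℝ} {A₀ A₁ a : ℝ × ℝ → ℝ}
    {A₂ : ℝ × ℝ × ℝ → ℝ} (hA : HasExpansion m Φ A₀ A₁ A₂) (ha : IsParamInverse m A₀ a) :
    ∀ᶠ q in 𝓝 (0 : ℝ × ℝ × ℝ), 0 ≤ q.1 → A₁ (q.1, q.2.2) * Φ q.1 q.2.1 q.2.2 =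
      normalForm (fun h η β => nfTail A₁ A₂ a (h, η, β)) q.1 (A₁ (q.1, q.2.2) * q.2.1)
        (A₀ (q.1, q.2.2)) := by
  filter_upwards [hA.eq, tendsto_plane.eventually ha.left_inv,
    tendsto_plane.eventually (hA.smooth₁.continuousAt.eventually_ne hA.ne_zero)] with q h1 h2 h3 h0
  rw [h1 h0]
  simp only [normalForm, nfTail, h2]
  have h4 : A₁ (q.1, q.2.2) * q.2.1 * (A₁ (q.1, q.2.2))⁻¹ = q.2.1 := by field_simp
  rw [h4]
  simp only [Prod.mk.eta]
  field_simp
  ring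

/-- Uniform control, for `‖q‖ ≤ s`, of the data that put a map into normal form: `A₁` is close to
`c`, the parameter change `A₀` is close to having slope `d` in the parameter, and `e` is a tail with
bound and Lipschitz constant `K`. -/
structure IsGoodExpansion (m : ℕ) (s K c d : ℝ) (Φ : ℝ → ℝ → ℝ → ℝ) (A₀ A₁ : ℝ × ℝ → ℝ)
    (e : ℝ × ℝ × ℝ → ℝ) : Prop where
  smooth₀ : ∀ q, ‖q‖ ≤ s → ContDiffAt ℝ m A₀ q
  smooth₁ : ∀ q, ‖q‖ ≤ s → ContDiffAt ℝ m A₁ q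
  smooth_tail : ∀ q, ‖q‖ ≤ s → ContDiffAt ℝ m e q
  coeff : ∀ q, ‖q‖ ≤ s → |A₁ q - c| ≤ |c| / 2
  param : ∀ q, ‖q‖ ≤ s → |A₀ q| ≤ K * ‖q‖
  param_deriv : ∀ q, ‖q‖ ≤ s → fderiv ℝ A₀ q (0, 1) ≠ 0
  slope : ∀ q q', ‖q‖ ≤ s → ‖q'‖ ≤ s → q.1 = q'.1 →
    |A₀ q - A₀ q' - d * (q.2 - q'.2)| ≤ |d| / 2 * |q.2 - q'.2|
  transforms : ∀ q : ℝ × ℝ × ℝ, ‖q‖ ≤ s → 0 ≤ q.1 → A₁ (q.1, q.2.2) * Φ q.1 q.2.1 q.2.2 =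
      normalForm (fun h η β => e (h, η, β)) q.1 (A₁ (q.1, q.2.2) * q.2.1) (A₀ (q.1, q.2.2))
  tail_bound : ∀ q, ‖q‖ ≤ s → |e q| ≤ K
  tail_lip : ∀ q q', ‖q‖ ≤ s → ‖q'‖ ≤ s → |e q - e q'| ≤ K * ‖q - q'‖

theorem HasExpansion.eventually_isGoodExpansion {m : ℕ} (hm : m ≠ 0) {Φ : ℝ → ℝ → ℝ → ℝ}
    {A₀ A₁ a : ℝ × ℝ → ℝ} {A₂ : ℝ × ℝ × ℝ → ℝ} (hA : HasExpansion m Φ A₀ A₁ A₂)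
    (ha : IsParamInverse m A₀ a) :
    ∀ᶠ K in atTop, ∀ᶠ s in 𝓝[>] (0 : ℝ), IsGoodExpansion m s K (A₁ 0)
      (deriv (fun α => A₀ (0, α)) 0) Φ A₀ A₁ (nfTail A₁ A₂ a) := by
  have hm' : (m : WithTop ℕ∞) ≠ 0 := by exact_mod_cast hm
  have hm1 : (1 : WithTop ℕ∞) ≤ m := by exact_mod_cast Nat.one_le_iff_ne_zero.2 hm
  have hinf : (m : WithTop ℕ∞) ≠ ((⊤ : ℕ∞) : WithTop ℕ∞) := by
    exact_mod_cast ENat.natCast_ne_top m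
  have he := ha.contDiffAt_nfTail hA.smooth₁ hA.ne_zero hA.smooth₂
  set e := nfTail A₁ A₂ a
  set d := deriv (fun α => A₀ (0, α)) 0 with hd
  have hd0 : d ≠ 0 := hA.deriv_ne_zero
  have hfd := fderiv_apply_param hA.smooth₀ hm'
  have h0 := eventually_of_norm_le (hA.smooth₀.eventually hinf)
  have h1 := eventually_of_norm_le (hA.smooth₁.eventually hinf)
  have h2 := eventually_of_norm_le (he.eventually hinf)
  have h3 : ∀ᶠ s in 𝓝[>] (0 : ℝ), ∀ q, ‖q‖ ≤ s → |A₁ q - A₁ 0| ≤ |A₁ 0| / 2 := by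
    refine eventually_of_norm_le ((Metric.tendsto_nhds.1 hA.smooth₁.continuousAt _
      (half_pos (abs_pos.2 hA.ne_zero))).mono fun q hq => ?_)
    rw [Real.dist_eq] at hq
    exact hq.le
  have h4 : ∀ᶠ s in 𝓝[>] (0 : ℝ), ∀ q, ‖q‖ ≤ s → fderiv ℝ A₀ q (0, 1) ≠ 0 := by
    refine eventually_of_norm_le (ContinuousAt.eventually_ne ?_ (by rwa [hfd]))
    have := (hA.smooth₀.fderiv_right (m := 0) (by simpa using hm1)).continuousAt
    exact this.clm_apply continuousAt_const
  have h5 : ∀ᶠ s in 𝓝[>] (0 : ℝ), ∀ q q', ‖q‖ ≤ s → ‖q'‖ ≤ s → q.1 = q'.1 →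
      |A₀ q - A₀ q' - d * (q.2 - q'.2)| ≤ |d| / 2 * |q.2 - q'.2| := by
    have h := (hA.smooth₀.hasStrictFDerivAt hm').isLittleO.def (half_pos (abs_pos.2 hd0))
    have h' : ∀ᶠ w in 𝓝 (0 : (ℝ × ℝ) × (ℝ × ℝ)), ‖A₀ w.1 - A₀ w.2 - fderiv ℝ A₀ 0 (w.1 - w.2)‖ ≤
      |d| / 2 * ‖w.1 - w.2‖ := h
    filter_upwards [eventually_of_norm_le h'] with s hs q q' hq hq' hqq
    have h6 := hs (q, q') (by simpa [Prod.norm_def] using ⟨by simpa [Prod.norm_def] using hq,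
      by simpa [Prod.norm_def] using hq'⟩)
    have h7 : q - q' = (q.2 - q'.2) • ((0 : ℝ), (1 : ℝ)) := by
      ext <;> simp [hqq]
    simp only at h6
    rw [h7, map_smul, hfd, norm_smul, smul_eq_mul] at h6
    simpa [Prod.norm_def, mul_comm] using h6
  have h6 := eventually_of_norm_le (hA.eventually_transforms ha)
  obtain ⟨L, t, ht, hL⟩ := (he.of_le hm1).exists_lipschitzOnWith
  obtain ⟨c, hc⟩ := ((hA.smooth₀.differentiableAt hm').hasFDerivAt.isBigO_sub).bound
  have hc' := eventually_of_norm_le hc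
  have h7 := eventually_of_norm_le (he.continuousAt.abs.eventually_lt_const (lt_add_one |e 0|))
  have h8 := eventually_of_norm_le (P := fun q => q ∈ t) ht
  filter_upwards [eventually_ge_atTop c, eventually_ge_atTop (L : ℝ),
    eventually_ge_atTop (|e 0| + 1)] with K hKc hKL hKe
  filter_upwards [h0, h1, h2, h3, h4, h5, h6, hc', h7, h8] with s g0 g1 g2 g3 g4 g5 g6 gc g7 g8
  refine ⟨g0, g1, g2, g3, fun q hq => ?_, g4, g5, g6, fun q hq => (g7 q hq).le.trans hKe,
    fun q q' hq hq' => ?_⟩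
  · have := gc q hq
    rw [hA.zero, sub_zero, sub_zero, Real.norm_eq_abs] at this
    exact this.trans (mul_le_mul_of_nonneg_right hKc (norm_nonneg _))
  · have := hL.dist_le_mul q (g8 q hq) q' (g8 q' hq')
    rw [Real.dist_eq, dist_eq_norm] at this
    exact this.trans (mul_le_mul_of_nonneg_right hKL (norm_nonneg _))

/-- Uniform closeness of two normal form reductions for `‖q‖ ≤ s`; `b` inverts the parameter
change `B₀`. -/
structure IsGoodPair (p : ℕ) (s K : ℝ) (A₀ A₁ : ℝ × ℝ → ℝ) (e : ℝ × ℝ × ℝ → ℝ)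
    (B₀ B₁ : ℝ × ℝ → ℝ) (e' : ℝ × ℝ × ℝ → ℝ) (b : ℝ × ℝ → ℝ) : Prop where
  close₀ : ∀ q, ‖q‖ ≤ s → 0 ≤ q.1 → |A₀ q - B₀ q| ≤ K * q.1 ^ p
  close₁ : ∀ q, ‖q‖ ≤ s → 0 ≤ q.1 → |A₁ q - B₁ q| ≤ K * q.1 ^ p
  close_tail : ∀ q, ‖q‖ ≤ s → 0 ≤ q.1 → |e q - e' q| ≤ K * q.1 ^ p
  shift_smooth : ∀ q, ‖q‖ ≤ s → ContinuousAt (fun q => b (q.1, A₀ q)) q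
  shift_close : ∀ q, ‖q‖ ≤ s → 0 ≤ q.1 → |b (q.1, A₀ q) - q.2| ≤ K * q.1 ^ p
  shift_aligns : ∀ q, ‖q‖ ≤ s → B₀ (q.1, b (q.1, A₀ q)) = A₀ q
  shift_coeff : ∀ q, ‖q‖ ≤ s → 0 ≤ q.1 → |A₁ q - B₁ (q.1, b (q.1, A₀ q))| ≤ K * q.1 ^ p

theorem AreClose.eventually_isGoodPair {m p : ℕ} (hm : m ≠ 0) {Φ φ : ℝ → ℝ → ℝ → ℝ}
    {A₀ A₁ B₀ B₁ a b : ℝ × ℝ → ℝ} {A₂ B₂ : ℝ × ℝ × ℝ → ℝ}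
    (hAB : AreClose p A₀ A₁ A₂ B₀ B₁ B₂) (hA : HasExpansion m Φ A₀ A₁ A₂)
    (hB : HasExpansion m φ B₀ B₁ B₂) (ha : IsParamInverse m A₀ a) (hb : IsParamInverse m B₀ b) :
    ∀ᶠ K in atTop, ∀ᶠ s in 𝓝[>] (0 : ℝ),
      IsGoodPair p s K A₀ A₁ (nfTail A₁ A₂ a) B₀ B₁ (nfTail B₁ B₂ b) b := by
  have hm' : (m : WithTop ℕ∞) ≠ 0 := by exact_mod_cast hm
  have hinf : (m : WithTop ℕ∞) ≠ ((⊤ : ℕ∞) : WithTop ℕ∞) := by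
    exact_mod_cast ENat.natCast_ne_top m
  have hs := hb.isBigO_shift hA.smooth₀ hA.zero hB.smooth₀ hB.zero hm hAB.close₀
  have hsmooth : ContDiffAt ℝ m (fun q : ℝ × ℝ => b (q.1, A₀ q)) 0 := by
    refine ContDiffAt.comp (0 : ℝ × ℝ) (f := fun q : ℝ × ℝ => ((q.1, A₀ q) : ℝ × ℝ)) ?_
      (contDiffAt_fst.prodMk hA.smooth₀)
    rw [show (((0 : ℝ × ℝ).1, A₀ 0) : ℝ × ℝ) = 0 from Prod.ext rfl hA.zero]
    exact hb.smooth
  have hshift : Tendsto (fun q : ℝ × ℝ => ((q.1, b (q.1, A₀ q)) : ℝ × ℝ)) (𝓝 0) (𝓝 0) := by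
    refine tendsto_paramChange (m := m) hsmooth ?_
    rw [hA.zero]
    exact hb.zero
  have hid : Tendsto (fun q : ℝ × ℝ => q) (𝓝[{q | 0 ≤ q.1}] 0) (𝓝 0) :=
    tendsto_id.mono_left nhdsWithin_le_nhds
  have hcoeff : (fun q : ℝ × ℝ => A₁ q - B₁ (q.1, b (q.1, A₀ q))) =O[𝓝[{q | 0 ≤ q.1}] 0]
      fun q => q.1 ^ p := by
    have h1 := hB.smooth₁.isBigO_comp_sub hm' hid (hshift.mono_left nhdsWithin_le_nhds)
      (k := fun q : ℝ × ℝ => q.1 ^ p) (by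
        refine (isBigO_prodMk_zero hs.neg_left).congr_left fun q => ?_
        ext <;> simp)
    exact (hAB.close₁.add h1).congr_left fun q => by ring
  filter_upwards [hAB.close₀.eventually_abs_le, hAB.close₁.eventually_abs_le,
    (hAB.isBigO_nfTail hA hB ha hb hm).eventually_abs_le, hs.eventually_abs_le,
    hcoeff.eventually_abs_le] with K k0 k1 k2 k3 k4
  filter_upwards [k0, k1, k2, k3, k4, eventually_of_norm_le (hsmooth.eventually hinf),
    eventually_of_norm_le ((tendsto_paramChange hA.smooth₀ hA.zero).eventually hb.right_inv)]
    with s g0 g1 g2 g3 g4 g5 g6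
  exact ⟨g0, g1, g2, fun q hq => (g5 q hq).continuousAt, g3, g6, g4⟩

/-! ### Assembling the conjugacy -/

theorem norm_pair_le {s h α : ℝ} (hh : |h| ≤ s) (hα : |α| ≤ s) : ‖((h, α) : ℝ × ℝ)‖ ≤ s := by
  simpa [Prod.norm_def] using ⟨hh, hα⟩

theorem norm_triple_le {s h x α : ℝ} (hh : |h| ≤ s) (hx : |x| ≤ s) (hα : |α| ≤ s) :
    ‖((h, x, α) : ℝ × ℝ × ℝ)‖ ≤ s := by
  simpa [Prod.norm_def] using ⟨hh, hx, hα⟩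

/-- The sizes of the domains of the conjugacy, relative to the scale `s` on which the estimates with
constant `K` hold. The last inequality keeps the conjugacy in original coordinates, which moves
points by at most `4202 K h / |c|`, in the domain of the coordinate changes. -/
structure IsScale (s K c h₀ ε r ρ : ℝ) : Prop where
  s_le : s ≤ 1
  one_le_K : 1 ≤ K
  c_ne : c ≠ 0
  h₀_pos : 0 < h₀
  ε_pos : 0 < ε
  r_pos : 0 < r
  ρ_pos : 0 < ρ
  ε_le : ε ≤ s
  K_ε_le : K * ε ≤ 1 / 10000
  r_le : r ≤ s
  c_r_le : 2 * |c| * r ≤ ε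
  K_ρ_le : K * ρ ≤ ε / 8
  ρ_le_r : ρ ≤ r
  K_h₀_le : 2 * K * h₀ ≤ ρ
  h₀_le : 2 * (4202 * K / |c|) * h₀ ≤ r

theorem exists_isScale {s K c : ℝ} (hs : 0 < s) (hs1 : s ≤ 1) (hK : 1 ≤ K) (hc : c ≠ 0) :
    ∃ h₀ ε r ρ, IsScale s K c h₀ ε r ρ := by
  have hK0 : 0 < K := by linarith
  have hc0 : 0 < |c| := abs_pos.2 hc
  obtain ⟨ε, hε, hε1, hε2⟩ : ∃ ε, 0 < ε ∧ ε ≤ s ∧ ε ≤ 1 / 10000 / K :=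
    ⟨min s (1 / 10000 / K), by positivity, min_le_left _ _, min_le_right _ _⟩
  obtain ⟨r, hr, hr1, hr2⟩ : ∃ r, 0 < r ∧ r ≤ s ∧ r ≤ ε / (2 * |c|) :=
    ⟨min s (ε / (2 * |c|)), by positivity, min_le_left _ _, min_le_right _ _⟩
  obtain ⟨ρ, hρ, hρ1, hρ2⟩ : ∃ ρ, 0 < ρ ∧ ρ ≤ ε / 8 / K ∧ ρ ≤ r :=
    ⟨min (ε / 8 / K) r, by positivity, min_le_left _ _, min_le_right _ _⟩
  obtain ⟨h₀, hh, hh1, hh2⟩ : ∃ h₀, 0 < h₀ ∧ h₀ ≤ ρ / (2 * K) ∧ h₀ ≤ r / (2 * (4202 * K / |c|)) :=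
    ⟨min (ρ / (2 * K)) (r / (2 * (4202 * K / |c|))), by positivity, min_le_left _ _,
      min_le_right _ _⟩
  rw [le_div_iff₀ (by positivity)] at hε2 hr2 hρ1 hh1 hh2
  exact ⟨h₀, ε, r, ρ, hs1, hK, hc, hh, hε, hr, hρ, hε1, by linarith, hr1, by linarith, by linarith,
    hρ2, by linarith, by linarith⟩

section

variable {m p : ℕ} {s K c d h₀ ε r ρ : ℝ} {Φ φ : ℝ → ℝ → ℝ → ℝ} {A₀ A₁ B₀ B₁ b : ℝ × ℝ → ℝ}
  {e e' : ℝ × ℝ × ℝ → ℝ}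

theorem IsScale.ρ_le (S : IsScale s K c h₀ ε r ρ) : ρ ≤ ε / 8 := by
  nlinarith [S.K_ρ_le, S.one_le_K, S.ρ_pos]

theorem IsScale.h₀_le_ρ (S : IsScale s K c h₀ ε r ρ) : h₀ ≤ ρ := by
  nlinarith [S.K_h₀_le, S.one_le_K, S.h₀_pos]

theorem IsScale.step_mem (S : IsScale s K c h₀ ε r ρ) {h : ℝ} (hh : h ∈ Icc 0 h₀) : |h| ≤ s := by
  rw [abs_of_nonneg hh.1]
  linarith [hh.2, S.h₀_le_ρ, S.ρ_le, S.ε_le, S.ε_pos]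

theorem IsScale.param_mem (S : IsScale s K c h₀ ε r ρ) {α : ℝ} (hα : α ∈ Icc (-ρ) ρ) :
    |α| ≤ s := by
  linarith [abs_le.2 hα, S.ρ_le, S.ε_le, S.ε_pos]

theorem IsScale.nfParam_mem (S : IsScale s K c h₀ ε r ρ) {β : ℝ}
    (hβ : β ∈ Icc (-(ε / 8)) (ε / 8)) : |β| ≤ s := by
  linarith [abs_le.2 hβ, S.ε_le, S.ε_pos]

theorem IsScale.pair_mem (S : IsScale s K c h₀ ε r ρ) {h α : ℝ} (hh : h ∈ Icc 0 h₀)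
    (hα : α ∈ Icc (-ρ) ρ) : ‖((h, α) : ℝ × ℝ)‖ ≤ s :=
  norm_pair_le (S.step_mem hh) (S.param_mem hα)

theorem IsScale.triple_mem (S : IsScale s K c h₀ ε r ρ) {h x α : ℝ} (hh : h ∈ Icc 0 h₀)
    (hx : x ∈ Icc (-r) r) (hα : α ∈ Icc (-ρ) ρ) : ‖((h, x, α) : ℝ × ℝ × ℝ)‖ ≤ s :=
  norm_triple_le (S.step_mem hh) ((abs_le.2 hx).trans S.r_le) (S.param_mem hα)

theorem IsScale.nfTriple_mem (S : IsScale s K c h₀ ε r ρ) {h η β : ℝ} (hh : h ∈ Icc 0 h₀)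
    (hη : η ∈ Icc (-ε) ε) (hβ : β ∈ Icc (-(ε / 8)) (ε / 8)) :
    ‖((h, η, β) : ℝ × ℝ × ℝ)‖ ≤ s :=
  norm_triple_le (S.step_mem hh) ((abs_le.2 hη).trans S.ε_le) (S.nfParam_mem hβ)

theorem IsScale.smallParams (S : IsScale s K c h₀ ε r ρ) {h β : ℝ} (hh : h ∈ Ioc 0 h₀)
    (hβ : β ∈ Icc (-(ε / 8)) (ε / 8)) : SmallParams ε K h β where
  ε_pos := S.ε_pos
  ε_le := by nlinarith [S.K_ε_le, S.one_le_K, S.ε_pos]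
  K_nonneg := by linarith [S.one_le_K]
  K_le := S.K_ε_le
  h_pos := hh.1
  h_le := by
    have := S.step_mem ⟨hh.1.le, hh.2⟩
    linarith [le_abs_self h, S.s_le]
  β_le := abs_le.2 hβ

theorem IsGoodExpansion.tailBound (E : IsGoodExpansion m s K c d Φ A₀ A₁ e)
    (S : IsScale s K c h₀ ε r ρ) {h β : ℝ} (hh : h ∈ Icc 0 h₀)
    (hβ : β ∈ Icc (-(ε / 8)) (ε / 8)) : TailBound ε K (fun η => e (h, η, β)) where
  bound x hx := E.tail_bound _ (S.nfTriple_mem hh hx hβ)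
  lip x hx y hy := by
    have := E.tail_lip _ _ (S.nfTriple_mem hh hx hβ) (S.nfTriple_mem hh hy hβ)
    simpa [Prod.norm_def] using this

theorem IsGoodExpansion.coeff_ne (E : IsGoodExpansion m s K c d Φ A₀ A₁ e) (hc : c ≠ 0)
    {q : ℝ × ℝ} (hq : ‖q‖ ≤ s) : A₁ q ≠ 0 := by
  intro h
  have h1 := E.coeff q hq
  rw [h, zero_sub, abs_neg] at h1
  linarith [abs_pos.2 hc]

theorem IsGoodExpansion.le_abs_coeff (E : IsGoodExpansion m s K c d Φ A₀ A₁ e)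
    {q : ℝ × ℝ} (hq : ‖q‖ ≤ s) : |c| / 2 ≤ |A₁ q| := by
  have h1 := E.coeff q hq
  have h2 := abs_sub_abs_le_abs_sub c (A₁ q)
  rw [abs_sub_comm] at h2
  linarith

theorem IsGoodExpansion.abs_coeff_le (E : IsGoodExpansion m s K c d Φ A₀ A₁ e)
    {q : ℝ × ℝ} (hq : ‖q‖ ≤ s) : |A₁ q| ≤ 2 * |c| := by
  have h1 := E.coeff q hq
  have h2 := abs_sub_abs_le_abs_sub (A₁ q) c
  linarith [abs_nonneg c]

theorem IsGoodExpansion.coord_maps (E : IsGoodExpansion m s K c d Φ A₀ A₁ e)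
    (S : IsScale s K c h₀ ε r ρ) {h x α : ℝ} (hh : h ∈ Icc 0 h₀) (hx : x ∈ Icc (-r) r)
    (hα : α ∈ Icc (-ρ) ρ) : A₁ (h, α) * x ∈ Icc (-ε) ε := by
  rw [mem_Icc, ← abs_le, abs_mul]
  calc |A₁ (h, α)| * |x| ≤ (2 * |c|) * r :=
        mul_le_mul (E.abs_coeff_le (S.pair_mem hh hα)) (abs_le.2 hx) (abs_nonneg _) (by positivity)
    _ ≤ ε := S.c_r_le

theorem IsGoodExpansion.param_maps (E : IsGoodExpansion m s K c d Φ A₀ A₁ e)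
    (S : IsScale s K c h₀ ε r ρ) {h α : ℝ} (hh : h ∈ Icc 0 h₀) (hα : α ∈ Icc (-ρ) ρ) :
    A₀ (h, α) ∈ Icc (-(ε / 8)) (ε / 8) := by
  rw [mem_Icc, ← abs_le]
  have h1 : ‖((h, α) : ℝ × ℝ)‖ ≤ ρ := norm_pair_le
    (by rw [abs_of_nonneg hh.1]; exact hh.2.trans S.h₀_le_ρ) (abs_le.2 hα)
  have h2 : K * ‖((h, α) : ℝ × ℝ)‖ ≤ K * ρ :=
    mul_le_mul_of_nonneg_left h1 (by linarith [S.one_le_K])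
  linarith [E.param _ (S.pair_mem hh hα), S.K_ρ_le]

/-- The parameter change is strictly monotone, with the sign of `d`. -/
theorem IsGoodExpansion.slope_pos (E : IsGoodExpansion m s K c d Φ A₀ A₁ e) (hd : d ≠ 0)
    {h α α' : ℝ} (hα : ‖((h, α) : ℝ × ℝ)‖ ≤ s) (hα' : ‖((h, α') : ℝ × ℝ)‖ ≤ s) (hlt : α < α') :
    0 < d * (A₀ (h, α') - A₀ (h, α)) := by
  have h1 := E.slope _ _ hα' hα rfl
  simp only at h1
  rw [abs_of_pos (sub_pos.2 hlt)] at h1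
  have h2 : |d * (A₀ (h, α') - A₀ (h, α)) - d ^ 2 * (α' - α)| ≤ d ^ 2 / 2 * (α' - α) := by
    calc |d * (A₀ (h, α') - A₀ (h, α)) - d ^ 2 * (α' - α)|
        = |d| * |A₀ (h, α') - A₀ (h, α) - d * (α' - α)| := by rw [← abs_mul]; congr 1; ring
      _ ≤ |d| * (|d| / 2 * (α' - α)) := mul_le_mul_of_nonneg_left h1 (abs_nonneg d)
      _ = d ^ 2 / 2 * (α' - α) := by rw [← sq_abs d]; ring
  have h3 : 0 < d ^ 2 * (α' - α) := mul_pos (by positivity) (sub_pos.2 hlt)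
  linarith [(abs_le.1 h2).1]

theorem IsGoodExpansion.normalFormReduction (E : IsGoodExpansion m s K c d Φ A₀ A₁ e)
    (S : IsScale s K c h₀ ε r ρ) :
    NormalFormReduction m Φ h₀ r ρ ε (ε / 8) (fun h x α => A₁ (h, α) * x)
      (fun h α => A₀ (h, α)) (fun h η β => e (h, η, β)) where
  coord_smooth := by
    rintro ⟨h, x, α⟩ ⟨hh, hx, hα⟩
    have h1 : ContDiffAt ℝ m (fun q : ℝ × ℝ × ℝ => A₁ (q.1, q.2.2)) (h, x, α) :=
      ContDiffAt.comp (h, x, α) (f := fun q : ℝ × ℝ × ℝ => ((q.1, q.2.2) : ℝ × ℝ))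
        (E.smooth₁ _ (S.pair_mem hh hα)) (by fun_prop)
    have h2 : ContDiffAt ℝ m (fun q : ℝ × ℝ × ℝ => q.2.1) (h, x, α) := by fun_prop
    exact (h1.mul h2).contDiffWithinAt
  coord_zero h hh α hα := mul_zero _
  coord_deriv h hh x hx α hα := by
    have h1 : HasDerivWithinAt (fun y => A₁ (h, α) * y) (A₁ (h, α) * 1) (Icc (-r) r) x :=
      ((hasDerivAt_id x).const_mul _).hasDerivWithinAt
    rw [h1.derivWithin (uniqueDiffOn_Icc (by linarith [S.r_pos]) x hx), mul_one]
    exact E.coeff_ne S.c_ne (S.pair_mem hh hα)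
  coord_maps h hh x hx α hα := E.coord_maps S hh hx hα
  param_smooth := by
    rintro ⟨h, α⟩ ⟨hh, hα⟩
    exact (E.smooth₀ _ (S.pair_mem hh hα)).contDiffWithinAt
  param_deriv h hh α hα := by
    have h1 : HasDerivAt (fun α : ℝ => ((h, α) : ℝ × ℝ)) (0, 1) α :=
      (hasDerivAt_const _ _).prodMk (hasDerivAt_id _)
    have h0 : DifferentiableAt ℝ A₀ (h, α) := by
      by_contra h2
      simpa [fderiv_zero_of_not_differentiableAt h2] using E.param_deriv _ (S.pair_mem hh hα)
    have h2 := HasFDerivAt.comp_hasDerivAt (f := fun α : ℝ => ((h, α) : ℝ × ℝ)) α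
      h0.hasFDerivAt h1
    have h3 : HasDerivWithinAt (fun α => A₀ (h, α)) (fderiv ℝ A₀ (h, α) (0, 1)) (Icc (-ρ) ρ) α :=
      h2.hasDerivWithinAt
    rw [h3.derivWithin (uniqueDiffOn_Icc (by linarith [S.ρ_pos]) α hα)]
    exact E.param_deriv _ (S.pair_mem hh hα)
  param_maps h hh α hα := E.param_maps S hh hα
  tail_smooth := by
    rintro ⟨h, η, β⟩ ⟨hh, hη, hβ⟩
    exact (E.smooth_tail _ (S.nfTriple_mem hh hη hβ)).contDiffWithinAt
  transforms h hh x hx α hα _ := E.transforms (h, x, α) (S.triple_mem hh hx hα) hh.1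

/-- For every step-size and parameter, `J h β` is a conjugacy from the normal form with tail `e'` to
the one with tail `e`, built from fundamental domains and `O(h^p)`-close to the identity. -/
def IsNFConjugacy (p : ℕ) (K h₀ ε : ℝ) (e e' : ℝ × ℝ × ℝ → ℝ) (J : ℝ → ℝ → (ℝ ≃o ℝ)) : Prop :=
  ∀ h ∈ Ioc 0 h₀, ∀ β ∈ Icc (-(ε / 8)) (ε / 8),
    BuiltFromFundamentalDomains (nfMap (fun η => e' (h, η, β)) h β)
      (nfMap (fun η => e (h, η, β)) h β) ε β (J h β) ∧
    (∀ x ∈ Icc (-ε) ε, J h β (nfMap (fun η => e' (h, η, β)) h β x) =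
      nfMap (fun η => e (h, η, β)) h β (J h β x)) ∧
    (∀ x, J h β x ∈ Icc (-ε) ε ↔ x ∈ Icc (-ε) ε) ∧
    ∀ x ∈ Icc (-ε) ε, |x - J h β x| ≤ 2100 * (K * h ^ p)

theorem exists_isNFConjugacy (E : IsGoodExpansion m s K c d Φ A₀ A₁ e)
    (E' : IsGoodExpansion m s K c d φ B₀ B₁ e') (P : IsGoodPair p s K A₀ A₁ e B₀ B₁ e' b)
    (S : IsScale s K c h₀ ε r ρ) : ∃ J, IsNFConjugacy p K h₀ ε e e' J := by
  have : ∀ h β, ∃ J : ℝ ≃o ℝ, h ∈ Ioc 0 h₀ → β ∈ Icc (-(ε / 8)) (ε / 8) →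
      BuiltFromFundamentalDomains (nfMap (fun η => e' (h, η, β)) h β)
        (nfMap (fun η => e (h, η, β)) h β) ε β J ∧
      (∀ x ∈ Icc (-ε) ε, J (nfMap (fun η => e' (h, η, β)) h β x) =
        nfMap (fun η => e (h, η, β)) h β (J x)) ∧
      (∀ x, J x ∈ Icc (-ε) ε ↔ x ∈ Icc (-ε) ε) ∧
      ∀ x ∈ Icc (-ε) ε, |x - J x| ≤ 2100 * (K * h ^ p) := by
    intro h β
    by_cases H : h ∈ Ioc 0 h₀ ∧ β ∈ Icc (-(ε / 8)) (ε / 8)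
    · have hh : h ∈ Icc 0 h₀ := ⟨H.1.1.le, H.1.2⟩
      obtain ⟨J, hJ⟩ := exists_nf_conjugacy (S.smallParams H.1 H.2) (E'.tailBound S hh H.2)
        (E.tailBound S hh H.2) (δ := K * h ^ p)
        (mul_nonneg (by linarith [S.one_le_K]) (pow_nonneg hh.1 p)) (fun x hx => by
          rw [abs_sub_comm]
          exact P.close_tail _ (S.nfTriple_mem hh hx H.2) hh.1)
      exact ⟨J, fun _ _ => hJ⟩
    · exact ⟨OrderIso.refl ℝ, fun h1 h2 => absurd ⟨h1, h2⟩ H⟩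
  choose J hJ using this
  exact ⟨J, fun h hh β hβ => hJ h β hh hβ⟩

end

/-- The conjugacy data: the coordinate changes are `x ↦ A₁(h, α) x` and `x ↦ B₁(h, α) x`, the
parameter changes are `A₀` and `B₀`, the shift is `B₀⁻¹ ∘ A₀` and `Jo = χφ⁻¹ ∘ J⁻¹ ∘ χΦ`. -/
def conjData (h₀ ε r ρ : ℝ) (A₀ A₁ : ℝ × ℝ → ℝ) (e : ℝ × ℝ × ℝ → ℝ) (B₀ B₁ : ℝ × ℝ → ℝ)
    (e' : ℝ × ℝ × ℝ → ℝ) (b : ℝ × ℝ → ℝ) (J : ℝ → ℝ → (ℝ ≃o ℝ)) : TCData where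
  h₀ := h₀
  ε₀ := ε
  α₀ := ε / 8
  r := r
  ρ := ρ
  r' := r / 2
  ρ' := ρ / 2
  χΦ h x α := A₁ (h, α) * x
  χφ h x α := B₁ (h, α) * x
  bΦ h α := A₀ (h, α)
  bφ h α := B₀ (h, α)
  eΦ h η β := e (h, η, β)
  eφ h η β := e' (h, η, β)
  J h x β := J h β x
  shift h α := b (h, A₀ (h, α))
  Jo h x α := (B₁ (h, b (h, A₀ (h, α))))⁻¹ * (J h (A₀ (h, α))).symm (A₁ (h, α) * x)

section

variable {m p : ℕ} {s K c d h₀ ε r ρ : ℝ} {Φ φ : ℝ → ℝ → ℝ → ℝ} {A₀ A₁ B₀ B₁ b : ℝ × ℝ → ℝ}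
  {e e' : ℝ × ℝ × ℝ → ℝ} {J : ℝ → ℝ → (ℝ ≃o ℝ)}

theorem IsScale.pow_le (S : IsScale s K c h₀ ε r ρ) (hp : 1 ≤ p) {h : ℝ} (hh : h ∈ Icc 0 h₀) :
    h ^ p ≤ h₀ := by
  have h1 : h ≤ 1 := by
    have := S.step_mem hh
    linarith [le_abs_self h, S.s_le]
  have h2 : h ^ p ≤ h ^ 1 := pow_le_pow_of_le_one hh.1 h1 hp
  linarith [hh.2]

theorem IsScale.half_mem {r x : ℝ} (hx : x ∈ Icc (-(r / 2)) (r / 2)) : x ∈ Icc (-r) r := by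
  have : 0 ≤ r := by linarith [hx.1, hx.2]
  exact ⟨by linarith [hx.1], by linarith [hx.2]⟩

theorem IsGoodPair.shift_mem (P : IsGoodPair p s K A₀ A₁ e B₀ B₁ e' b)
    (S : IsScale s K c h₀ ε r ρ) (hp : 1 ≤ p) {h α : ℝ} (hh : h ∈ Icc 0 h₀)
    (hα : α ∈ Icc (-(ρ / 2)) (ρ / 2)) : b (h, A₀ (h, α)) ∈ Icc (-ρ) ρ := by
  have h1 := P.shift_close (h, α) (S.pair_mem hh (IsScale.half_mem hα)) hh.1
  have h2 : K * h ^ p ≤ K * h₀ :=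
    mul_le_mul_of_nonneg_left (S.pow_le hp hh) (by linarith [S.one_le_K])
  have h3 := abs_le.1 (h1.trans h2)
  simp only at h3
  have := S.K_h₀_le
  exact ⟨by linarith [hα.1], by linarith [hα.2]⟩

theorem IsNFConjugacy.symm_mem (hJ : IsNFConjugacy p K h₀ ε e e' J) {h β y : ℝ}
    (hh : h ∈ Ioc 0 h₀) (hβ : β ∈ Icc (-(ε / 8)) (ε / 8)) (hy : y ∈ Icc (-ε) ε) :
    (J h β).symm y ∈ Icc (-ε) ε := by
  rw [← (hJ h hh β hβ).2.2.1]
  simpa using hy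

theorem IsNFConjugacy.symm_close (hJ : IsNFConjugacy p K h₀ ε e e' J) {h β y : ℝ}
    (hh : h ∈ Ioc 0 h₀) (hβ : β ∈ Icc (-(ε / 8)) (ε / 8)) (hy : y ∈ Icc (-ε) ε) :
    |(J h β).symm y - y| ≤ 2100 * (K * h ^ p) := by
  have := (hJ h hh β hβ).2.2.2 _ (hJ.symm_mem hh hβ hy)
  simpa using this

theorem conjData_orig_close (E : IsGoodExpansion m s K c d Φ A₀ A₁ e)
    (E' : IsGoodExpansion m s K c d φ B₀ B₁ e') (P : IsGoodPair p s K A₀ A₁ e B₀ B₁ e' b)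
    (S : IsScale s K c h₀ ε r ρ) (hp : 1 ≤ p) (hJ : IsNFConjugacy p K h₀ ε e e' J) {h x α : ℝ}
    (hh : h ∈ Ioc 0 h₀) (hx : x ∈ Icc (-(r / 2)) (r / 2)) (hα : α ∈ Icc (-(ρ / 2)) (ρ / 2)) :
    |x - (conjData h₀ ε r ρ A₀ A₁ e B₀ B₁ e' b J).Jo h x α| ≤ 4202 * K / |c| * h ^ p := by
  have hh' : h ∈ Icc 0 h₀ := ⟨hh.1.le, hh.2⟩
  have hα' := IsScale.half_mem hα
  have hx' := IsScale.half_mem hx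
  set t := b (h, A₀ (h, α)) with ht
  have hB := E'.coeff_ne S.c_ne (S.pair_mem hh' (P.shift_mem S hp hh' hα))
  have hB' := E'.le_abs_coeff (S.pair_mem hh' (P.shift_mem S hp hh' hα))
  have h1 := hJ.symm_close hh (E.param_maps S hh' hα') (E.coord_maps S hh' hx' hα')
  have h2 := P.shift_coeff (h, α) (S.pair_mem hh' hα') hh'.1
  simp only at h2
  rw [← ht] at hB hB' h2
  set z := (J h (A₀ (h, α))).symm (A₁ (h, α) * x) with hz
  have hx1 : |x| ≤ 1 := (abs_le.2 hx').trans (S.r_le.trans S.s_le)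
  have hc := abs_pos.2 S.c_ne
  have hKh : 0 ≤ K * h ^ p := mul_nonneg (by linarith [S.one_le_K]) (pow_nonneg hh'.1 p)
  have h3 : |B₁ (h, t) * (x - (B₁ (h, t))⁻¹ * z)| ≤ 2101 * (K * h ^ p) := by
    have h4 : B₁ (h, t) * (x - (B₁ (h, t))⁻¹ * z) =
        -(z - A₁ (h, α) * x) + -((A₁ (h, α) - B₁ (h, t)) * x) := by
      field_simp
      ring
    rw [h4]
    refine (abs_add_le _ _).trans ?_
    rw [abs_neg, abs_neg, abs_mul]
    have h5 : |A₁ (h, α) - B₁ (h, t)| * |x| ≤ K * h ^ p * 1 :=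
      mul_le_mul h2 hx1 (abs_nonneg _) hKh
    linarith
  rw [abs_mul] at h3
  change |x - (B₁ (h, t))⁻¹ * z| ≤ _
  have h6 : |c| / 2 * |x - (B₁ (h, t))⁻¹ * z| ≤ 2101 * (K * h ^ p) :=
    (mul_le_mul_of_nonneg_right hB' (abs_nonneg _)).trans h3
  calc |x - (B₁ (h, t))⁻¹ * z| = (|c| / 2 * |x - (B₁ (h, t))⁻¹ * z|) * (2 / |c|) := by
        field_simp
    _ ≤ 2101 * (K * h ^ p) * (2 / |c|) := mul_le_mul_of_nonneg_right h6 (by positivity)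
    _ = 4202 * K / |c| * h ^ p := by ring

theorem conjData_orig_maps (E : IsGoodExpansion m s K c d Φ A₀ A₁ e)
    (E' : IsGoodExpansion m s K c d φ B₀ B₁ e') (P : IsGoodPair p s K A₀ A₁ e B₀ B₁ e' b)
    (S : IsScale s K c h₀ ε r ρ) (hp : 1 ≤ p) (hJ : IsNFConjugacy p K h₀ ε e e' J) {h x α : ℝ}
    (hh : h ∈ Ioc 0 h₀) (hx : x ∈ Icc (-(r / 2)) (r / 2)) (hα : α ∈ Icc (-(ρ / 2)) (ρ / 2)) :
    (conjData h₀ ε r ρ A₀ A₁ e B₀ B₁ e' b J).Jo h x α ∈ Icc (-r) r := by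
  have h1 := conjData_orig_close E E' P S hp hJ hh hx hα
  have hc := abs_pos.2 S.c_ne
  have h2 : 4202 * K / |c| * h ^ p ≤ 4202 * K / |c| * h₀ :=
    mul_le_mul_of_nonneg_left (S.pow_le hp ⟨hh.1.le, hh.2⟩)
      (div_nonneg (by linarith [S.one_le_K]) hc.le)
  have h3 := abs_le.1 (h1.trans h2)
  have := S.h₀_le
  exact ⟨by linarith [hx.1], by linarith [hx.2]⟩

/-- `A₁` and `B₁` have the sign of `c`, so `Jo` is increasing whether `χΦ` and `χφ` preserve or
reverse the orientation. -/
theorem conjData_orig_mono (E : IsGoodExpansion m s K c d Φ A₀ A₁ e)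
    (E' : IsGoodExpansion m s K c d φ B₀ B₁ e') (P : IsGoodPair p s K A₀ A₁ e B₀ B₁ e' b)
    (S : IsScale s K c h₀ ε r ρ) (hp : 1 ≤ p) {h α : ℝ}
    (hh : h ∈ Icc 0 h₀) (hα : α ∈ Icc (-(ρ / 2)) (ρ / 2)) :
    StrictMono (fun x => (conjData h₀ ε r ρ A₀ A₁ e B₀ B₁ e' b J).Jo h x α) := by
  have h1 := E.coeff _ (S.pair_mem hh (IsScale.half_mem hα))
  have h2 := E'.coeff _ (S.pair_mem hh (P.shift_mem S hp hh hα))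
  intro x y hxy
  simp only [conjData]
  rcases lt_or_gt_of_ne S.c_ne with hc | hc
  · rw [abs_of_neg hc] at h1 h2
    have h3 : A₁ (h, α) < 0 := by linarith [(abs_le.1 h1).2]
    have h4 : B₁ (h, b (h, A₀ (h, α))) < 0 := by linarith [(abs_le.1 h2).2]
    exact mul_lt_mul_of_neg_left ((OrderIso.strictMono _) (mul_lt_mul_of_neg_left hxy h3))
      (inv_lt_zero.2 h4)
  · rw [abs_of_pos hc] at h1 h2
    have h3 : 0 < A₁ (h, α) := by linarith [(abs_le.1 h1).1]
    have h4 : 0 < B₁ (h, b (h, A₀ (h, α))) := by linarith [(abs_le.1 h2).1]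
    exact mul_lt_mul_of_pos_left ((OrderIso.strictMono _) (mul_lt_mul_of_pos_left hxy h3))
      (inv_pos.2 h4)

theorem conjData_orig_conj (E : IsGoodExpansion m s K c d Φ A₀ A₁ e)
    (E' : IsGoodExpansion m s K c d φ B₀ B₁ e') (P : IsGoodPair p s K A₀ A₁ e B₀ B₁ e' b)
    (S : IsScale s K c h₀ ε r ρ) (hp : 1 ≤ p) (hJ : IsNFConjugacy p K h₀ ε e e' J) {h x α : ℝ}
    (hh : h ∈ Ioc 0 h₀) (hx : x ∈ Icc (-(r / 2)) (r / 2)) (hα : α ∈ Icc (-(ρ / 2)) (ρ / 2)) :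
    (conjData h₀ ε r ρ A₀ A₁ e B₀ B₁ e' b J).Jo h (Φ h x α) α =
      φ h ((conjData h₀ ε r ρ A₀ A₁ e B₀ B₁ e' b J).Jo h x α) (b (h, A₀ (h, α))) := by
  have hh' : h ∈ Icc 0 h₀ := ⟨hh.1.le, hh.2⟩
  have hα' := IsScale.half_mem hα
  have hx' := IsScale.half_mem hx
  have hJo := conjData_orig_maps E E' P S hp hJ hh hx hα
  have hal := P.shift_aligns _ (S.pair_mem hh' hα')
  have hβ := E.param_maps S hh' hα'
  have hy := E.coord_maps S hh' hx' hα'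
  have h1 := E.transforms (h, x, α) (S.triple_mem hh' hx' hα') hh'.1
  have h2 := E'.transforms (h, _, _) (S.triple_mem hh' hJo (P.shift_mem S hp hh' hα)) hh'.1
  have hB := E'.coeff_ne S.c_ne (S.pair_mem hh' (P.shift_mem S hp hh' hα))
  simp only [conjData] at *
  rw [hal] at h2
  set t := b (h, A₀ (h, α)) with ht
  set z := (J h (A₀ (h, α))).symm (A₁ (h, α) * x) with hz
  rw [mul_inv_cancel_left₀ hB] at h2
  rw [h1]
  have hzy : J h (A₀ (h, α)) z = A₁ (h, α) * x := by simp [hz]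
  have h3 := (hJ h hh _ hβ).2.1 z (hJ.symm_mem hh hβ hy)
  rw [hzy] at h3
  have h4 : (J h (A₀ (h, α))).symm (normalForm (fun h η β => e (h, η, β)) h (A₁ (h, α) * x)
      (A₀ (h, α))) = normalForm (fun h η β => e' (h, η, β)) h z (A₀ (h, α)) := by
    rw [OrderIso.symm_apply_eq]
    exact h3.symm
  rw [h4, ← h2, inv_mul_cancel_left₀ hB]

theorem isCloseConjugacy_conjData {p : ℕ} (hp : 1 ≤ p)
    (E : IsGoodExpansion (p + 3) s K c d Φ A₀ A₁ e)
    (E' : IsGoodExpansion (p + 3) s K c d φ B₀ B₁ e') (hd : d ≠ 0)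
    (P : IsGoodPair p s K A₀ A₁ e B₀ B₁ e' b) (S : IsScale s K c h₀ ε r ρ)
    (hJ : IsNFConjugacy p K h₀ ε e e' J) :
    (conjData h₀ ε r ρ A₀ A₁ e B₀ B₁ e' b J).IsCloseConjugacy p Φ φ
      (2100 * K + 4202 * K / |c|) := by
  have hK : 0 < K := by linarith [S.one_le_K]
  have hc := abs_pos.2 S.c_ne
  have hC1 : K ≤ 2100 * K + 4202 * K / |c| := by
    have : 0 ≤ 4202 * K / |c| := by positivity
    linarith
  have hC2 : 2100 * K ≤ 2100 * K + 4202 * K / |c| := by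
    have : 0 ≤ 4202 * K / |c| := by positivity
    linarith
  have hC3 : 4202 * K / |c| ≤ 2100 * K + 4202 * K / |c| := by linarith
  have hle : ∀ {C u h : ℝ}, C ≤ 2100 * K + 4202 * K / |c| → 0 ≤ h → u ≤ C * h ^ p →
      u ≤ (2100 * K + 4202 * K / |c|) * h ^ p := fun h1 h2 h3 =>
    h3.trans (mul_le_mul_of_nonneg_right h1 (pow_nonneg h2 p))
  have hIoc : ∀ {h}, h ∈ Ioc 0 h₀ → h ∈ Icc 0 h₀ := fun hh => ⟨hh.1.le, hh.2⟩
  exact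
  { h₀_pos := S.h₀_pos
    ε₀_pos := S.ε_pos
    α₀_pos := by have := S.ε_pos; simp only [conjData]; positivity
    r'_pos := half_pos S.r_pos
    r'_le := half_le_self S.r_pos.le
    ρ'_pos := half_pos S.ρ_pos
    ρ'_le := half_le_self S.ρ_pos.le
    reductionΦ := E.normalFormReduction S
    reductionφ := E'.normalFormReduction S
    coord_close := fun h hh x hx α hα => by
      refine hle hC1 hh.1 ?_
      have h1 := P.close₁ (h, α) (S.pair_mem hh hα) hh.1
      have h2 : |x| ≤ 1 := (abs_le.2 hx).trans (S.r_le.trans S.s_le)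
      calc |A₁ (h, α) * x - B₁ (h, α) * x| = |A₁ (h, α) - B₁ (h, α)| * |x| := by
            rw [← abs_mul]; congr 1; ring
        _ ≤ K * h ^ p * 1 :=
            mul_le_mul h1 h2 (abs_nonneg _) (mul_nonneg hK.le (pow_nonneg hh.1 p))
        _ = K * h ^ p := mul_one _
    param_close := fun h hh α hα => hle hC1 hh.1 (P.close₀ (h, α) (S.pair_mem hh hα) hh.1)
    tail_close := fun h hh η hη β hβ =>
      hle hC1 hh.1 (P.close_tail (h, η, β) (S.nfTriple_mem hh hη hβ) hh.1)
    built := fun h hh β hβ => (hJ h hh β hβ).1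
    conj := fun h hh β hβ =>
      { continuousOn := (J h β).continuous.continuousOn
        injOn := (J h β).injective.injOn
        mapsTo := fun x hx => ((hJ h hh β hβ).2.2.1 x).2 hx
        conj := fun x hx _ => (hJ h hh β hβ).2.1 x hx }
    mono := fun h hh β hβ => (J h β).strictMono.strictMonoOn _
    surj := fun h hh β hβ y hy =>
      ⟨(J h β).symm y, hJ.symm_mem hh hβ hy, (J h β).apply_symm_apply y⟩
    close := fun h hh x hx β hβ => hle hC2 hh.1.le
      (((hJ h hh β hβ).2.2.2 x hx).trans_eq (by ring))
    shift_maps := fun h hh α hα => P.shift_mem S hp (hIoc hh) hα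
    shift_continuousOn := fun h hh α hα => by
      have h1 : ContinuousAt (fun α : ℝ => ((h, α) : ℝ × ℝ)) α := by fun_prop
      exact (ContinuousAt.comp (f := fun α : ℝ => ((h, α) : ℝ × ℝ)) (x := α)
        (P.shift_smooth _ (S.pair_mem (hIoc hh) (IsScale.half_mem hα))) h1).continuousWithinAt
    shift_mono := fun h hh α hα α' hα' hlt => by
      -- otherwise `A₀` and `B₀` would be monotone in opposite directions
      by_contra hge
      have h1 := E.slope_pos hd (S.pair_mem (hIoc hh) (IsScale.half_mem hα))
        (S.pair_mem (hIoc hh) (IsScale.half_mem hα')) hlt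
      have e1 := P.shift_aligns _ (S.pair_mem (hIoc hh) (IsScale.half_mem hα))
      have e2 := P.shift_aligns _ (S.pair_mem (hIoc hh) (IsScale.half_mem hα'))
      simp only at e1 e2
      rw [← e1, ← e2] at h1
      simp only [conjData] at hge
      rcases (not_lt.1 hge).lt_or_eq with h2 | h2
      · have h3 := E'.slope_pos hd (S.pair_mem (hIoc hh) (P.shift_mem S hp (hIoc hh) hα'))
          (S.pair_mem (hIoc hh) (P.shift_mem S hp (hIoc hh) hα)) h2
        linarith
      · rw [h2] at h1
        simp at h1
    shift_aligns := fun h hh α hα =>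
      P.shift_aligns _ (S.pair_mem (hIoc hh) (IsScale.half_mem hα))
    shift_close := fun h hh α hα => by
      refine hle hC1 hh.1.le ?_
      rw [abs_sub_comm]
      exact P.shift_close (h, α) (S.pair_mem (hIoc hh) (IsScale.half_mem hα)) hh.1.le
    orig_eq := fun h hh x hx α hα => by
      have hB := E'.coeff_ne S.c_ne (S.pair_mem (hIoc hh) (P.shift_mem S hp (hIoc hh) hα))
      simp only [conjData]
      rw [mul_inv_cancel_left₀ hB, OrderIso.apply_symm_apply]
    orig_conj := fun h hh α hα =>
      { continuousOn := by
          refine Continuous.continuousOn ?_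
          simp only [conjData]
          exact continuous_const.mul ((OrderIso.continuous _).comp (continuous_const.mul continuous_id))
        injOn := (conjData_orig_mono E E' P S hp (hIoc hh) hα).injective.injOn
        mapsTo := fun x hx => conjData_orig_maps E E' P S hp hJ hh hx hα
        conj := fun x hx _ => conjData_orig_conj E E' P S hp hJ hh hx hα }
    orig_mono := fun h hh α hα =>
      (conjData_orig_mono E E' P S hp (hIoc hh) hα).strictMonoOn _
    orig_close := fun h hh x hx α hα => hle hC3 hh.1.le
      (conjData_orig_close E E' P S hp hJ hh hx hα) }

end

/-! ### Existence of the close conjugacy -/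

section

variable {p : ℕ} {Φ φ : ℝ → ℝ → ℝ → ℝ} {A₀ A₁ B₀ B₁ a b : ℝ × ℝ → ℝ} {A₂ B₂ : ℝ × ℝ × ℝ → ℝ}

theorem AreClose.coeff_eq (hp : 1 ≤ p) (hAB : AreClose p A₀ A₁ A₂ B₀ B₁ B₂) : A₁ 0 = B₁ 0 := by
  obtain ⟨K, hK⟩ := hAB.close₁.eventually_abs_le.exists
  obtain ⟨s, hs, hs0⟩ := (hK.and self_mem_nhdsWithin).exists
  have := hs 0 (by rw [norm_zero]; exact le_of_lt hs0) le_rfl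
  rw [Prod.fst_zero, zero_pow (by lia), mul_zero] at this
  exact sub_eq_zero.1 (abs_nonpos_iff.1 this)

theorem AreClose.deriv_param_eq (hp : 1 ≤ p) (hAB : AreClose p A₀ A₁ A₂ B₀ B₁ B₂) :
    deriv (fun α => A₀ (0, α)) 0 = deriv (fun α => B₀ (0, α)) 0 := by
  obtain ⟨K, hK⟩ := hAB.close₀.eventually_abs_le.exists
  obtain ⟨s, hs, hs0⟩ := (hK.and self_mem_nhdsWithin).exists
  refine EventuallyEq.deriv_eq ?_
  filter_upwards [Icc_mem_nhds (neg_lt_zero.2 hs0) hs0] with α hα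
  have := hs (0, α) (norm_pair_le (by simpa using le_of_lt hs0) (abs_le.2 hα)) le_rfl
  simp only [zero_pow (show p ≠ 0 by lia), mul_zero] at this
  exact sub_eq_zero.1 (abs_nonpos_iff.1 this)

/-- Everything needed for the conjugacy exists on a scale `s` that may be taken arbitrarily
small. -/
theorem AreClose.exists_scale (hp : 1 ≤ p) (hAB : AreClose p A₀ A₁ A₂ B₀ B₁ B₂)
    (hA : HasExpansion (p + 3) Φ A₀ A₁ A₂) (hB : HasExpansion (p + 3) φ B₀ B₁ B₂)
    (ha : IsParamInverse (p + 3) A₀ a) (hb : IsParamInverse (p + 3) B₀ b) {Q : ℝ → Prop}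
    (hQ : ∀ᶠ s in 𝓝[>] (0 : ℝ), Q s) :
    ∃ s K h₀ ε r ρ J, Q s ∧
      IsGoodExpansion (p + 3) s K (A₁ 0) (deriv (fun α => A₀ (0, α)) 0) Φ A₀ A₁ (nfTail A₁ A₂ a) ∧
      IsGoodExpansion (p + 3) s K (A₁ 0) (deriv (fun α => A₀ (0, α)) 0) φ B₀ B₁ (nfTail B₁ B₂ b) ∧
      IsGoodPair p s K A₀ A₁ (nfTail A₁ A₂ a) B₀ B₁ (nfTail B₁ B₂ b) b ∧
      IsScale s K (A₁ 0) h₀ ε r ρ ∧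
      IsNFConjugacy p K h₀ ε (nfTail A₁ A₂ a) (nfTail B₁ B₂ b) J := by
  have hm : p + 3 ≠ 0 := by lia
  obtain ⟨K, ⟨⟨k1, k2⟩, k3⟩, hK⟩ := (((hA.eventually_isGoodExpansion hm ha).and
    (hB.eventually_isGoodExpansion hm hb)).and
    (hAB.eventually_isGoodPair hm hA hB ha hb) |>.and (eventually_ge_atTop 1)).exists
  obtain ⟨s, ⟨⟨⟨⟨E, E'⟩, P⟩, hs⟩, hs0, hs1⟩⟩ := ((((k1.and k2).and k3).and hQ).and
    (Ioo_mem_nhdsGT (zero_lt_one' ℝ))).exists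
  rw [← hAB.coeff_eq hp, ← hAB.deriv_param_eq hp] at E'
  obtain ⟨h₀, ε, r, ρ, S⟩ := exists_isScale hs0 hs1.le hK hA.ne_zero
  obtain ⟨J, hJ⟩ := exists_isNFConjugacy E E' P S
  exact ⟨s, K, h₀, ε, r, ρ, J, hs, E, E', P, S, hJ⟩

theorem TCHypotheses.exists_isCloseConjugacy (hp : 1 ≤ p) {f : ℝ → ℝ → ℝ}
    (H : TCHypotheses p (p + 7) f φ) :
    ∃ (D : TCData) (C : ℝ), 0 < C ∧ D.IsCloseConjugacy p (timeMap f) φ C := by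
  obtain ⟨A₀, A₁, A₂, B₀, B₁, B₂, hA, hB, hAB⟩ := H.exists_expansions hp
  obtain ⟨a, ha⟩ := exists_paramInverse (by lia) hA.smooth₀ hA.zero hA.deriv_ne_zero
  obtain ⟨b, hb⟩ := exists_paramInverse (by lia) hB.smooth₀ hB.zero hB.deriv_ne_zero
  obtain ⟨s, K, h₀, ε, r, ρ, J, -, E, E', P, S, hJ⟩ :=
    hAB.exists_scale hp hA hB ha hb (Q := fun _ => True) (by simp)
  have hK : 0 < K := by linarith [S.one_le_K]
  have hc := abs_pos.2 S.c_ne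
  exact ⟨_, _, by positivity, isCloseConjugacy_conjData hp E E' hA.deriv_ne_zero P S hJ⟩

end

/-! ### Optimality of the order -/

/-- Fixed points of two normal forms are apart by at least a multiple of the difference of the
tails. -/
theorem TailBound.fixed_gap {ε K h β γ x y : ℝ} {e e' : ℝ → ℝ} (he : TailBound ε K e)
    (hs : SmallParams ε K h β) (hx : x ∈ Icc (-ε) ε) (hy : y ∈ Icc (-ε) ε)
    (hfx : nfMap e' h β x = x) (hfy : nfMap e h β y = y) (hγ1 : γ ≤ 1)
    (hγ : γ ≤ |e x - e' x|) : γ * x ^ 2 / 2 ≤ |x - y| := by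
  have hroot : ∀ {e : ℝ → ℝ} {x : ℝ}, nfMap e h β x = x → x = 0 ∨ nfRate e β x = 0 := by
    intro e x hx
    rw [nfMap_eq, add_eq_left, mul_eq_zero, mul_eq_zero] at hx
    exact hx.resolve_left hs.h_pos.ne'
  rcases hroot hfx with rfl | hx0
  · simp
  have hx1 : |x| ≤ 1 := (abs_le.2 hx).trans (by linarith [hs.ε_le])
  rcases hroot hfy with rfl | hy0
  · rw [sub_zero, ← sq_abs]
    nlinarith [abs_nonneg x, mul_le_mul_of_nonneg_right hγ1 (sq_nonneg |x|)]
  · obtain ⟨E, hE, h1⟩ := he.exists_nfRate_sub hs hx hy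
    have h2 : x ^ 2 * (e x - e' x) = (x - y) * (1 + E) := by
      have : nfRate e β x - nfRate e' β x = x ^ 2 * (e x - e' x) := by
        rw [nfRate, nfRate]; ring
      rw [← this, hx0, sub_zero]
      linear_combination hy0 - h1
    have h3 : γ * x ^ 2 ≤ |x - y| * |1 + E| := by
      rw [← abs_mul, ← h2, abs_mul, abs_of_nonneg (sq_nonneg x), mul_comm]
      exact mul_le_mul_of_nonneg_left hγ (sq_nonneg x)
    have h4 : |1 + E| ≤ 2 := by
      rw [abs_le] at hE ⊢
      constructor <;> linarith [hE.1, hE.2]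
    nlinarith [abs_nonneg (x - y)]

section

variable {m p : ℕ} {s K c d h₀ ε r ρ γ : ℝ} {Φ φ : ℝ → ℝ → ℝ → ℝ} {A₀ A₁ B₀ b : ℝ × ℝ → ℝ}
  {e e' : ℝ × ℝ × ℝ → ℝ} {J : ℝ → ℝ → (ℝ ≃o ℝ)}

theorem normal_gap (E : IsGoodExpansion m s K c d Φ A₀ A₁ e)
    (E' : IsGoodExpansion m s K c d φ A₀ A₁ e') (S : IsScale s K c h₀ ε r ρ)
    (hγ0 : 0 ≤ γ) (hγ1 : γ ≤ 1) {h β : ℝ} (hh : h ∈ Ioc 0 h₀)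
    (hβ : β ∈ Icc (-(ε / 8)) (ε / 8))
    (hγ : ∀ η ∈ Icc (-ε) ε, γ ≤ |e (h, η, β) - e' (h, η, β)|) {k : ℝ → ℝ}
    (hk : IsConjugacyOn (nfMap (fun η => e' (h, η, β)) h β) (nfMap (fun η => e (h, η, β)) h β)
      (Icc (-ε) ε) (Icc (-ε) ε) k) :
    ∃ x ∈ Icc (-ε) ε, γ * β ^ 2 / 8 ≤ |x - k x| := by
  have hs := S.smallParams hh hβ
  have hh' : h ∈ Icc 0 h₀ := ⟨hh.1.le, hh.2⟩
  obtain ⟨ω, hω, hω0, hωβ⟩ := (E'.tailBound S hh' hβ).exists_root hs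
  have hω' : ω ∈ Icc (-ε) ε := ⟨hω.1.le, hω.2.le⟩
  have hfix : nfMap (fun η => e' (h, η, β)) h β ω = ω := by
    rw [nfMap_eq, hω0]; ring
  have h1 := hk.conj ω hω' (by rwa [hfix])
  rw [hfix] at h1
  have h2 := (E.tailBound S hh' hβ).fixed_gap hs hω' (hk.mapsTo hω') hfix h1.symm hγ1 (hγ ω hω')
  refine ⟨ω, hω', le_trans ?_ h2⟩
  have h3 : |β| ≤ 2 * |ω| := by
    have := abs_sub (ω + β) ω
    rw [add_sub_cancel_left] at this
    linarith [abs_nonneg ω]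
  have h4 : β ^ 2 ≤ 4 * ω ^ 2 := by
    rw [← sq_abs β, ← sq_abs ω]
    nlinarith [abs_nonneg β, abs_nonneg ω]
  nlinarith [mul_le_mul_of_nonneg_left h4 hγ0]

theorem orig_gap (E : IsGoodExpansion m s K c d Φ A₀ A₁ e)
    (E' : IsGoodExpansion m s K c d φ A₀ A₁ e') (S : IsScale s K c h₀ ε r ρ)
    (hγ0 : 0 ≤ γ) (hγ1 : γ ≤ 1) {h x α : ℝ} (hh : h ∈ Ioc 0 h₀) (hα : α ∈ Icc (-ρ) ρ)
    (hx : x ∈ Icc (-r) r) (hfix : Φ h x α = x)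
    (hγ : ∀ η ∈ Icc (-ε) ε, γ ≤ |e' (h, η, A₀ (h, α)) - e (h, η, A₀ (h, α))|) {y : ℝ}
    (hy : y ∈ Icc (-r) r) (hfy : φ h y α = y) : γ * |c| / 16 * x ^ 2 ≤ |x - y| := by
  have hh' : h ∈ Icc 0 h₀ := ⟨hh.1.le, hh.2⟩
  have hβ := E.param_maps S hh' hα
  have hq := S.pair_mem hh' hα
  have h1 := E.transforms _ (S.triple_mem hh' hx hα) hh'.1
  have h2 := E'.transforms _ (S.triple_mem hh' hy hα) hh'.1
  simp only at h1 h2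
  rw [hfix] at h1
  rw [hfy] at h2
  have hX := E.coord_maps S hh' hx hα
  have hY := E.coord_maps S hh' hy hα
  have h3 := (E'.tailBound S hh' hβ).fixed_gap
    (e' := fun η => e (h, η, A₀ (h, α))) (S.smallParams hh hβ) hX hY h1.symm h2.symm hγ1
    (hγ _ hX)
  rw [← mul_sub, abs_mul] at h3
  have h4 := E.le_abs_coeff hq
  have h5 := E.abs_coeff_le hq
  have hc := abs_pos.2 S.c_ne
  have h6 : (|c| / 2) ^ 2 * x ^ 2 ≤ (A₁ (h, α) * x) ^ 2 := by
    rw [mul_pow, ← sq_abs (A₁ (h, α))]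
    exact mul_le_mul_of_nonneg_right (pow_le_pow_left₀ (by positivity) h4 2) (sq_nonneg x)
  have h7 : |A₁ (h, α)| * |x - y| ≤ 2 * |c| * |x - y| :=
    mul_le_mul_of_nonneg_right h5 (abs_nonneg _)
  have h8 : γ * ((|c| / 2) ^ 2 * x ^ 2) ≤ γ * (A₁ (h, α) * x) ^ 2 :=
    mul_le_mul_of_nonneg_left h6 hγ0
  refine le_of_mul_le_mul_left (a := 2 * |c|) ?_ (by positivity)
  nlinarith

end

/-- The vector field `α x + x²`. -/
def quadField (x α : ℝ) : ℝ := α * x + x ^ 2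

/-- The exact time-`h` map of `x' = α x + x²`, perturbed by `h^(p+1) x³`. -/
def cubicMethod (p : ℕ) (h x α : ℝ) : ℝ := timeMap quadField h x α + h ^ (p + 1) * x ^ 3

theorem contDiff_quadField {n : WithTop ℕ∞} :
    ContDiff ℝ n (fun q : ℝ × ℝ => quadField q.1 q.2) := by
  unfold quadField
  fun_prop

theorem hasDerivAt_quadField (x α : ℝ) : HasDerivAt (fun x => quadField x α) (α + 2 * x) x :=
  (((hasDerivAt_id x).const_mul α).add (hasDerivAt_pow 2 x)).congr_deriv (by simp)

theorem quadField_transcritical : TranscriticalConditions quadField := by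
  have h : ∀ α, deriv (fun x => quadField x α) = fun x => α + 2 * x :=
    fun α => funext fun x => (hasDerivAt_quadField x α).deriv
  refine ⟨⟨1, one_pos, fun α _ => by simp [quadField]⟩, by simp [h], ?_, ?_⟩
  · rw [h]
    have : HasDerivAt (fun x : ℝ => 0 + 2 * x) (2 * 1) 0 :=
      ((hasDerivAt_id (0 : ℝ)).const_mul 2).const_add 0
    rw [this.deriv]
    norm_num
  · simp [h]

theorem smoothNearOrigin_cubicMethod (p k : ℕ) : SmoothNearOrigin k (cubicMethod p) := by
  obtain ⟨g, hg, hΦ, -⟩ := exists_timeMap_increment (n := k + 1) (by lia)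
    (contDiff_quadField (n := ((k + 1 : ℕ) : WithTop ℕ∞)))
  have hk : (k : WithTop ℕ∞) ≤ ((k + 1 : ℕ) : WithTop ℕ∞) := by exact_mod_cast Nat.le_succ k
  have hg' : ContDiffAt ℝ k g (0, 0, 0) := hg.of_le hk
  obtain ⟨s, hs, hs0⟩ := ((eventually_of_norm_le hΦ).and self_mem_nhdsWithin).exists
  have hs0 : 0 < s := hs0
  refine ⟨fun q => q.2.1 + q.1 * g q + q.1 ^ (p + 1) * q.2.1 ^ 3, by fun_prop,
    s, hs0, s, hs0, s, hs0, fun h hh x hx α hα => ?_⟩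
  have := hs (h, x, α) (norm_triple_le (by rw [abs_of_nonneg hh.1]; exact hh.2) (abs_le.2 hx)
    (abs_le.2 hα)) hh.1
  simp only at this
  rw [cubicMethod, this]

theorem cubicMethod_hypotheses (p k : ℕ) : TCHypotheses p k quadField (cubicMethod p) where
  smooth_f := contDiff_quadField
  smooth_φ := smoothNearOrigin_cubicMethod p k
  transcritical := quadField_transcritical
  order := by
    refine ⟨1, one_pos, 1, one_pos, 1, one_pos, 1, one_pos, fun h hh x hx α hα => ?_⟩
    rw [cubicMethod, sub_add_cancel_left, abs_neg, abs_mul, abs_of_nonneg (pow_nonneg hh.1 _),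
      abs_pow, mul_comm]
    exact mul_le_mul_of_nonneg_right (pow_le_one₀ (abs_nonneg x) (abs_le.2 hx))
      (pow_nonneg hh.1 _)
  equilibrium := by
    refine ⟨1, one_pos, 1, one_pos, fun h hh α hα => ?_⟩
    rw [cubicMethod, timeMap_equilibrium hh.1 contDiff_quadField (by simp [quadField])]
    simp

theorem HasExpansion.cubicMethod {p m : ℕ} {A₀ A₁ : ℝ × ℝ → ℝ} {A₂ : ℝ × ℝ × ℝ → ℝ}
    (hA : HasExpansion m (timeMap quadField) A₀ A₁ A₂) :
    HasExpansion m (cubicMethod p) A₀ A₁ (fun q => A₂ q + q.1 ^ p) where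
  smooth₀ := hA.smooth₀
  smooth₁ := hA.smooth₁
  smooth₂ := hA.smooth₂.add (by fun_prop)
  eq := by
    filter_upwards [hA.eq] with q hq h0
    rw [_root_.cubicMethod, hq h0]
    ring
  zero := hA.zero
  ne_zero := hA.ne_zero
  deriv_ne_zero := hA.deriv_ne_zero

theorem areClose_add_pow (p : ℕ) (A₀ A₁ : ℝ × ℝ → ℝ) (A₂ : ℝ × ℝ × ℝ → ℝ) :
    AreClose p A₀ A₁ A₂ A₀ A₁ (fun q => A₂ q + q.1 ^ p) where
  close₀ := by simpa only [sub_self] using Asymptotics.isBigO_zero _ _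
  close₁ := by simpa only [sub_self] using Asymptotics.isBigO_zero _ _
  close₂ := by
    simpa only [sub_add_cancel_left] using (Asymptotics.isBigO_refl _ _).neg_left

theorem nfTail_add_pow (p : ℕ) (A₁ a : ℝ × ℝ → ℝ) (A₂ : ℝ × ℝ × ℝ → ℝ) (q : ℝ × ℝ × ℝ) :
    nfTail A₁ (fun q => A₂ q + q.1 ^ p) a q - nfTail A₁ A₂ a q =
      q.1 ^ p * ((A₁ (q.1, a (q.1, q.2.2)))⁻¹ * (A₁ (q.1, a (q.1, q.2.2)))⁻¹) := by
  simp only [nfTail]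
  ring

/-- Fixed points of the exact map and of the perturbed one differ by at least a multiple of `h^p`
and of the square of the parameter; conjugacies preserve fixed points. -/
theorem exists_optimal {p : ℕ} (hp : 1 ≤ p) :
    ∃ (D : TCData) (C c : ℝ), 0 < C ∧ 0 < c ∧
      D.IsCloseConjugacy p (timeMap quadField) (cubicMethod p) C ∧
      D.IsOptimal p (timeMap quadField) (cubicMethod p) c := by
  obtain ⟨A₀, A₁, A₂, -, -, -, hA, -, -⟩ := (cubicMethod_hypotheses p (p + 7)).exists_expansions hp
  obtain ⟨a, ha⟩ := exists_paramInverse (by lia) hA.smooth₀ hA.zero hA.deriv_ne_zero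
  have hc := abs_pos.2 hA.ne_zero
  have hinv : ∀ᶠ q in 𝓝 (0 : ℝ × ℝ × ℝ), |A₁ (q.1, a (q.1, q.2.2))| < 2 * |A₁ 0| ∧
      A₁ (q.1, a (q.1, q.2.2)) ≠ 0 := by
    have h1 := hA.smooth₁.continuousAt.tendsto.comp ha.tendsto_paramPoint
    exact (h1.abs.eventually_lt_const (by linarith)).and (h1.eventually_ne hA.ne_zero)
  obtain ⟨s, K, h₀, ε, r, ρ, J, ⟨hQ1, hQ2⟩, E, E', P, S, hJ⟩ :=
    (areClose_add_pow p A₀ A₁ A₂).exists_scale hp hA hA.cubicMethod ha ha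
      ((eventually_of_norm_le hinv).and (eventually_of_norm_le ha.left_inv))
  have hK : 0 < K := by linarith [S.one_le_K]
  -- the tails differ by at least `γ h^p`
  obtain ⟨γ, hγ, hγ1, hγ2⟩ : ∃ γ, 0 < γ ∧ γ ≤ 1 ∧ γ * (2 * |A₁ 0|) ^ 2 ≤ 1 :=
    ⟨min 1 (1 / (2 * |A₁ 0|) ^ 2), by positivity, min_le_left _ _, by
      rw [← le_div_iff₀ (by positivity)]; exact min_le_right _ _⟩
  have hgap : ∀ {h η β : ℝ}, h ∈ Ioc 0 h₀ → η ∈ Icc (-ε) ε → β ∈ Icc (-(ε / 8)) (ε / 8) →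
      γ * h ^ p ≤ |nfTail A₁ (fun q => A₂ q + q.1 ^ p) a (h, η, β) - nfTail A₁ A₂ a (h, η, β)| := by
    intro h η β hh hη hβ
    obtain ⟨h1, h2⟩ := hQ1 (h, η, β) (S.nfTriple_mem ⟨hh.1.le, hh.2⟩ hη hβ)
    have hhp := pow_nonneg hh.1.le p
    rw [nfTail_add_pow, ← mul_inv, ← sq, abs_mul, abs_of_nonneg hhp,
      abs_of_nonneg (inv_nonneg.2 (sq_nonneg _)), mul_comm]
    refine mul_le_mul_of_nonneg_left ?_ hhp
    simp only at h1 h2 ⊢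
    rw [← one_div, le_div_iff₀ (by positivity)]
    refine le_trans (mul_le_mul_of_nonneg_left ?_ hγ.le) hγ2
    rw [← sq_abs]
    exact pow_le_pow_left₀ (abs_nonneg _) h1.le 2
  have hγh : ∀ {h : ℝ}, h ∈ Ioc 0 h₀ → 0 ≤ γ * h ^ p ∧ γ * h ^ p ≤ 1 := by
    intro h hh
    have h1 : h ≤ 1 := by
      have := S.step_mem ⟨hh.1.le, hh.2⟩
      linarith [le_abs_self h, S.s_le]
    exact ⟨mul_nonneg hγ.le (pow_nonneg hh.1.le p),
      mul_le_one₀ hγ1 (pow_nonneg hh.1.le p) (pow_le_one₀ hh.1.le h1)⟩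
  refine ⟨_, _, min (γ / 8) (γ * |A₁ 0| / 16), by positivity, by positivity,
    isCloseConjugacy_conjData hp E E' hA.deriv_ne_zero P S hJ, ⟨?_, ?_⟩⟩
  · intro h hh β hβ k hk
    obtain ⟨x, hx, h1⟩ := normal_gap E E' S (hγh hh).1 (hγh hh).2 hh hβ
      (fun η hη => by rw [abs_sub_comm]; exact hgap hh hη hβ) hk
    refine ⟨x, hx, le_trans ?_ h1⟩
    have h2 : 0 ≤ β ^ 2 * h ^ p := mul_nonneg (sq_nonneg β) (pow_nonneg hh.1.le p)
    have h3 := mul_le_mul_of_nonneg_right (min_le_left (γ / 8) (γ * |A₁ 0| / 16)) h2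
    linarith
  · intro h hh α hα k hk
    have hα : α ∈ Icc (-(ρ / 2)) (ρ / 2) := hα
    have hh' : h ∈ Icc 0 h₀ := ⟨hh.1.le, hh.2⟩
    have hα' := IsScale.half_mem hα
    -- `-α` is an equilibrium of the vector field, and the parameter shift is the identity
    have hx : -α ∈ Icc (-(r / 2)) (r / 2) := by
      have := S.ρ_le_r
      exact ⟨by linarith [hα.2], by linarith [hα.1]⟩
    have hfix : timeMap quadField h (-α) α = -α :=
      timeMap_equilibrium hh'.1 contDiff_quadField (by rw [quadField]; ring)
    have hshift : a (h, A₀ (h, α)) = α := hQ2 _ (S.pair_mem hh' hα')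
    have h1 := hk.conj (-α) hx (by rwa [hfix])
    simp only [conjData] at h1
    rw [hfix, hshift] at h1
    have h2 := orig_gap E E' S (hγh hh).1 (hγh hh).2 hh hα' (IsScale.half_mem hx) hfix
      (fun η hη => hgap hh hη (E.param_maps S hh' hα')) (hk.mapsTo hx) h1.symm
    refine ⟨-α, hx, le_trans ?_ h2⟩
    have h3 : 0 ≤ α ^ 2 * h ^ p := mul_nonneg (sq_nonneg α) (pow_nonneg hh.1.le p)
    have h4 := mul_le_mul_of_nonneg_right (min_le_right (γ / 8) (γ * |A₁ 0| / 16)) h3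
    rw [neg_sq]
    linarith

end

theorem mainTheorem1 (p : ℕ) (hp : 1 ≤ p) :
    (∃ k : ℕ, ∀ (f : ℝ → ℝ → ℝ) (φ : ℝ → ℝ → ℝ → ℝ), TCHypotheses p k f φ →
      ∃ (D : TCData) (C : ℝ), 0 < C ∧ D.IsCloseConjugacy p (timeMap f) φ C) ∧
    (∃ (f : ℝ → ℝ → ℝ) (φ : ℝ → ℝ → ℝ → ℝ), (∀ k : ℕ, TCHypotheses p k f φ) ∧
      ∃ (D : TCData) (C c : ℝ), 0 < C ∧ 0 < c ∧
        D.IsCloseConjugacy p (timeMap f) φ C ∧ D.IsOptimal p (timeMap f) φ c) :=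
  ⟨⟨p + 7, fun _ _ H => H.exists_isCloseConjugacy hp⟩,
    quadField, cubicMethod p, cubicMethod_hypotheses p, exists_optimal hp⟩
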